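/- Let $m\le n$ and let $M$ be a compact smooth manifold of dimension $m$, possibly with boundary. Let $\Omega^1(M,\mathbb R^n)$ be the Fréchet space of smooth $\mathbb R^n$-valued one-forms on $M$, and let $\Omega^1_+(M,\mathbb R^n)$ be its open subset of full-ranked one-forms, i.e. of those $\alpha$ for which $\alpha(x):T_xM\to\mathbb R^n$ is injective for every $x\in M$. Equip $\Omega^1_+(M,\mathbb R^n)$ with the generalized Ebin metric $$G_\alpha(\zeta,\eta)=\int_M \operatorname{tr}\!\big(\zeta_x(\alpha_x^T\alpha_x)^{-1}\eta_x^T\big)\sqrt{\det(\alpha_x^T\alpha_x)}\,dx,\qquad \zeta,\eta\in T_\alpha\Omega^1_+(M,\mathbb R^n)=\Omega^1(M,\mathbb R^n),$$ where, in local coordinates, $\alpha_x,\zeta_x,\eta_x$ are written as $n\times m$ matrices (the integrand is a density on $M$ that does not depend on the coordinates). Let $\mathrm{Gr}(m,n)$ be the Grassmannian of $m$-dimensional linear subspaces of $\mathbb R^n$, let $\xi$ be its tautological $m$-plane bundle, and for $\alpha\in\Omega^1_+(M,\mathbb R^n)$ let $W(\alpha):M\to\mathrm{Gr}(m,n)$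 be the map $W(\alpha)(x)=\alpha(T_xM)$. A geodesic of a submanifold $\mathcal N$ of $\Omega^1_+(M,\mathbb R^n)$ is a smooth curve $c$ in $\mathcal N$, on an open interval, that on each compact subinterval $[a,b]$ is a critical point of the energy $\int_a^b G_c(\partial_t c,\partial_t c)\,dt$ under smooth variations in $\mathcal N$ with fixed end points. A subset $\mathcal N\subseteq\Omega^1_+(M,\mathbb R^n)$ is called totally geodesic if it is a (split) submanifold, every geodesic of $\mathcal N$ is a geodesic of $\Omega^1_+(M,\mathbb R^n)$, every vector tangent to $\mathcal N$ is the initial velocity of a geodesic of $\Omega^1_+(M,\mathbb R^n)$ that runs in $\mathcal N$, and every geodesic of $\Omega^1_+(M,\mathbb R^n)$ that at time $0$ passes through a point of $\mathcal N$ with velocity tangent to $\mathcal N$ stays in $\mathcal N$ for all sufficiently small times. Then: (1) For every $\alpha_0\in\Omega^1_+(M,\mathbb R^n)$, the space of scalings $\mathcal A=\{t\alpha_0 \mid t\in\mathbb R_{>0}\}$ is totally geodesic. (2) For every $f_0\in C^\infty(M,\mathrm{Gr}(m,n))$, the space $\mathcal B=\{\alpha\in\Omega^1_+(M,\mathbb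 R^n)\mid W(\alpha)=f_0\}$ is totally geodesic. (It is non-empty if and only if $TM\cong f_0^*(\xi)$ as vector bundles over $M$.) -/

import Mathlib

open Set Bundle MeasureTheory
open scoped Manifold ContDiff Matrix

noncomputable section

namespace EbinOneForms

/-- The tangent coordinate space `ℝᵐ` (and the target `ℝⁿ`), with the Euclidean norm. -/
abbrev Euc (k : ℕ) : Type := EuclideanSpace ℝ (Fin k)

variable {m : ℕ} {H : Type*} [TopologicalSpace H]
  (I : ModelWithCorners ℝ (Euc m) H)
  (M : Type*) [TopologicalSpace M] [ChartedSpace H M] [IsManifold I ∞ M] (n : ℕ)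

/-! ### One-forms, full-ranked one-forms, image planes -/

/-- `Ω¹(M, ℝⁿ)`: smooth sections `α` of the bundle `Hom(TM, M × ℝⁿ)`. -/
abbrev OneForm : Type _ :=
  Cₛ^∞⟮I; Euc m →L[ℝ] Euc n, fun x : M => TangentSpace I x →L[ℝ] Bundle.Trivial M (Euc n) x⟯

variable {M n}

/-- `Ω¹₊(M, ℝⁿ)`: the one-forms `α` such that every `α(x) : T_xM → ℝⁿ` is injective. -/
def fullRank : Set (OneForm I M n) :=
  {α | ∀ x : M, Function.Injective (α x)}

/-- The Grassmannian `Gr(m, n)` of `m`-dimensional linear subspaces of `ℝⁿ`. -/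
def Gr (m n : ℕ) : Type :=
  {V : Submodule ℝ (Euc n) // Module.finrank ℝ V = m}

/-- `f ∈ C^∞(M, Gr(m, n))`, where `Gr(m, n)` is regarded as the submanifold of `End(ℝⁿ)` formed by
the orthogonal projections of rank `m` (a plane is identified with the projection onto it). -/
def SmoothGr {k : ℕ} (f : M → Gr k n) : Prop :=
  ContMDiff I 𝓘(ℝ, Euc n →L[ℝ] Euc n) ∞
    (fun x : M => ((f x).1.starProjection : Euc n →L[ℝ] Euc n))

/-- `W(α)(x) = α(T_xM)`, as an element of `Gr(m, n)`. -/
def imagePlane (α : OneForm I M n) (hα : α ∈ fullRank I) (x : M) : Gr m n :=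
  ⟨LinearMap.range ((α x : TangentSpace I x →L[ℝ] Euc n) : TangentSpace I x →ₗ[ℝ] Euc n), by
    have h := LinearMap.finrank_range_of_inj
      (f := ((α x : TangentSpace I x →L[ℝ] Euc n) : TangentSpace I x →ₗ[ℝ] Euc n)) (hα x)
    rw [h]
    change Module.finrank ℝ (Euc m) = m
    simp⟩

/-- The ray of scalings `{t α₀ | t > 0}`. -/
def scalings (α₀ : OneForm I M n) : Set (OneForm I M n) :=
  {α | ∃ t : ℝ, 0 < t ∧ α = t • α₀}

/-- `{α ∈ Ω¹₊(M, ℝⁿ) | W(α) = f₀}`. -/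
def fixedPlanes (f₀ : M → Gr m n) : Set (OneForm I M n) :=
  {α | ∃ hα : α ∈ fullRank I, imagePlane I α hα = f₀}

/-- `TM ≅ f^*(ξ)`, where `ξ` is the tautological `m`-plane bundle over `Gr(m, n)`: there are linear
isomorphisms `T_xM → f(x)` that depend smoothly on `x` (as maps into the ambient trivial bundle
`M × ℝⁿ`, of which `f^*(ξ)` is a smooth subbundle). -/
def TangentIsoPullback (f : M → Gr m n) : Prop :=
  ∃ e : ∀ x : M, TangentSpace I x ≃L[ℝ] (f x).1,
    ContMDiff I (I.prod 𝓘(ℝ, Euc m →L[ℝ] Euc n)) ∞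
      (fun x : M => TotalSpace.mk' (Euc m →L[ℝ] Euc n)
        (E := fun x : M => TangentSpace I x →L[ℝ] Bundle.Trivial M (Euc n) x) x
        ((f x).1.subtypeL ∘L (e x : TangentSpace I x →L[ℝ] (f x).1)))

/-! ### The generalized Ebin metric -/

/-- The inner product `⟨u, v⟩_a = tr(u (aᵀa)⁻¹ vᵀ) √det(aᵀa)` on `n × m` matrices, for `a` of
rank `m`. -/
def matInner {m n : ℕ} (a u v : Matrix (Fin n) (Fin m) ℝ) : ℝ :=
  (u * (aᵀ * a)⁻¹ * vᵀ).trace * Real.sqrt (aᵀ * a).det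

/-- The `n × m` matrix of a linear map `A : T_xM → ℝⁿ` with respect to the coordinate basis
`∂/∂x¹, …, ∂/∂xᵐ` of the chart at `i` and the standard basis of `ℝⁿ` (for `x` in the domain of
that chart). -/
def coordMatrix (i x : M) (A : TangentSpace I x → Euc n) : Matrix (Fin n) (Fin m) ℝ :=
  Matrix.of fun k j =>
    (A ((trivializationAt (Euc m) (TangentSpace I) i).symmL ℝ x (EuclideanSpace.single j 1))) k

section Compact

variable (M) [T2Space M] [CompactSpace M]

/-- A smooth partition of unity `(ρ_i)` on `M`, indexed by the points `i` of `M` (only finitely many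
`ρ_i` are nonzero), with `ρ_i` supported in the domain of the chart at `i`. -/
def partition : SmoothPartitionOfUnity M I M univ :=
  (SmoothPartitionOfUnity.exists_isSubordinate_chartAt_source I M).choose

variable {M}

/-- The generalized Ebin metric `G_α(ζ, η) = ∫_M (αᵀα)⁻¹_x(ζ_x, η_x) vol(α)`, where in local
coordinates `(αᵀα)⁻¹_x(ζ_x, η_x) vol(α) = tr(ζ_x (αᵀα)_x⁻¹ η_xᵀ) √det((αᵀα)_x) dx`. The integral of
this density over `M` is computed, as usual, with a partition of unity subordinate to charts. The
arguments are families of linear maps `T_xM → ℝⁿ`, given as functions. -/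
def ebinMetric (α ζ η : ∀ x : M, TangentSpace I x → Euc n) : ℝ :=
  ∑ᶠ i : M, ∫ y in (extChartAt I i).target,
    partition I M i ((extChartAt I i).symm y) *
      matInner
        (coordMatrix I i ((extChartAt I i).symm y) (α ((extChartAt I i).symm y)))
        (coordMatrix I i ((extChartAt I i).symm y) (ζ ((extChartAt I i).symm y)))
        (coordMatrix I i ((extChartAt I i).symm y) (η ((extChartAt I i).symm y)))

/-- The velocity `∂c/∂t` of a curve of one-forms, at each point of `M` and on each tangent
vector. -/
def velocity (c : ℝ → OneForm I M n) (t : ℝ) (x : M) (v : TangentSpace I x) : Euc n :=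
  deriv (fun s : ℝ => (c s x v : Euc n)) t

/-- The energy `∫_a^b G_c(∂c/∂t, ∂c/∂t) dt` of a curve of one-forms. -/
def energy (c : ℝ → OneForm I M n) (a b : ℝ) : ℝ :=
  ∫ t in a..b, ebinMetric I (fun x v => c t x v) (velocity I c t) (velocity I c t)

end Compact

/-! ### Smooth curves, smooth maps and submanifolds

`M` is compact in all applications, so that `Ω¹(M, ℝⁿ)` is a Fréchet space for the `C^∞` topology.
Its smooth curves are the families of one-forms which are jointly smooth in time and in the point
of `M`; its open sets are the sets whose preimage under each smooth curve is open; and its smooth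
maps are the maps which send smooth curves to smooth curves. -/

/-- `c` is a smooth curve of one-forms on the open set `J` of times. -/
def SmoothCurveOn (J : Set ℝ) (c : ℝ → OneForm I M n) : Prop :=
  ContMDiffOn (𝓘(ℝ, ℝ).prod I) (I.prod 𝓘(ℝ, Euc m →L[ℝ] Euc n)) ∞
    (fun p : ℝ × M => TotalSpace.mk' (Euc m →L[ℝ] Euc n)
      (E := fun x : M => TangentSpace I x →L[ℝ] Bundle.Trivial M (Euc n) x) p.2 (c p.1 p.2))
    (J ×ˢ univ)

/-- `Γ` is a smooth two-parameter family of one-forms on the open set `S × J` of parameters. -/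
def SmoothFamilyOn (S J : Set ℝ) (Γ : ℝ → ℝ → OneForm I M n) : Prop :=
  ContMDiffOn (𝓘(ℝ, ℝ × ℝ).prod I) (I.prod 𝓘(ℝ, Euc m →L[ℝ] Euc n)) ∞
    (fun p : (ℝ × ℝ) × M => TotalSpace.mk' (Euc m →L[ℝ] Euc n)
      (E := fun x : M => TangentSpace I x →L[ℝ] Bundle.Trivial M (Euc n) x) p.2
      (Γ p.1.1 p.1.2 p.2))
    ((S ×ˢ J) ×ˢ univ)

/-- `U` is open in `Ω¹(M, ℝⁿ)`. -/
def IsOpenSet (U : Set (OneForm I M n)) : Prop :=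
  ∀ c : ℝ → OneForm I M n, SmoothCurveOn I univ c → IsOpen (c ⁻¹' U)

/-- `φ` is smooth on the open set `U` of `Ω¹(M, ℝⁿ)`. -/
def SmoothMapOn (U : Set (OneForm I M n)) (φ : OneForm I M n → OneForm I M n) : Prop :=
  ∀ c : ℝ → OneForm I M n, SmoothCurveOn I univ c → (∀ t, c t ∈ U) →
    SmoothCurveOn I univ (fun t => φ (c t))

/-- `N` is a (split) submanifold of the open subset `Ω¹₊(M, ℝⁿ)` of the Fréchet space
`Ω¹(M, ℝⁿ)`: near each of its points, a diffeomorphism `φ` between open sets, with inverse `ψ`,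
takes `N` to the range of a continuous linear projection `P`. -/
def IsSubmanifold (N : Set (OneForm I M n)) : Prop :=
  N ⊆ fullRank I ∧
  ∀ α ∈ N, ∃ (U U' : Set (OneForm I M n)) (φ ψ : OneForm I M n → OneForm I M n)
      (P : OneForm I M n →ₗ[ℝ] OneForm I M n),
    α ∈ U ∧ U ⊆ fullRank I ∧ IsOpenSet I U ∧ IsOpenSet I U' ∧
    SmoothMapOn I U φ ∧ SmoothMapOn I U' ψ ∧ MapsTo φ U U' ∧ MapsTo ψ U' U ∧ InvOn ψ φ U U' ∧
    SmoothMapOn I univ P ∧ P ∘ₗ P = P ∧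
    φ '' (N ∩ U) = (LinearMap.range P : Set (OneForm I M n)) ∩ U'

/-- `c` has velocity `ζ ∈ Ω¹(M, ℝⁿ)` at time `t`. -/
def HasVelocityAt (c : ℝ → OneForm I M n) (ζ : OneForm I M n) (t : ℝ) : Prop :=
  ∀ (x : M) (v : TangentSpace I x), HasDerivAt (fun s : ℝ => (c s x v : Euc n)) (ζ x v : Euc n) t

/-- The tangent space `T_αN`: the velocities at `α` of the smooth curves in `N` through `α`. -/
def tangentVectors (N : Set (OneForm I M n)) (α : OneForm I M n) : Set (OneForm I M n) :=
  {ζ | ∃ ε > 0, ∃ c : ℝ → OneForm I M n, SmoothCurveOn I (Ioo (-ε) ε) c ∧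
    (∀ t ∈ Ioo (-ε) ε, c t ∈ N) ∧ c 0 = α ∧ HasVelocityAt I c ζ 0}

/-! ### Geodesics and totally geodesic submanifolds -/

section Geodesics

variable [T2Space M] [CompactSpace M]

/-- `c` is a geodesic, on the open interval `J`, of the submanifold `N` with the metric induced by
the generalized Ebin metric: a smooth curve in `N` which on each `[a, b] ⊆ J` is a critical point
of the energy under smooth variations within `N` that fix the end points. -/
structure IsGeodesicIn (N : Set (OneForm I M n)) (J : Set ℝ) (c : ℝ → OneForm I M n) : Prop where
  isOpen : IsOpen J
  ordConnected : J.OrdConnected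
  smooth : SmoothCurveOn I J c
  mem : ∀ t ∈ J, c t ∈ N
  critical : ∀ a b : ℝ, a < b → Icc a b ⊆ J → ∀ ε > 0, ∀ Γ : ℝ → ℝ → OneForm I M n,
    SmoothFamilyOn I (Ioo (-ε) ε) J Γ →
    (∀ s ∈ Ioo (-ε) ε, ∀ t ∈ J, Γ s t ∈ N) →
    (∀ t ∈ J, Γ 0 t = c t) →
    (∀ s ∈ Ioo (-ε) ε, Γ s a = c a ∧ Γ s b = c b) →
    HasDerivAt (fun s : ℝ => energy I (Γ s) a b) 0 0

/-- `N` is a totally geodesic submanifold of `Ω¹₊(M, ℝⁿ)` with the generalized Ebin metric. -/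
structure IsTotallyGeodesic (N : Set (OneForm I M n)) : Prop where
  isSubmanifold : IsSubmanifold I N
  /-- Each geodesic of `N` is a geodesic of `Ω¹₊(M, ℝⁿ)`. -/
  geodesic_of_induced : ∀ (J : Set ℝ) (c : ℝ → OneForm I M n),
    IsGeodesicIn I N J c → IsGeodesicIn I (fullRank I) J c
  /-- Each vector tangent to `N` is the initial velocity of a geodesic of `Ω¹₊(M, ℝⁿ)` that runs
  in `N`. -/
  exists_geodesic : ∀ α ∈ N, ∀ ζ ∈ tangentVectors I N α,
    ∃ ε > 0, ∃ c : ℝ → OneForm I M n, IsGeodesicIn I (fullRank I) (Ioo (-ε) ε) c ∧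
      c 0 = α ∧ HasVelocityAt I c ζ 0 ∧ ∀ t ∈ Ioo (-ε) ε, c t ∈ N
  /-- Each geodesic of `Ω¹₊(M, ℝⁿ)` that starts tangentially to `N` stays in `N` for a while. -/
  geodesic_stays : ∀ (J : Set ℝ) (c : ℝ → OneForm I M n), IsGeodesicIn I (fullRank I) J c →
    0 ∈ J → c 0 ∈ N → (∃ ζ ∈ tangentVectors I N (c 0), HasVelocityAt I c ζ 0) →
    ∃ ε > 0, ∀ t ∈ J ∩ Ioo (-ε) ε, c t ∈ N

end Geodesics

end EbinOneForms

end

/-! The integrand of the metric at `x` depends only on the values of the forms at `x`. The geodesic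
equation therefore contains no derivative along `M`: it is an ODE `c'' = F(c, c')` for `n × m`
matrices, one for each point of `M`, with `F` = `geodF`. The algebra that produces `F` is
`dMatInner_sub`; `hasDerivAt_energy` turns it into the first variation formula, in which the
derivative of the energy in the direction `w` is `-2 ∫∫ ⟨c'' - F(c, c'), w⟩`. So solutions of the
ODE are geodesics. Conversely, a geodesic of a submanifold solves the ODE as soon as the test
direction `w = χ(t) (c'' - F(c, c'))`, with a bump function `χ`, can be realised inside the
submanifold, because the metric is positive definite.

Both sets of the theorem have the form `E ∩ U`, with `E` a split linear space of one-forms and `U`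
an open set of full-ranked forms: `E` is the line `ℝ α₀`, or the space of forms with values in the
planes `f₀ x`. `isTotallyGeodesic_of_inter` treats them together. The identity serves as a
submanifold chart. The space `E` contains the velocities of its curves and is preserved by `F`, so
the test direction above lies in `E`, and geodesics of `E ∩ U` solve the full equation. Uniqueness
for the ODE at each point of `M` shows that a geodesic with tangential initial velocity agrees with
the one constructed inside `E ∩ U`.

Existence comes from an explicit solution. If the range of `u` lies in the range of `a`, let `X = u
(aᵀa)⁻¹ aᵀ`, let `P` be the orthogonal projection to the range of `a`, and let `τ = tr X`, `κ = m
tr(X Xᵀ) / 4`, `f = 1 + τ t + κ t²`, `s = ∫₀ᵗ dσ / f`. The geodesic is `f^(1/m) exp(s (X - Xᵀ))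
exp(s (Xᵀ - (τ/m) P)) a` (`exists_velocity_geodSol`). It is smooth in `(t, a, u)`, hence gives a
smooth curve of one-forms, on a time interval that is uniform because `M` is compact. Both
exponentials preserve the range of `a`, and they are trivial if `u` is a multiple of `a`; so the
geodesic remains in `E` in both cases.

Coordinates are handled by equivariance: a change of frame replaces matrices `a` by `a * E` with `E`
invertible. `geodF` and `geodSol` commute with this operation and `matInner` is multiplied by `|det
E|`. Division by the density of a fixed reference form makes the metric an integral of a function
over `M` against a fixed finite measure. -/

open Set Bundle MeasureTheory
open scoped Manifold ContDiff Matrix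

noncomputable section

namespace EbinOneForms

/-! ### Calculus of matrix-valued functions -/

section MatrixCalculus

open Filter Topology
open scoped Matrix.Norms.Operator

/-- Real `n × m` matrices. -/
abbrev Mat (n m : ℕ) : Type := Matrix (Fin n) (Fin m) ℝ

variable {m n k : ℕ}

theorem isBoundedBilinearMap_matrix_mul (n m k : ℕ) :
    IsBoundedBilinearMap ℝ (fun p : Mat n m × Mat m k => p.1 * p.2) where
  add_left := Matrix.add_mul
  smul_left c x y := Matrix.smul_mul c x y
  add_right := Matrix.mul_add
  smul_right c x y := Matrix.mul_smul x c y
  bound := ⟨1, one_pos, fun x y => by simpa using Matrix.linfty_opNorm_mul x y⟩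

/-- Transposition as a continuous linear map. -/
def transposeL (n m : ℕ) : Mat n m →L[ℝ] Mat m n :=
  LinearMap.toContinuousLinearMap (Matrix.transposeLinearEquiv (Fin n) (Fin m) ℝ ℝ).toLinearMap

/-- The trace as a continuous linear map. -/
def traceL (m : ℕ) : Mat m m →L[ℝ] ℝ :=
  LinearMap.toContinuousLinearMap (Matrix.traceLinearMap (Fin m) ℝ ℝ)

/-- A matrix entry as a continuous linear map. -/
def entryL (n m : ℕ) (i : Fin n) (j : Fin m) : Mat n m →L[ℝ] ℝ :=
  LinearMap.toContinuousLinearMap (Matrix.entryLinearMap ℝ ℝ i j)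

section ContDiff

variable {F : Type*} [NormedAddCommGroup F] [NormedSpace ℝ F] {N : WithTop ℕ∞} {x : F}

theorem _root_.ContDiffAt.matrix_mul {f : F → Mat n m} {h : F → Mat m k}
    (hf : ContDiffAt ℝ N f x) (hh : ContDiffAt ℝ N h x) :
    ContDiffAt ℝ N (fun y => f y * h y) x :=
  ((isBoundedBilinearMap_matrix_mul n m k).contDiff.contDiffAt (x := (f x, h x))).comp
    (f := fun y => (f y, h y)) x (hf.prodMk hh)

theorem _root_.ContDiffAt.matrix_transpose {f : F → Mat n m} (hf : ContDiffAt ℝ N f x) :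
    ContDiffAt ℝ N (fun y => (f y)ᵀ) x :=
  (transposeL n m).contDiff.contDiffAt.comp x hf

theorem _root_.ContDiffAt.matrix_trace {f : F → Mat m m} (hf : ContDiffAt ℝ N f x) :
    ContDiffAt ℝ N (fun y => (f y).trace) x :=
  (traceL m).contDiff.contDiffAt.comp x hf

theorem contDiff_matrix_det : ContDiff ℝ N (fun a : Mat m m => a.det) := by
  simp only [Matrix.det_apply]
  refine ContDiff.sum fun σ _ => ContDiff.const_smul _ (contDiff_prod fun i _ => ?_)
  exact (entryL m m (σ i) i).contDiff

theorem _root_.ContDiffAt.matrix_det {f : F → Mat m m} (hf : ContDiffAt ℝ N f x) :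
    ContDiffAt ℝ N (fun y => (f y).det) x :=
  contDiff_matrix_det.contDiffAt.comp x hf

theorem _root_.ContDiffAt.matrix_inv {f : F → Mat m m} (hf : ContDiffAt ℝ N f x)
    (hx : (f x).det ≠ 0) : ContDiffAt ℝ N (fun y => (f y)⁻¹) x := by
  obtain ⟨U, hU⟩ := (Matrix.isUnit_iff_isUnit_det (f x)).2 (isUnit_iff_ne_zero.2 hx)
  have : CompleteSpace (Mat m m) := FiniteDimensional.complete ℝ _
  have h := contDiffAt_ringInverse (n := N) ℝ U
  rw [hU] at h
  simp only [Matrix.nonsing_inv_eq_ringInverse]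
  exact h.comp x hf

end ContDiff

section HasDerivAt

variable {t : ℝ}

theorem _root_.HasDerivAt.matrix_mul {f : ℝ → Mat n m} {h : ℝ → Mat m k} {f' : Mat n m}
    {h' : Mat m k} (hf : HasDerivAt f f' t) (hh : HasDerivAt h h' t) :
    HasDerivAt (fun s => f s * h s) (f' * h t + f t * h') t := by
  have := ((isBoundedBilinearMap_matrix_mul n m k).hasFDerivAt (f t, h t)).comp_hasDerivAt t
    (hf.prodMk hh)
  simpa [IsBoundedBilinearMap.deriv, add_comm, Function.comp_def] using! this

theorem _root_.HasDerivAt.matrix_transpose {f : ℝ → Mat n m} {f' : Mat n m}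
    (hf : HasDerivAt f f' t) : HasDerivAt (fun s => (f s)ᵀ) f'ᵀ t :=
  (transposeL n m).hasFDerivAt.comp_hasDerivAt t hf

theorem _root_.HasDerivAt.matrix_trace {f : ℝ → Mat m m} {f' : Mat m m}
    (hf : HasDerivAt f f' t) : HasDerivAt (fun s => (f s).trace) f'.trace t :=
  (traceL m).hasFDerivAt.comp_hasDerivAt t hf

theorem _root_.HasDerivAt.matrix_inv {f : ℝ → Mat m m} {f' : Mat m m}
    (hf : HasDerivAt f f' t) (ht : (f t).det ≠ 0) :
    HasDerivAt (fun s => (f s)⁻¹) (-((f t)⁻¹ * f' * (f t)⁻¹)) t := by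
  obtain ⟨U, hU⟩ := (Matrix.isUnit_iff_isUnit_det (f t)).2 (isUnit_iff_ne_zero.2 ht)
  have : CompleteSpace (Mat m m) := FiniteDimensional.complete ℝ _
  have h := hasFDerivAt_ringInverse (𝕜 := ℝ) U
  rw [hU] at h
  have h2 := h.comp_hasDerivAt t hf
  simp only [Function.comp_def, ← Matrix.nonsing_inv_eq_ringInverse] at h2
  convert! h2 using 1
  have : ((U⁻¹ : (Mat m m)ˣ) : Mat m m) = (f t)⁻¹ := by
    rw [← hU, Matrix.coe_units_inv]
  simp [this]

/-- Jacobi's formula. The determinant is a polynomial, hence differentiable, so it suffices to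
differentiate along the line `f t + s f'`. Factoring out `f t` leaves `det (1 + s A)`, whose linear
coefficient is `tr A`. -/
theorem _root_.HasDerivAt.matrix_det {f : ℝ → Mat m m} {f' : Mat m m}
    (hf : HasDerivAt f f' t) (ht : (f t).det ≠ 0) :
    HasDerivAt (fun s => (f s).det) ((f t).det * ((f t)⁻¹ * f').trace) t := by
  have hd : DifferentiableAt ℝ (fun a : Mat m m => a.det) (f t) :=
    (contDiff_matrix_det (N := 1)).differentiable one_ne_zero _
  have h1 := hd.hasFDerivAt.comp_hasDerivAt t hf
  convert! h1 using 1
  have hl : HasDerivAt (fun s : ℝ => f t + s • f') f' 0 := by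
    have := ((hasDerivAt_id (0 : ℝ)).smul_const f').const_add (f t)
    rwa [one_smul] at this
  have h2 : HasDerivAt (fun s : ℝ => (f t + s • f').det)
      ((fderiv ℝ (fun a : Mat m m => a.det) (f t)) f') 0 := by
    have h0 : f t + (0 : ℝ) • f' = f t := by simp
    have := (h0.symm ▸ hd : DifferentiableAt ℝ (fun a : Mat m m => a.det)
      (f t + (0 : ℝ) • f')).hasFDerivAt.comp_hasDerivAt (0 : ℝ) hl
    rwa [h0] at this
  have h3 : (fun s : ℝ => (f t + s • f').det) =
      fun s => (f t).det * (1 + s • ((f t)⁻¹ * f')).det := by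
    funext s
    rw [← Matrix.det_mul, Matrix.mul_add, Matrix.mul_one, Matrix.mul_smul, ← Matrix.mul_assoc,
      Matrix.mul_nonsing_inv _ (isUnit_iff_ne_zero.2 ht), Matrix.one_mul]
  rw [h3] at h2
  have h4 : HasDerivAt (fun s : ℝ => (1 + s • ((f t)⁻¹ * f')).det) ((f t)⁻¹ * f').trace 0 := by
    set q := (Matrix.det (1 + (Polynomial.X : Polynomial ℝ) •
      ((f t)⁻¹ * f').map Polynomial.C)).divX.divX with hq
    have e0 : (fun s : ℝ => (1 + s • ((f t)⁻¹ * f')).det) =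
        fun s => 1 + ((f t)⁻¹ * f').trace * s + q.eval s * s ^ 2 :=
      funext fun s => Matrix.det_one_add_smul s _
    have e1 := ((hasDerivAt_id (0 : ℝ)).const_mul ((f t)⁻¹ * f').trace).const_add 1
    have e3 := (q.differentiableAt (x := 0)).hasDerivAt.mul ((hasDerivAt_id (0 : ℝ)).pow 2)
    rw [e0]
    exact (e1.add e3).congr_deriv (by simp)
  exact (h4.const_mul (f t).det).unique h2

end HasDerivAt

end MatrixCalculus

/-! ### The inner product and the geodesic equation at one point -/

section PointwiseGeometry

open Filter Topology
open scoped Matrix.Norms.Operator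

variable {m n : ℕ}

theorem gram_isSymm (a : Mat n m) : (aᵀ * a)⁻¹ᵀ = (aᵀ * a)⁻¹ := by
  rw [Matrix.transpose_nonsing_inv, Matrix.transpose_mul, Matrix.transpose_transpose]

theorem gram_det_nonneg (a : Mat n m) : 0 ≤ (aᵀ * a).det := by
  have := (Matrix.posSemidef_conjTranspose_mul_self a).det_nonneg
  simpa using this

theorem gram_det_pos_iff (a : Mat n m) : 0 < (aᵀ * a).det ↔ Function.Injective a.mulVec := by
  constructor
  · intro h x y hxy
    have h1 : (aᵀ * a)⁻¹ * (aᵀ * a) = 1 :=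
      Matrix.nonsing_inv_mul _ (isUnit_iff_ne_zero.2 h.ne')
    have h2 : ∀ z, ((aᵀ * a)⁻¹ * aᵀ).mulVec (a.mulVec z) = z := fun z => by
      rw [Matrix.mulVec_mulVec, Matrix.mul_assoc, h1, Matrix.one_mulVec]
    rw [← h2 x, hxy, h2 y]
  · intro h
    have := (Matrix.PosDef.conjTranspose_mul_self a h).det_pos
    simpa using this

theorem gram_mul_det (a : Mat n m) (E : Mat m m) :
    ((a * E)ᵀ * (a * E)).det = (aᵀ * a).det * E.det ^ 2 := by
  rw [Matrix.transpose_mul, Matrix.mul_assoc, ← Matrix.mul_assoc aᵀ, Matrix.det_mul,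
    Matrix.det_mul, Matrix.det_transpose]
  ring

theorem gram_mul_inv (a : Mat n m) (E : Mat m m) :
    ((a * E)ᵀ * (a * E))⁻¹ = E⁻¹ * (aᵀ * a)⁻¹ * E⁻¹ᵀ := by
  rw [Matrix.transpose_mul, Matrix.mul_assoc, ← Matrix.mul_assoc aᵀ, Matrix.mul_inv_rev,
    Matrix.mul_inv_rev, Matrix.transpose_nonsing_inv]

/-- `u (aᵀa)⁻¹ vᵀ` does not depend on the coordinates. -/
theorem mul_gram_inv_mul (a u v : Mat n m) {E : Mat m m} (hE : E.det ≠ 0) :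
    (u * E) * ((a * E)ᵀ * (a * E))⁻¹ * (v * E)ᵀ = u * (aᵀ * a)⁻¹ * vᵀ := by
  have h1 : E * E⁻¹ = 1 := Matrix.mul_nonsing_inv _ (isUnit_iff_ne_zero.2 hE)
  have h2 : E⁻¹ᵀ * Eᵀ = 1 := by rw [← Matrix.transpose_mul, h1, Matrix.transpose_one]
  rw [gram_mul_inv, Matrix.transpose_mul]
  calc _ = u * (E * E⁻¹) * (aᵀ * a)⁻¹ * (E⁻¹ᵀ * Eᵀ) * vᵀ := by simp only [Matrix.mul_assoc]
    _ = _ := by rw [h1, h2, Matrix.mul_one, Matrix.mul_one]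

/-- This is the transformation law of a density: the trace is invariant and only the volume factor
sees the change of frame. -/
theorem matInner_mul (a u v : Mat n m) {E : Mat m m} (hE : E.det ≠ 0) :
    matInner (a * E) (u * E) (v * E) = matInner a u v * |E.det| := by
  rw [matInner, mul_gram_inv_mul a u v hE, gram_mul_det, matInner,
    Real.sqrt_mul (gram_det_nonneg a), Real.sqrt_sq_eq_abs]
  ring

/-- The derivative of `matInner` at `(a, u, v)` in the direction `(a', u', v')`. -/
def dMatInner (a u v a' u' v' : Mat n m) : ℝ :=
  ((u' * (aᵀ * a)⁻¹ * vᵀ).trace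
    - (u * ((aᵀ * a)⁻¹ * (a'ᵀ * a + aᵀ * a') * (aᵀ * a)⁻¹) * vᵀ).trace
    + (u * (aᵀ * a)⁻¹ * v'ᵀ).trace
    + (u * (aᵀ * a)⁻¹ * vᵀ).trace * ((aᵀ * a)⁻¹ * (aᵀ * a')).trace) * Real.sqrt (aᵀ * a).det

theorem hasDerivAt_matInner {a u v : ℝ → Mat n m} {a' u' v' : Mat n m} {t : ℝ}
    (ha : HasDerivAt a a' t) (hu : HasDerivAt u u' t) (hv : HasDerivAt v v' t)
    (hpos : 0 < ((a t)ᵀ * a t).det) :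
    HasDerivAt (fun s => matInner (a s) (u s) (v s))
      (dMatInner (a t) (u t) (v t) a' u' v') t := by
  have hg := ha.matrix_transpose.matrix_mul ha
  have h1 := (((hu.matrix_mul (hg.matrix_inv hpos.ne')).matrix_mul hv.matrix_transpose)).matrix_trace
  have h2 := (hg.matrix_det hpos.ne').sqrt hpos.ne'
  have h3 := h1.mul h2
  refine h3.congr_deriv ?_
  have hs : Real.sqrt ((a t)ᵀ * a t).det ≠ 0 := (Real.sqrt_pos.2 hpos).ne'
  have hsq : ((a t)ᵀ * a t).det = Real.sqrt ((a t)ᵀ * a t).det * Real.sqrt ((a t)ᵀ * a t).det :=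
    (Real.mul_self_sqrt hpos.le).symm
  -- The two halves of the derivative of `aᵀa` are transposes of each other, so they have equal
  -- traces against the symmetric inverse; this cancels the `2` from the square root.
  have htr : (((a t)ᵀ * a t)⁻¹ * (a'ᵀ * a t)).trace = (((a t)ᵀ * a t)⁻¹ * ((a t)ᵀ * a')).trace := by
    rw [← Matrix.trace_transpose, Matrix.transpose_mul, gram_isSymm, Matrix.transpose_mul,
      Matrix.transpose_transpose, Matrix.trace_mul_comm]
  have h4 : ((a t)ᵀ * a t).det * (((a t)ᵀ * a t)⁻¹ * (a'ᵀ * a t + (a t)ᵀ * a')).trace /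
      (2 * Real.sqrt ((a t)ᵀ * a t).det) =
      (((a t)ᵀ * a t)⁻¹ * ((a t)ᵀ * a')).trace * Real.sqrt ((a t)ᵀ * a t).det := by
    rw [Matrix.mul_add, Matrix.trace_add, htr]
    nth_rewrite 1 [hsq]
    field_simp
    ring
  rw [h4]
  simp only [dMatInner, Matrix.add_mul, Matrix.trace_add, Matrix.mul_neg, Matrix.neg_mul,
    Matrix.trace_neg, Matrix.mul_assoc]
  ring

/-- The right-hand side of the geodesic equation `c'' = geodF c c'`. -/
def geodF (a u : Mat n m) : Mat n m :=
  u * (aᵀ * a)⁻¹ * uᵀ * a + u * (aᵀ * a)⁻¹ * aᵀ * u - (u * (aᵀ * a)⁻¹ * aᵀ).trace • u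
    - a * (aᵀ * a)⁻¹ * uᵀ * u + ((1 / 2 : ℝ) * (u * (aᵀ * a)⁻¹ * uᵀ).trace) • a

/-- The pointwise Euler–Lagrange computation, with `u` the velocity, `w` the variation and `w'`
their common mixed derivative. The left side is the time derivative of `2⟨u, w⟩` minus the
derivative of `⟨u, u⟩` along the variation. The terms in `w'` cancel, and what remains is linear in
`w`; writing it as an inner product with `w` is what determines `geodF`. -/
theorem dMatInner_sub (a u w u' w' : Mat n m) :
    2 * dMatInner a u w u u' w' - dMatInner a u u w w' w' =
      2 * matInner a (u' - geodF a u) w := by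
  have hs := gram_isSymm a
  set G := (aᵀ * a)⁻¹ with hG
  have t1 : (w' * G * uᵀ).trace = (u * G * w'ᵀ).trace := by
    rw [← Matrix.trace_transpose]
    simp only [Matrix.transpose_mul, Matrix.transpose_transpose, hs, Matrix.mul_assoc]
  have t2 : (u * (G * (wᵀ * a) * G) * uᵀ).trace = (a * G * (uᵀ * u) * G * wᵀ).trace := by
    calc _ = ((u * G * wᵀ) * (a * G * uᵀ)).trace := by simp only [Matrix.mul_assoc]
      _ = ((a * G * uᵀ) * (u * G * wᵀ)).trace := Matrix.trace_mul_comm _ _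
      _ = _ := by simp only [Matrix.mul_assoc]
  have t3 : (u * (G * (aᵀ * w) * G) * uᵀ).trace = (u * (G * (wᵀ * a) * G) * uᵀ).trace := by
    rw [← Matrix.trace_transpose]
    simp only [Matrix.transpose_mul, Matrix.transpose_transpose, hs, Matrix.mul_assoc]
  have t4 : (a * G * wᵀ).trace = (G * (aᵀ * w)).trace := by
    rw [← Matrix.trace_transpose]
    simp only [Matrix.transpose_mul, Matrix.transpose_transpose, hs]
    rw [Matrix.trace_mul_comm]
    simp only [Matrix.mul_assoc]
  have t5 : (u * G * aᵀ).trace = (G * (aᵀ * u)).trace := by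
    rw [Matrix.mul_assoc, Matrix.trace_mul_comm, Matrix.mul_assoc]
  simp only [dMatInner, matInner, geodF, ← hG, t5]
  simp only [Matrix.sub_mul, Matrix.add_mul, Matrix.mul_add, Matrix.trace_add, Matrix.trace_sub,
    Matrix.smul_mul, Matrix.trace_smul, smul_eq_mul, t1, t3, t2, t4]
  simp only [Matrix.mul_assoc]
  ring

/-- With `Y = e (aᵀa)⁻¹ aᵀ` one has `e (aᵀa)⁻¹ eᵀ = Y Yᵀ`, of nonnegative trace. Since `Y a = e`,
this trace vanishes only for `e = 0`, which is used in the next lemma. -/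
theorem matInner_self_nonneg (a e : Mat n m) (ha : 0 < (aᵀ * a).det) : 0 ≤ matInner a e e := by
  refine mul_nonneg ?_ (Real.sqrt_nonneg _)
  have h1 : (aᵀ * a)⁻¹ * (aᵀ * a) = 1 := Matrix.nonsing_inv_mul _ (isUnit_iff_ne_zero.2 ha.ne')
  have : e * (aᵀ * a)⁻¹ * eᵀ = (e * (aᵀ * a)⁻¹ * aᵀ) * (e * (aᵀ * a)⁻¹ * aᵀ)ᵀ := by
    simp only [Matrix.transpose_mul, Matrix.transpose_transpose, gram_isSymm]
    calc _ = e * ((aᵀ * a)⁻¹ * (aᵀ * a)) * (aᵀ * a)⁻¹ * eᵀ := by rw [h1, Matrix.mul_one]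
      _ = _ := by simp only [Matrix.mul_assoc]
  rw [this]
  have := (Matrix.posSemidef_self_mul_conjTranspose (e * (aᵀ * a)⁻¹ * aᵀ)).trace_nonneg
  simpa using this

theorem eq_zero_of_matInner_self (a e : Mat n m) (ha : 0 < (aᵀ * a).det)
    (h : matInner a e e = 0) : e = 0 := by
  have h0 := (mul_eq_zero.1 h).resolve_right (Real.sqrt_pos.2 ha).ne'
  have h1 : (aᵀ * a)⁻¹ * (aᵀ * a) = 1 := Matrix.nonsing_inv_mul _ (isUnit_iff_ne_zero.2 ha.ne')
  have h2 : e * (aᵀ * a)⁻¹ * eᵀ = (e * (aᵀ * a)⁻¹ * aᵀ) * (e * (aᵀ * a)⁻¹ * aᵀ)ᴴ := by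
    simp only [Matrix.conjTranspose_eq_transpose_of_trivial, Matrix.transpose_mul,
      Matrix.transpose_transpose, gram_isSymm]
    calc _ = e * ((aᵀ * a)⁻¹ * (aᵀ * a)) * (aᵀ * a)⁻¹ * eᵀ := by rw [h1, Matrix.mul_one]
      _ = _ := by simp only [Matrix.mul_assoc]
  rw [h2, Matrix.trace_mul_conjTranspose_self_eq_zero_iff] at h0
  calc e = e * ((aᵀ * a)⁻¹ * (aᵀ * a)) := by rw [h1, Matrix.mul_one]
    _ = e * (aᵀ * a)⁻¹ * aᵀ * a := by simp only [Matrix.mul_assoc]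
    _ = 0 := by rw [h0, Matrix.zero_mul]

/-- Each term is a frame-independent scalar or endomorphism of `ℝⁿ` applied to `a` or `u`. This is
why the geodesic equation makes sense for one-forms. -/
theorem geodF_mul (a u : Mat n m) {E : Mat m m} (hE : E.det ≠ 0) :
    geodF (a * E) (u * E) = geodF a u * E := by
  simp only [geodF, mul_gram_inv_mul _ _ _ hE]
  simp only [← Matrix.mul_assoc, Matrix.add_mul, Matrix.sub_mul, Matrix.smul_mul]

theorem contDiffAt_geodF {N : WithTop ℕ∞} (p : Mat n m × Mat n m) (hp : 0 < (p.1ᵀ * p.1).det) :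
    ContDiffAt ℝ N (fun p : Mat n m × Mat n m => geodF p.1 p.2) p := by
  have ha : ContDiffAt ℝ N (fun p : Mat n m × Mat n m => p.1) p := contDiffAt_fst
  have hu : ContDiffAt ℝ N (fun p : Mat n m × Mat n m => p.2) p := contDiffAt_snd
  have hG := (ha.matrix_transpose.matrix_mul ha).matrix_inv hp.ne'
  unfold geodF
  have hua := (hu.matrix_mul hG).matrix_mul ha.matrix_transpose
  have huu := (hu.matrix_mul hG).matrix_mul hu.matrix_transpose
  have hau := ((ha.matrix_mul hG).matrix_mul hu.matrix_transpose)
  exact ((((huu.matrix_mul ha).add (hua.matrix_mul hu)).sub (hua.matrix_trace.smul hu)).sub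
    (hau.matrix_mul hu)).add ((contDiffAt_const.mul huu.matrix_trace).smul ha)

end PointwiseGeometry

/-! ### One-forms as matrices, and coordinate frames -/

section Frames

open Filter Topology
open scoped Matrix.Norms.Operator

variable {m n : ℕ}

/-- The matrix of a linear map between Euclidean spaces. -/
def toMat (n m : ℕ) : (Euc m →L[ℝ] Euc n) ≃L[ℝ] Mat n m :=
  (LinearMap.toContinuousLinearMap.symm.trans
    (LinearMap.toMatrix (EuclideanSpace.basisFun (Fin m) ℝ).toBasis
      (EuclideanSpace.basisFun (Fin n) ℝ).toBasis)).toContinuousLinearEquiv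

theorem toMat_apply (A : Euc m →L[ℝ] Euc n) (k : Fin n) (j : Fin m) :
    toMat n m A k j = A (EuclideanSpace.single j 1) k := by
  change LinearMap.toMatrix _ _ _ k j = _
  rw [LinearMap.toMatrix_apply]
  simp

theorem toMat_comp {k : ℕ} (A : Euc m →L[ℝ] Euc n) (B : Euc k →L[ℝ] Euc m) :
    toMat n k (A ∘L B) = toMat n m A * toMat m k B :=
  LinearMap.toMatrix_comp (EuclideanSpace.basisFun (Fin k) ℝ).toBasis
    (EuclideanSpace.basisFun (Fin m) ℝ).toBasis (EuclideanSpace.basisFun (Fin n) ℝ).toBasis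
    (A : Euc m →ₗ[ℝ] Euc n) (B : Euc k →ₗ[ℝ] Euc m)

theorem toMat_id : toMat m m (ContinuousLinearMap.id ℝ (Euc m)) = 1 :=
  LinearMap.toMatrix_id (EuclideanSpace.basisFun (Fin m) ℝ).toBasis

theorem toMat_mulVec (A : Euc m →L[ℝ] Euc n) (v : Euc m) :
    (toMat n m A).mulVec v.ofLp = (A v).ofLp :=
  LinearMap.toMatrix_mulVec_repr (EuclideanSpace.basisFun (Fin m) ℝ).toBasis
    (EuclideanSpace.basisFun (Fin n) ℝ).toBasis (A : Euc m →ₗ[ℝ] Euc n) v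

theorem injective_iff_gram_det_pos (A : Euc m →L[ℝ] Euc n) :
    Function.Injective A ↔ 0 < ((toMat n m A)ᵀ * toMat n m A).det := by
  rw [gram_det_pos_iff]
  constructor
  · intro h x y hxy
    have := toMat_mulVec A (WithLp.toLp 2 x)
    have h2 := toMat_mulVec A (WithLp.toLp 2 y)
    simp only at this h2
    rw [this, h2] at hxy
    simpa using congrArg WithLp.ofLp (h (WithLp.ofLp_injective 2 hxy))
  · intro h x y hxy
    apply WithLp.ofLp_injective 2
    apply h
    rw [toMat_mulVec, toMat_mulVec, hxy]

variable {H : Type*} [TopologicalSpace H] (I : ModelWithCorners ℝ (Euc m) H)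
  {M : Type*} [TopologicalSpace M] [ChartedSpace H M] [IsManifold I ∞ M]

/-- The coordinate frame of the chart at `i`, as a matrix, at the point `x`. -/
def frame (i x : M) : Mat m m :=
  toMat m m (show Euc m →L[ℝ] Euc m from
    (trivializationAt (Euc m) (TangentSpace I) i).symmL ℝ x)

/-- The matrix of a one-form at a point. -/
def mat (α : OneForm I M n) (x : M) : Mat n m :=
  toMat n m (show Euc m →L[ℝ] Euc n from α x)

variable {I}

theorem mat_apply (α : OneForm I M n) (x : M) (k : Fin n) (j : Fin m) :
    mat I α x k j = (α x (EuclideanSpace.single j 1 : Euc m) : Euc n) k :=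
  toMat_apply _ k j

theorem mat_mulVec (α : OneForm I M n) (x : M) (v : Euc m) :
    (mat I α x).mulVec v.ofLp = (α x v : Euc n).ofLp :=
  toMat_mulVec _ v

theorem mem_fullRank_iff (α : OneForm I M n) :
    α ∈ fullRank I ↔ ∀ x, 0 < ((mat I α x)ᵀ * mat I α x).det :=
  forall_congr' fun x => injective_iff_gram_det_pos (show Euc m →L[ℝ] Euc n from α x)

theorem mat_injective {α β : OneForm I M n} (h : ∀ x, mat I α x = mat I β x) : α = β :=
  ContMDiffSection.ext fun x => (toMat n m).injective (h x)

/-- The link between the chart-dependent matrices in the metric and the chart-free `mat`: they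
differ by an invertible factor on the right, so the equivariance lemmas apply. -/
theorem coordMatrix_eq (i x : M) (A : Euc m →L[ℝ] Euc n) :
    coordMatrix I i x (fun v => A v) = toMat n m A * frame I i x := by
  rw [frame, ← toMat_comp]
  ext k j
  rw [toMat_apply]
  rfl

theorem frame_self (x : M) : frame I x x = 1 := by
  rw [← toMat_id, frame]
  congr 1
  ext1 v
  rw [TangentBundle.symmL_trivializationAt_eq_core (mem_chart_source H x)]
  exact (tangentBundleCore I M).coordChange_self _ _ (mem_chart_source H x) v

theorem frame_det_ne_zero {i x : M} (hx : x ∈ (chartAt H i).source) : (frame I i x).det ≠ 0 := by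
  have hx' : x ∈ (trivializationAt (Euc m) (TangentSpace I) i).baseSet := hx
  have h : (toMat m m (show Euc m →L[ℝ] Euc m from
    (trivializationAt (Euc m) (TangentSpace I) i).continuousLinearMapAt ℝ x)) * frame I i x = 1 := by
    rw [frame, ← toMat_comp, ← toMat_id]
    congr 1
    ext1 v
    exact (trivializationAt (Euc m) (TangentSpace I) i).continuousLinearMapAt_symmL hx' v
  intro h0
  have := congrArg Matrix.det h
  rw [Matrix.det_mul, h0] at this
  simp at this

end Frames

/-! ### Joint smoothness in the parameter and the point of `M` -/

section LocSmooth

open Filter Topology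
open scoped Matrix.Norms.Operator

variable {m n : ℕ} {H : Type*} [TopologicalSpace H] (I : ModelWithCorners ℝ (Euc m) H)
  {M : Type*} [TopologicalSpace M] [ChartedSpace H M] [IsManifold I ∞ M]
  {Z : Type*} [NormedAddCommGroup Z] [NormedSpace ℝ Z]

/-- A family of matrices of one-forms, with parameters in `Z`, is jointly smooth at a point. -/
def SmoothFamilyAt (A : Z → M → Mat n m) (z₀ : Z) (x₀ : M) : Prop :=
  ContMDiffAt (𝓘(ℝ, Z).prod I) 𝓘(ℝ, Euc m →L[ℝ] Euc n) ∞
    (fun p : Z × M => (toMat n m).symm (A p.1 p.2 * frame I x₀ p.2)) (z₀, x₀)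

variable {I}

/-- In the trivialization at `x₀` of the Hom bundle, a linear map is composed with the inverse
trivialization of the tangent bundle; the target bundle is trivial. In matrices this is right
multiplication by the frame. -/
theorem contMDiffAt_mk_iff (A : Z → ∀ x : M, TangentSpace I x →L[ℝ] Bundle.Trivial M (Euc n) x)
    (z₀ : Z) (x₀ : M) :
    ContMDiffAt (𝓘(ℝ, Z).prod I) (I.prod 𝓘(ℝ, Euc m →L[ℝ] Euc n)) ∞
      (fun p : Z × M => TotalSpace.mk' (Euc m →L[ℝ] Euc n)
        (E := fun x : M => TangentSpace I x →L[ℝ] Bundle.Trivial M (Euc n) x) p.2 (A p.1 p.2))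
      (z₀, x₀) ↔
    SmoothFamilyAt I (fun z x => toMat n m (show Euc m →L[ℝ] Euc n from A z x)) z₀ x₀ := by
  rw [contMDiffAt_hom_bundle]
  have key : (fun p : Z × M => ContinuousLinearMap.inCoordinates (Euc m) (TangentSpace I)
      (Euc n) (Bundle.Trivial M (Euc n)) x₀ p.2 x₀ p.2 (A p.1 p.2)) =
      fun p => (show Euc m →L[ℝ] Euc n from A p.1 p.2) ∘L (show Euc m →L[ℝ] Euc m from
    (trivializationAt (Euc m) (TangentSpace I) x₀).symmL ℝ p.2) := by
    funext p
    ext1 v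
    simp [ContinuousLinearMap.inCoordinates]
    rfl
  have key2 : (fun p : Z × M => (toMat n m).symm
      ((toMat n m (show Euc m →L[ℝ] Euc n from A p.1 p.2)) * frame I x₀ p.2)) =
      fun p => (show Euc m →L[ℝ] Euc n from A p.1 p.2) ∘L (show Euc m →L[ℝ] Euc m from
        (trivializationAt (Euc m) (TangentSpace I) x₀).symmL ℝ p.2) := by
    funext p
    rw [ContinuousLinearEquiv.symm_apply_eq, toMat_comp]
    rfl
  rw [SmoothFamilyAt, key2]
  exact ⟨fun h => key ▸ h.2, fun h => ⟨contMDiffAt_snd, key ▸ h⟩⟩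

attribute [irreducible] toMat frame

end LocSmooth

/-! ### Operations on smooth families of one-forms -/

section SmoothFamilies

open Filter Topology
open scoped Matrix.Norms.Operator

variable {m n : ℕ} {H : Type*} [TopologicalSpace H] {I : ModelWithCorners ℝ (Euc m) H}
  {M : Type*} [TopologicalSpace M] [ChartedSpace H M] [IsManifold I ∞ M]
  {Z : Type*} [NormedAddCommGroup Z] [NormedSpace ℝ Z]
  {Z' : Type*} [NormedAddCommGroup Z'] [NormedSpace ℝ Z']

theorem smoothCurveOn_iff {J : Set ℝ} (hJ : IsOpen J) {c : ℝ → OneForm I M n} :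
    SmoothCurveOn I J c ↔ ∀ t ∈ J, ∀ x, SmoothFamilyAt I (fun t x => mat I (c t) x) t x := by
  have hop : IsOpen (J ×ˢ (univ : Set M)) := hJ.prod isOpen_univ
  constructor
  · intro h t ht x
    exact (contMDiffAt_mk_iff (fun t x => c t x) t x).1
      ((h (t, x) ⟨ht, mem_univ _⟩).contMDiffAt (hop.mem_nhds ⟨ht, mem_univ _⟩))
  · rintro h ⟨t, x⟩ ⟨ht, -⟩
    exact ((contMDiffAt_mk_iff (fun t x => c t x) t x).2 (h t ht x)).contMDiffWithinAt

theorem smoothFamilyOn_iff {S J : Set ℝ} (hS : IsOpen S) (hJ : IsOpen J)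
    {Γ : ℝ → ℝ → OneForm I M n} :
    SmoothFamilyOn I S J Γ ↔ ∀ z : ℝ × ℝ, z ∈ S ×ˢ J → ∀ x,
      SmoothFamilyAt I (fun z x => mat I (Γ z.1 z.2) x) z x := by
  have hop : IsOpen ((S ×ˢ J) ×ˢ (univ : Set M)) := (hS.prod hJ).prod isOpen_univ
  have key (z : ℝ × ℝ) (x : M) := contMDiffAt_mk_iff (I := I) (n := n) (fun z x => Γ z.1 z.2 x) z x
  constructor
  · intro h z hz x
    have hm : (z, x) ∈ (S ×ˢ J) ×ˢ (univ : Set M) := ⟨hz, mem_univ x⟩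
    have h1 := h (z, x) hm
    have h2 := h1.contMDiffAt (hop.mem_nhds hm)
    exact (key z x).1 h2
  · rintro h ⟨z, x⟩ ⟨hz, -⟩
    have h1 := (key z x).2 (h z hz x)
    exact h1.contMDiffWithinAt

theorem smoothFamilyAt_const (α : OneForm I M n) (z : Z) (x : M) :
    SmoothFamilyAt I (fun (_ : Z) x => mat I α x) z x :=
  (contMDiffAt_mk_iff (fun _ x => α x) z x).1
    ((α.contMDiff_toFun x).comp (z, x) contMDiffAt_snd)

/-- The one-form with given matrices at the points of `M`, if they depend smoothly on the point. -/
theorem exists_mat_eq {A : Z → M → Mat n m} {z : Z} (hA : ∀ x, SmoothFamilyAt I A z x) :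
    ∃ α : OneForm I M n, ∀ x, mat I α x = A z x := by
  let B : Z → ∀ x : M, TangentSpace I x →L[ℝ] Bundle.Trivial M (Euc n) x :=
    fun z x => (show Euc m →L[ℝ] Euc n from (toMat n m).symm (A z x))
  have hB : ∀ z x, toMat n m (show Euc m →L[ℝ] Euc n from B z x) = A z x := fun z x =>
    (toMat n m).apply_symm_apply _
  refine ⟨⟨B z, fun x => ?_⟩, fun x => hB z x⟩
  have h1 := (contMDiffAt_mk_iff B z x).2 (by simpa only [hB] using hA x)
  exact h1.comp x ((contMDiffAt_const (c := z)).prodMk contMDiffAt_id)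

theorem SmoothFamilyAt.comp_param {A : Z → M → Mat n m} {φ : Z' → Z} {z : Z'} {x : M}
    (hA : SmoothFamilyAt I A (φ z) x) (hφ : ContDiffAt ℝ ∞ φ z) :
    SmoothFamilyAt I (fun z x => A (φ z) x) z x := by
  have h1 : ContMDiffAt (𝓘(ℝ, Z').prod I) (𝓘(ℝ, Z).prod I) ∞
      (fun p : Z' × M => (φ p.1, p.2)) (z, x) :=
    (hφ.contMDiffAt.comp (z, x) contMDiffAt_fst).prodMk contMDiffAt_snd
  have h2 : ContMDiffAt (𝓘(ℝ, Z).prod I) 𝓘(ℝ, Euc m →L[ℝ] Euc n) ∞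
    (fun p : Z × M => (toMat n m).symm (A p.1 p.2 * frame I x p.2)) (φ z, x) := hA
  exact h2.comp_of_eq h1 rfl

omit [NormedSpace ℝ Z] in
theorem eventually_frame_det_ne_zero (z₀ : Z) (x₀ : M) :
    ∀ᶠ p : Z × M in 𝓝 (z₀, x₀), (frame I x₀ p.2).det ≠ 0 := by
  have : ∀ᶠ x in 𝓝 x₀, x ∈ (chartAt H x₀).source :=
    (chartAt H x₀).open_source.mem_nhds (mem_chart_source H x₀)
  filter_upwards [continuousAt_snd.eventually this] with p hp
  exact frame_det_ne_zero hp

/-- Near `x₀` the frame of the chart at `x₀` is invertible, so by equivariance the local expression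
of the result is `Φ` applied to the local expressions of `A` and `B`. At `x₀` itself the frame is
`1`, hence smoothness of `Φ` at the untransformed point suffices. -/
theorem SmoothFamilyAt.map₂ {A B : Z → M → Mat n m} {z₀ : Z} {x₀ : M}
    (hA : SmoothFamilyAt I A z₀ x₀) (hB : SmoothFamilyAt I B z₀ x₀)
    (Φ : Z × Mat n m × Mat n m → Mat n m)
    (hΦ : ContDiffAt ℝ ∞ Φ (z₀, A z₀ x₀, B z₀ x₀))
    (hE : ∀ z a u (E : Mat m m), E.det ≠ 0 → Φ (z, a * E, u * E) = Φ (z, a, u) * E) :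
    SmoothFamilyAt I (fun z x => Φ (z, A z x, B z x)) z₀ x₀ := by
  have h1 : ContMDiffAt (𝓘(ℝ, Z).prod I) 𝓘(ℝ, Z × (Euc m →L[ℝ] Euc n) × (Euc m →L[ℝ] Euc n)) ∞
      (fun p : Z × M => (p.1, (toMat n m).symm (A p.1 p.2 * frame I x₀ p.2),
        (toMat n m).symm (B p.1 p.2 * frame I x₀ p.2))) (z₀, x₀) :=
    contMDiffAt_fst.prodMk_space (hA.prodMk_space hB)
  have h2 : ContDiffAt ℝ ∞ (fun q : Z × (Euc m →L[ℝ] Euc n) × (Euc m →L[ℝ] Euc n) =>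
      (toMat n m).symm (Φ (q.1, toMat n m q.2.1, toMat n m q.2.2)))
      (z₀, (toMat n m).symm (A z₀ x₀ * frame I x₀ x₀),
        (toMat n m).symm (B z₀ x₀ * frame I x₀ x₀)) := by
    refine (toMat n m).symm.contDiff.contDiffAt.comp _ (ContDiffAt.comp (g := Φ) _ ?_
      (f := fun q : Z × (Euc m →L[ℝ] Euc n) × (Euc m →L[ℝ] Euc n) =>
        (q.1, toMat n m q.2.1, toMat n m q.2.2)) ?_)
    · simpa [frame_self] using hΦ
    · exact contDiffAt_fst.prodMk
        (((toMat n m).contDiff.contDiffAt.comp _ (contDiffAt_fst.comp _ contDiffAt_snd)).prodMk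
          ((toMat n m).contDiff.contDiffAt.comp _ (contDiffAt_snd.comp _ contDiffAt_snd)))
  refine (ContDiffAt.comp_contMDiffAt (x := (z₀, x₀)) (f := fun p : Z × M =>
    (p.1, (toMat n m).symm (A p.1 p.2 * frame I x₀ p.2),
        (toMat n m).symm (B p.1 p.2 * frame I x₀ p.2))) h2 h1).congr_of_eventuallyEq ?_
  filter_upwards [eventually_frame_det_ne_zero (I := I) z₀ x₀] with p hp
  simp [hE _ _ _ _ hp]

theorem SmoothFamilyAt.continuousAt {A : Z → M → Mat n m} {z₀ : Z} {x₀ : M}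
    (hA : SmoothFamilyAt I A z₀ x₀) :
    ContinuousAt (fun p : Z × M => A p.1 p.2 * frame I x₀ p.2) (z₀, x₀) := by
  have := (toMat n m).continuous.continuousAt.comp (ContMDiffAt.continuousAt hA)
  simpa only [Function.comp_def, ContinuousLinearEquiv.apply_symm_apply] using! this

/-- A continuous function of five families which does not depend on the coordinates is
continuous. -/
theorem continuousAt_of_invariant {Y : Type*} [TopologicalSpace Y]
    {A B C D R : Z → M → Mat n m} {z₀ : Z} {x₀ : M}
    (hA : SmoothFamilyAt I A z₀ x₀) (hB : SmoothFamilyAt I B z₀ x₀)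
    (hC : SmoothFamilyAt I C z₀ x₀) (hD : SmoothFamilyAt I D z₀ x₀)
    (hR : SmoothFamilyAt I R z₀ x₀)
    (Φ : Mat n m × Mat n m × Mat n m × Mat n m × Mat n m → Y)
    (hΦ : ContinuousAt Φ (A z₀ x₀, B z₀ x₀, C z₀ x₀, D z₀ x₀, R z₀ x₀))
    (hE : ∀ a b c d r (E : Mat m m), E.det ≠ 0 →
      Φ (a * E, b * E, c * E, d * E, r * E) = Φ (a, b, c, d, r)) :
    ContinuousAt (fun p : Z × M =>
      Φ (A p.1 p.2, B p.1 p.2, C p.1 p.2, D p.1 p.2, R p.1 p.2)) (z₀, x₀) := by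
  have h1 := hA.continuousAt.prodMk (hB.continuousAt.prodMk (hC.continuousAt.prodMk
    (hD.continuousAt.prodMk hR.continuousAt)))
  have h2 := ContinuousAt.comp (g := Φ) (x := (z₀, x₀)) (by simpa [frame_self] using hΦ) h1
  refine h2.congr ?_
  filter_upwards [eventually_frame_det_ne_zero (I := I) z₀ x₀] with p hp
  simp [hE _ _ _ _ _ _ hp]

theorem SmoothFamilyAt.contDiffAt {A : Z → M → Mat n m} {z₀ : Z} {x₀ : M}
    (hA : SmoothFamilyAt I A z₀ x₀) : ContDiffAt ℝ ∞ (fun z => A z x₀) z₀ := by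
  have h1 : ContMDiffAt 𝓘(ℝ, Z) (𝓘(ℝ, Z).prod I) ∞ (fun z : Z => (z, x₀)) z₀ :=
    contMDiffAt_id.prodMk contMDiffAt_const
  have h2 : ContMDiffAt (𝓘(ℝ, Z).prod I) 𝓘(ℝ, Euc m →L[ℝ] Euc n) ∞
    (fun p : Z × M => (toMat n m).symm (A p.1 p.2 * frame I x₀ p.2)) (z₀, x₀) := hA
  have h3 := (toMat n m).contDiff.contDiffAt.comp z₀ (h2.comp_of_eq h1 rfl).contDiffAt
  refine h3.congr_of_eventuallyEq (Eventually.of_forall fun z => ?_)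
  have h4 := (toMat n m).apply_symm_apply (A z x₀ * frame I x₀ x₀)
  rw [frame_self, Matrix.mul_one] at h4
  simp only [Function.comp_apply, frame_self, Matrix.mul_one]
  exact h4.symm

/-- The frame does not depend on the parameter, so differentiation in the parameter commutes with
multiplication by it, and partial derivatives of a jointly smooth map are jointly smooth. -/
theorem smoothFamilyAt_fderiv {A : Z → M → Mat n m} {S : Set Z} (hS : IsOpen S)
    (hA : ∀ z ∈ S, ∀ x, SmoothFamilyAt I A z x) (e : Z) :
    ∀ z ∈ S, ∀ x, SmoothFamilyAt I (fun z x => fderiv ℝ (fun z' => A z' x) z e) z x := by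
  intro z₀ hz₀ x₀
  have h0 := hA z₀ hz₀ x₀
  let f : Z × M → Z → (Euc m →L[ℝ] Euc n) := fun p z =>
    (toMat n m).symm (A z p.2 * frame I x₀ p.2)
  have h1 : ContMDiffAt ((𝓘(ℝ, Z).prod I).prod 𝓘(ℝ, Z)) 𝓘(ℝ, Euc m →L[ℝ] Euc n) ∞
      (Function.uncurry f) ((z₀, x₀), z₀) := by
    have h2 : ContMDiffAt ((𝓘(ℝ, Z).prod I).prod 𝓘(ℝ, Z)) (𝓘(ℝ, Z).prod I) ∞
        (fun q : (Z × M) × Z => (q.2, q.1.2)) ((z₀, x₀), z₀) :=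
      contMDiffAt_snd.prodMk (contMDiffAt_snd.comp _ contMDiffAt_fst)
    have h3 : ContMDiffAt (𝓘(ℝ, Z).prod I) 𝓘(ℝ, Euc m →L[ℝ] Euc n) ∞
      (fun p : Z × M => (toMat n m).symm (A p.1 p.2 * frame I x₀ p.2)) (z₀, x₀) := h0
    exact h3.comp_of_eq h2 rfl
  have h3 := ContMDiffAt.mfderiv (m := ∞) (n := ∞) f (fun p => p.1) h1 contMDiffAt_fst (by simp)
  have e1 := inTangentCoordinates_model_space (I := 𝓘(ℝ, Z)) (I' := 𝓘(ℝ, Euc m →L[ℝ] Euc n))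
    (fun p : Z × M => p.1) (fun p => f p p.1)
    (fun p => mfderiv 𝓘(ℝ, Z) 𝓘(ℝ, Euc m →L[ℝ] Euc n) (f p) p.1) (z₀, x₀)
  have e2 : (fun p : Z × M => mfderiv 𝓘(ℝ, Z) 𝓘(ℝ, Euc m →L[ℝ] Euc n) (f p) p.1) =
      fun p => fderiv ℝ (f p) p.1 := funext fun p => mfderiv_eq_fderiv
  have h3 : ContMDiffAt (𝓘(ℝ, Z).prod I) 𝓘(ℝ, Z →L[ℝ] Euc m →L[ℝ] Euc n) ∞
      (fun p : Z × M => fderiv ℝ (f p) p.1) (z₀, x₀) := (e1.trans e2) ▸ h3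
  have h4 : ContMDiffAt (𝓘(ℝ, Z).prod I) 𝓘(ℝ, Euc m →L[ℝ] Euc n) ∞
      (fun p : Z × M => fderiv ℝ (f p) p.1 e) (z₀, x₀) :=
    ContMDiffAt.clm_apply h3 contMDiffAt_const
  refine ContMDiffAt.congr_of_eventuallyEq h4 ?_
  have h5 : ∀ᶠ p : Z × M in 𝓝 (z₀, x₀), p.1 ∈ S :=
    continuousAt_fst.eventually (hS.mem_nhds hz₀)
  filter_upwards [h5] with p hp
  have hd : HasFDerivAt (fun z => A z p.2) (fderiv ℝ (fun z => A z p.2) p.1) p.1 :=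
    ((hA p.1 hp p.2).contDiffAt.differentiableAt (by simp)).hasFDerivAt
  let R : Mat n m →ₗ[ℝ] Mat n m :=
    { toFun := fun a => a * frame I x₀ p.2
      map_add' := fun a b => Matrix.add_mul a b _
      map_smul' := fun r a => Matrix.smul_mul r a _ }
  let L : Mat n m →L[ℝ] (Euc m →L[ℝ] Euc n) := LinearMap.toContinuousLinearMap
    ((toMat n m).symm.toLinearEquiv.toLinearMap ∘ₗ R)
  have h6 : HasFDerivAt (f p) (L ∘L fderiv ℝ (fun z => A z p.2) p.1) p.1 :=
    L.hasFDerivAt.comp p.1 hd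
  rw [h6.fderiv]
  rfl

/-- Positivity of the Gram determinant is an open condition near each `(z₀, x)`, since the frame
changes it only by a square; compactness of `M` makes the neighbourhood of `z₀` uniform in `x`. -/
theorem isOpen_setOf_fullRank [CompactSpace M] {A : Z → M → Mat n m} {S : Set Z} (hS : IsOpen S)
    (hA : ∀ z ∈ S, ∀ x, SmoothFamilyAt I A z x) :
    IsOpen {z | z ∈ S ∧ ∀ x, 0 < ((A z x)ᵀ * A z x).det} := by
  rw [isOpen_iff_mem_nhds]
  rintro z₀ ⟨hz₀, h⟩
  have h1 : ∀ x ∈ (univ : Set M), ∀ᶠ p : Z × M in 𝓝 (z₀, x),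
      0 < ((A p.1 p.2)ᵀ * A p.1 p.2).det := by
    intro x _
    have hc := (hA z₀ hz₀ x).continuousAt
    have hd : ContinuousAt (fun a : Mat n m => (aᵀ * a).det) (A z₀ x * frame I x x) :=
      (((contDiffAt_id (n := 0)).matrix_transpose.matrix_mul contDiffAt_id).matrix_det).continuousAt
    have h2 := (ContinuousAt.comp (x := (z₀, x)) hd hc).eventually
      (lt_mem_nhds (a := 0) (by simpa [frame_self] using h x))
    filter_upwards [h2] with p hp
    simp only [Function.comp_apply, gram_mul_det] at hp
    exact pos_of_mul_pos_left hp (sq_nonneg _)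
  have h2 := isCompact_univ.eventually_forall_of_forall_eventually (P := fun z x =>
    0 < ((A z x)ᵀ * A z x).det) h1
  filter_upwards [hS.mem_nhds hz₀, h2] with z hz hz2
  exact ⟨hz, fun x => hz2 x (mem_univ _)⟩

end SmoothFamilies

/-! ### The metric as an integral against a fixed finite measure -/

section RiemannianMeasure

open Filter Topology
open scoped Matrix.Norms.Operator

variable {m n : ℕ} {H : Type*} [TopologicalSpace H] {I : ModelWithCorners ℝ (Euc m) H}
  {M : Type*} [TopologicalSpace M] [ChartedSpace H M] [IsManifold I ∞ M]

/-- Here continuity is needed on the whole chart domain and not only near `i`. The coordinate vector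
fields of the chart are smooth there, and `α` is applied to them. -/
theorem continuousOn_mat_mul_frame (α : OneForm I M n) (i : M) :
    ContinuousOn (fun x => mat I α x * frame I i x) (chartAt H i).source := by
  have key : ∀ v : Euc m, ContinuousOn (fun x => (α x
      ((trivializationAt (Euc m) (TangentSpace I) i).symmL ℝ x v) : Euc n))
      (chartAt H i).source := by
    intro v x hx
    have hx' : x ∈ (trivializationAt (Euc m) (TangentSpace I) i).baseSet := hx
    have h1 : ContMDiffAt I (I.prod 𝓘(ℝ, Euc m)) ∞ (fun x => TotalSpace.mk' (Euc m) x
        ((trivializationAt (Euc m) (TangentSpace I) i).symmL ℝ x v)) x := by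
      rw [(trivializationAt (Euc m) (TangentSpace I) i).contMDiffAt_section_iff hx']
      refine (contMDiffAt_const (c := v)).congr_of_eventuallyEq ?_
      filter_upwards [(trivializationAt (Euc m) (TangentSpace I) i).open_baseSet.mem_nhds hx']
        with y hy
      rw [Bundle.Trivialization.symmL_apply _ hy, 
        Bundle.Trivialization.apply_mk_symm _ hy]
    have h2 := (α.contMDiff_toFun x).clm_bundle_apply h1
    exact ((contMDiffAt_section x).1 h2).continuousAt.continuousWithinAt
  have h3 : ∀ x k j, (mat I α x * frame I i x) k j = (α x
      ((trivializationAt (Euc m) (TangentSpace I) i).symmL ℝ x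
        (EuclideanSpace.single j 1)) : Euc n) k := fun x k j => by
    rw [mat, frame, ← toMat_comp, toMat_apply]
    rfl
  refine continuousOn_pi.2 fun k => continuousOn_pi.2 fun j => ?_
  simp only [h3]
  exact (EuclideanSpace.proj k : Euc n →L[ℝ] ℝ).continuous.comp_continuousOn (key _)

theorem continuousOn_sqrt_gram_det (α : OneForm I M n) (i : M) :
    ContinuousOn (fun x => Real.sqrt ((mat I α x * frame I i x)ᵀ * (mat I α x * frame I i x)).det)
      (chartAt H i).source := by
  have hc : Continuous (fun a : Mat n m => Real.sqrt (aᵀ * a).det) := 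
    Real.continuous_sqrt.comp (contDiff_iff_contDiffAt.2 fun a =>
      ((contDiffAt_id (n := 0)).matrix_transpose.matrix_mul contDiffAt_id).matrix_det).continuous
  exact hc.comp_continuousOn (continuousOn_mat_mul_frame α i)

variable [T2Space M] [CompactSpace M]

/-- The density of the volume of `r` in the chart at `i`, cut off by the partition of unity. -/
def chartDensity (r : OneForm I M n) (i : M) (y : Euc m) : ℝ :=
  partition I M i ((extChartAt I i).symm y) *
    Real.sqrt ((mat I r ((extChartAt I i).symm y) * frame I i ((extChartAt I i).symm y))ᵀ *
      (mat I r ((extChartAt I i).symm y) * frame I i ((extChartAt I i).symm y))).det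

theorem chartDensity_nonneg (r : OneForm I M n) (i : M) (y : Euc m) : 0 ≤ chartDensity r i y :=
  mul_nonneg ((partition I M).nonneg i _) (Real.sqrt_nonneg _)

theorem continuousOn_chartDensity (r : OneForm I M n) (i : M) :
    ContinuousOn (chartDensity r i) (extChartAt I i).target := by
  have hm : MapsTo (extChartAt I i).symm (extChartAt I i).target (chartAt H i).source := by
    intro y hy
    simpa using (extChartAt I i).map_target hy
  have hs := continuousOn_extChartAt_symm (I := I) i
  exact (((partition I M i).contMDiff.continuous).comp_continuousOn hs).mul
    ((continuousOn_sqrt_gram_det r i).comp hs hm)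

omit [IsManifold I ∞ M] [T2Space M] [CompactSpace M] in
theorem measurableSet_extChartAt_target (i : M) : MeasurableSet (extChartAt I i).target := by
  rw [extChartAt_target]
  have h1 : MeasurableSet (range I) := I.isClosed_range.measurableSet
  exact ((chartAt H i).open_target.preimage I.continuous_symm).measurableSet.inter h1

theorem integrableOn_chartDensity (r : OneForm I M n) (i : M) :
    IntegrableOn (chartDensity r i) (extChartAt I i).target := by
  have hsub : tsupport (partition I M i) ⊆ (chartAt H i).source :=
    (SmoothPartitionOfUnity.exists_isSubordinate_chartAt_source I M).choose_spec i
  -- The chart target need not be compact, but the density vanishes on it outside the compact image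
  -- of the support of the cut-off function.
  set K := extChartAt I i '' tsupport (partition I M i) with hK
  have hKc : IsCompact K := (isClosed_tsupport _).isCompact.image_of_continuousOn
    ((continuousOn_extChartAt i).mono (by simpa using hsub))
  have hKt : K ⊆ (extChartAt I i).target := by
    rintro _ ⟨x, hx, rfl⟩
    exact (extChartAt I i).map_source (by simpa using hsub hx)
  have h1 : IntegrableOn (chartDensity r i) K :=
    ((continuousOn_chartDensity r i).mono hKt).integrableOn_compact hKc
  refine h1.of_forall_sdiff_eq_zero (measurableSet_extChartAt_target i) ?_
  rintro y ⟨hy, hyK⟩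
  have : partition I M i ((extChartAt I i).symm y) = 0 := by
    apply image_eq_zero_of_notMem_tsupport
    intro h
    exact hyK ⟨_, h, (extChartAt I i).right_inv hy⟩
  rw [chartDensity, this, zero_mul]

theorem aemeasurable_chartDensity (r : OneForm I M n) (i : M) :
    AEMeasurable (chartDensity r i) (volume.restrict (extChartAt I i).target) :=
  (continuousOn_chartDensity r i).aemeasurable (measurableSet_extChartAt_target i)

theorem finite_support_partition :
    {i : M | partition I M i ≠ 0}.Finite := by
  have := (partition I M).locallyFinite.finite_nonempty_of_compact
  refine this.subset fun i hi => ?_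
  rw [mem_ofPred_eq, Function.support_nonempty_iff]
  intro h0
  exact hi (DFunLike.coe_injective h0)

variable [MeasurableSpace M] [BorelSpace M]

/-- The part of the volume measure of `r` in the chart at `i`. -/
def chartMeasure (r : OneForm I M n) (i : M) : Measure M :=
  Measure.map (extChartAt I i).symm
    ((volume.restrict (extChartAt I i).target).withDensity
      fun y => ENNReal.ofReal (chartDensity r i y))

omit [IsManifold I ∞ M] [T2Space M] [CompactSpace M] in
theorem aemeasurable_extChartAt_symm (i : M) :
    AEMeasurable (extChartAt I i).symm (volume.restrict (extChartAt I i).target) :=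
  (continuousOn_extChartAt_symm i).aemeasurable (measurableSet_extChartAt_target i)

instance isFiniteMeasure_chartMeasure (r : OneForm I M n) (i : M) :
    IsFiniteMeasure (chartMeasure r i) := by
  have := isFiniteMeasure_withDensity_ofReal (integrableOn_chartDensity r i).2
  unfold chartMeasure
  infer_instance

theorem integral_chartMeasure (r : OneForm I M n) (i : M) {h : M → ℝ} (hh : Continuous h) :
    ∫ x, h x ∂chartMeasure r i =
      ∫ y in (extChartAt I i).target, chartDensity r i y * h ((extChartAt I i).symm y) := by
  have h1 : AEMeasurable (extChartAt I i).symm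
      ((volume.restrict (extChartAt I i).target).withDensity
        fun y => ENNReal.ofReal (chartDensity r i y)) :=
    (aemeasurable_extChartAt_symm i).mono_ac (withDensity_absolutelyContinuous _ _)
  rw [chartMeasure, integral_map h1 hh.measurable.aestronglyMeasurable,
    integral_withDensity_eq_integral_toReal_smul₀
      (aemeasurable_chartDensity r i).ennreal_ofReal (by simp)]
  simp [ENNReal.toReal_ofReal (chartDensity_nonneg r i _)]

/-- The volume measure of `r`. -/
def volMeasure (r : OneForm I M n) : Measure M :=
  ∑ i ∈ (finite_support_partition (I := I) (M := M)).toFinset, chartMeasure r i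

instance isFiniteMeasure_volMeasure (r : OneForm I M n) : IsFiniteMeasure (volMeasure r) := by
  unfold volMeasure
  infer_instance

/-- Numerator and denominator of the quotient acquire the same factor `|det E|` in each chart, so
the quotient is a function on `M`, and multiplication by the density of `r` restores the integrand.
The measure depends only on `r`, so the metric along a varying form can be differentiated under the
integral. -/
theorem ebinMetric_eq_integral {r : OneForm I M n} (hr : r ∈ fullRank I)
    (α ζ η : M → Euc m →L[ℝ] Euc n)
    (hc : Continuous fun x => matInner (toMat n m (α x)) (toMat n m (ζ x)) (toMat n m (η x)) /
      Real.sqrt ((mat I r x)ᵀ * mat I r x).det) :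
    ebinMetric I (fun x v => α x v) (fun x v => ζ x v) (fun x v => η x v) =
      ∫ x, matInner (toMat n m (α x)) (toMat n m (ζ x)) (toMat n m (η x)) /
        Real.sqrt ((mat I r x)ᵀ * mat I r x).det ∂volMeasure r := by
  rw [mem_fullRank_iff] at hr
  rw [volMeasure, integral_finsetSum_measure fun i _ =>
    hc.integrable_of_hasCompactSupport (HasCompactSupport.of_compactSpace _)]
  rw [ebinMetric, finsum_eq_sum_of_support_subset
    (s := (finite_support_partition (I := I) (M := M)).toFinset)]
  · refine Finset.sum_congr rfl fun i _ => ?_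
    rw [integral_chartMeasure r i hc]
    refine setIntegral_congr_fun (measurableSet_extChartAt_target i) fun y hy => ?_
    have hx : (extChartAt I i).symm y ∈ (chartAt H i).source := by
      simpa using (extChartAt I i).map_target hy
    set x := (extChartAt I i).symm y with hxdef
    have hd := frame_det_ne_zero (I := I) hx
    have hpos := Real.sqrt_pos.2 (hr x)
    simp only [coordMatrix_eq, chartDensity]
    rw [← hxdef, matInner_mul _ _ _ hd, gram_mul_det, Real.sqrt_mul (hr x).le,
      Real.sqrt_sq_eq_abs]
    field_simp
  · intro i hi
    simp only [Finite.coe_toFinset, mem_ofPred_eq]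
    intro h0
    apply hi
    simp [h0]

/-- Some cut-off function is positive at a given point of the open set, and on a nonempty open piece
of the corresponding chart the density is positive. This is what makes a continuous nonnegative
function with zero integral vanish. -/
theorem isOpenPosMeasure_volMeasure {r : OneForm I M n} (hr : r ∈ fullRank I) :
    (volMeasure r).IsOpenPosMeasure := by
  rw [mem_fullRank_iff] at hr
  refine ⟨fun U hU ⟨x₀, hx₀⟩ h0 => ?_⟩
  obtain ⟨i, hi⟩ := (partition I M).exists_pos_of_mem (mem_univ x₀)
  have hsub : tsupport (partition I M i) ⊆ (chartAt H i).source :=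
    (SmoothPartitionOfUnity.exists_isSubordinate_chartAt_source I M).choose_spec i
  have hxs : x₀ ∈ (extChartAt I i).source := by
    simpa using hsub (subset_tsupport _ hi.ne')
  have hne : i ∈ (finite_support_partition (I := I) (M := M)).toFinset := by
    simp only [Finite.mem_toFinset, mem_ofPred_eq]
    intro h
    simp [h] at hi
  have h1 : chartMeasure r i U = 0 := by
    have : chartMeasure r i U ≤ volMeasure r U := by
      rw [volMeasure, Measure.finsetSum_apply]
      exact Finset.single_le_sum (f := fun i => chartMeasure r i U) (fun _ _ => zero_le) hne
    exact le_antisymm (this.trans h0.le) zero_le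
  have hae : AEMeasurable (extChartAt I i).symm
      ((volume.restrict (extChartAt I i).target).withDensity
        fun y => ENNReal.ofReal (chartDensity r i y)) :=
    (aemeasurable_extChartAt_symm i).mono_ac (withDensity_absolutelyContinuous _ _)
  rw [chartMeasure, Measure.map_apply_of_aemeasurable hae hU.measurableSet,
    withDensity_apply_eq_zero' (aemeasurable_chartDensity r i).ennreal_ofReal] at h1
  set y₀ := extChartAt I i x₀ with hy₀
  have hy₀t : y₀ ∈ (extChartAt I i).target := (extChartAt I i).map_source hxs
  have hnear : ∀ᶠ y in 𝓝[range I] y₀, y ∈ (extChartAt I i).target ∧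
      (extChartAt I i).symm y ∈ U ∧ 0 < partition I M i ((extChartAt I i).symm y) := by
    have ht : (extChartAt I i).target ∈ 𝓝[range I] y₀ := extChartAt_target_mem_nhdsWithin' hxs
    have hcont : ContinuousAt (extChartAt I i).symm y₀ := continuousAt_extChartAt_symm' hxs
    have hx : (extChartAt I i).symm y₀ = x₀ := (extChartAt I i).left_inv hxs
    have hO : IsOpen (U ∩ {x | 0 < partition I M i x}) :=
      hU.inter (isOpen_lt continuous_const (partition I M i).contMDiff.continuous)
    have hp := hcont.eventually (hO.mem_nhds (by rw [hx]; exact ⟨hx₀, hi⟩))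
    filter_upwards [ht, nhdsWithin_le_nhds hp] with y h1 h2
    exact ⟨h1, h2.1, h2.2⟩
  obtain ⟨O, hO, hyO, hOsub⟩ := mem_nhdsWithin.1 hnear
  -- At a boundary point the chart target is a neighbourhood only within the range of `I`. As that
  -- range lies in the closure of its interior, an honest open set of positive Lebesgue measure is
  -- still found arbitrarily close to `y₀`.
  have hcl : y₀ ∈ closure (interior (range I)) :=
    I.range_subset_closure_interior (extChartAt_target_subset_range i hy₀t)
  obtain ⟨y, hyO', hyi⟩ := mem_closure_iff.1 hcl O hO hyO
  have hV : IsOpen (O ∩ interior (range I)) := hO.inter isOpen_interior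
  have hVpos : 0 < volume (O ∩ interior (range I)) := hV.measure_pos volume ⟨y, hyO', hyi⟩
  have hVt : ∀ y ∈ O ∩ interior (range I), y ∈ (extChartAt I i).target ∧
      (extChartAt I i).symm y ∈ U ∧ 0 < partition I M i ((extChartAt I i).symm y) :=
    fun y hy => hOsub ⟨hy.1, interior_subset hy.2⟩
  have hle : (volume.restrict (extChartAt I i).target) (O ∩ interior (range I)) ≤ 0 := by
    rw [← h1]
    refine measure_mono fun y hy => ⟨?_, (hVt y hy).2.1⟩
    have hx : (extChartAt I i).symm y ∈ (chartAt H i).source := by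
      simpa using (extChartAt I i).map_target (hVt y hy).1
    simp only [ne_eq, ENNReal.ofReal_eq_zero, not_le, mem_ofPred_eq]
    refine mul_pos (hVt y hy).2.2 (Real.sqrt_pos.2 ?_)
    rw [gram_mul_det]
    exact mul_pos (hr _) (by have := frame_det_ne_zero (I := I) hx; positivity)
  rw [Measure.restrict_apply hV.measurableSet,
    inter_eq_left.2 fun y hy => (hVt y hy).1] at hle
  exact absurd hle (not_le.2 hVpos)

end RiemannianMeasure

/-! ### Integrals depending on a parameter -/

section ParametricIntegrals

open Filter Topology

variable {X : Type*} [TopologicalSpace X] [MeasurableSpace X] [BorelSpace X]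

theorem hasDerivAt_setIntegral {μ : Measure X} [IsFiniteMeasureOnCompacts μ] {K : Set X}
    (hK : IsCompact K) (hKm : MeasurableSet K) {U : Set ℝ} (hU : IsOpen U) {f f' : ℝ → X → ℝ}
    (hf : ContinuousOn (Function.uncurry f) (U ×ˢ K))
    (hf' : ContinuousOn (Function.uncurry f') (U ×ˢ K))
    (hd : ∀ s ∈ U, ∀ x ∈ K, HasDerivAt (fun s => f s x) (f' s x) s) {s₀ : ℝ} (hs₀ : s₀ ∈ U) :
    HasDerivAt (fun s => ∫ x in K, f s x ∂μ) (∫ x in K, f' s₀ x ∂μ) s₀ := by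
  obtain ⟨δ, hδ, hδU⟩ := Metric.isOpen_iff.1 hU s₀ hs₀
  have hsub : Metric.closedBall s₀ (δ / 2) ⊆ U :=
    (Metric.closedBall_subset_ball (by linarith)).trans hδU
  have hcomp : IsCompact (Metric.closedBall s₀ (δ / 2) ×ˢ K) :=
    (isCompact_closedBall s₀ (δ / 2)).prod hK
  obtain ⟨C, hC⟩ := hcomp.exists_bound_of_continuousOn
    (hf'.mono (prod_mono hsub Subset.rfl))
  have hsec : ∀ {g : ℝ → X → ℝ}, ContinuousOn (Function.uncurry g) (U ×ˢ K) → ∀ s ∈ U,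
      ContinuousOn (g s) K := fun hg s hs =>
    hg.comp (f := fun x => (s, x)) (by fun_prop) fun x hx => ⟨hs, hx⟩
  have hint : ∀ {g : ℝ → X → ℝ}, ContinuousOn (Function.uncurry g) (U ×ˢ K) → ∀ s ∈ U,
      IntegrableOn (g s) K μ := fun hg s hs => (hsec hg s hs).integrableOn_compact' hK hKm
  have hball : Metric.ball s₀ (δ / 2) ∈ 𝓝 s₀ := Metric.ball_mem_nhds _ (by linarith)
  refine (hasDerivAt_integral_of_dominated_loc_of_deriv_le (bound := fun _ => C) hball ?_
    (hint hf s₀ hs₀) (hint hf' s₀ hs₀).aestronglyMeasurable ?_ ?_ ?_).2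
  · filter_upwards [hU.mem_nhds hs₀] with s hs
    exact (hint hf s hs).aestronglyMeasurable
  · refine (ae_restrict_iff' hKm).2 (Eventually.of_forall fun x hx s hs => ?_)
    exact hC (s, x) ⟨Metric.ball_subset_closedBall hs, hx⟩
  · exact integrableOn_const hK.measure_lt_top.ne
  · refine (ae_restrict_iff' hKm).2 (Eventually.of_forall fun x hx s hs => ?_)
    exact hd s (hsub (Metric.ball_subset_closedBall hs)) x hx

theorem continuousOn_integral_of_compactSpace [CompactSpace X] {μ : Measure X} [IsFiniteMeasure μ]
    {P : Type*} [TopologicalSpace P] {S : Set P} {f : P → X → ℝ}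
    (hf : ContinuousOn (Function.uncurry f) (S ×ˢ univ)) :
    ContinuousOn (fun p => ∫ x, f p x ∂μ) S :=
  continuousOn_integral_of_compact_support isCompact_univ hf (by simp)

theorem hasDerivAt_integral_of_compactSpace [CompactSpace X] {μ : Measure X} [IsFiniteMeasure μ]
    {U : Set ℝ} (hU : IsOpen U) {f f' : ℝ → X → ℝ}
    (hf : ContinuousOn (Function.uncurry f) (U ×ˢ univ))
    (hf' : ContinuousOn (Function.uncurry f') (U ×ˢ univ))
    (hd : ∀ s ∈ U, ∀ x, HasDerivAt (fun s => f s x) (f' s x) s) {s₀ : ℝ} (hs₀ : s₀ ∈ U) :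
    HasDerivAt (fun s => ∫ x, f s x ∂μ) (∫ x, f' s₀ x ∂μ) s₀ := by
  simpa using hasDerivAt_setIntegral (μ := μ) isCompact_univ MeasurableSet.univ hU hf hf'
    (fun s hs x _ => hd s hs x) hs₀

theorem hasDerivAt_intervalIntegral {a b : ℝ} (hab : a ≤ b) {U : Set ℝ} (hU : IsOpen U)
    {f f' : ℝ → ℝ → ℝ} (hf : ContinuousOn (Function.uncurry f) (U ×ˢ Icc a b))
    (hf' : ContinuousOn (Function.uncurry f') (U ×ˢ Icc a b))
    (hd : ∀ s ∈ U, ∀ t ∈ Icc a b, HasDerivAt (fun s => f s t) (f' s t) s) {s₀ : ℝ} (hs₀ : s₀ ∈ U) :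
    HasDerivAt (fun s => ∫ t in a..b, f s t) (∫ t in a..b, f' s₀ t) s₀ := by
  simp only [intervalIntegral.integral_of_le hab, ← integral_Icc_eq_integral_Ioc]
  exact hasDerivAt_setIntegral isCompact_Icc measurableSet_Icc hU hf hf' hd hs₀

end ParametricIntegrals

/-! ### Continuity of the integrands -/

section PointwiseContinuity

open scoped Matrix.Norms.Operator

variable {m n : ℕ}

/-- In this form only products `p (aᵀa)⁻¹ qᵀ` occur, each of which is frame-independent; the
transformation law of `dMatInner` is then immediate. -/
theorem dMatInner_eq (a u v a' u' v' : Mat n m) :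
    dMatInner a u v a' u' v' =
      ((u' * (aᵀ * a)⁻¹ * vᵀ).trace
        - ((u * (aᵀ * a)⁻¹ * a'ᵀ) * (a * (aᵀ * a)⁻¹ * vᵀ)
          + (u * (aᵀ * a)⁻¹ * aᵀ) * (a' * (aᵀ * a)⁻¹ * vᵀ)).trace
        + (u * (aᵀ * a)⁻¹ * v'ᵀ).trace
        + (u * (aᵀ * a)⁻¹ * vᵀ).trace * (a' * (aᵀ * a)⁻¹ * aᵀ).trace) *
          Real.sqrt (aᵀ * a).det := by
  have h : (a' * (aᵀ * a)⁻¹ * aᵀ).trace = ((aᵀ * a)⁻¹ * (aᵀ * a')).trace := by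
    rw [Matrix.mul_assoc, Matrix.trace_mul_comm, Matrix.mul_assoc]
  rw [h]
  simp only [dMatInner, Matrix.mul_add, Matrix.add_mul, Matrix.mul_assoc]

theorem dMatInner_mul (a u v a' u' v' : Mat n m) {E : Mat m m} (hE : E.det ≠ 0) :
    dMatInner (a * E) (u * E) (v * E) (a' * E) (u' * E) (v' * E) =
      dMatInner a u v a' u' v' * |E.det| := by
  simp only [dMatInner_eq, mul_gram_inv_mul _ _ _ hE]
  rw [gram_mul_det, Real.sqrt_mul (gram_det_nonneg a), Real.sqrt_sq_eq_abs]
  ring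

section

variable {F : Type*} [NormedAddCommGroup F] [NormedSpace ℝ F] {N : WithTop ℕ∞} {x : F}
  {a u v a' u' v' : F → Mat n m}

theorem _root_.ContDiffAt.matInner (ha : ContDiffAt ℝ N a x) (hu : ContDiffAt ℝ N u x)
    (hv : ContDiffAt ℝ N v x) (hpos : 0 < ((a x)ᵀ * a x).det) :
    ContDiffAt ℝ N (fun y => matInner (a y) (u y) (v y)) x := by
  have hg := ha.matrix_transpose.matrix_mul ha
  exact (((hu.matrix_mul (hg.matrix_inv hpos.ne')).matrix_mul hv.matrix_transpose).matrix_trace).mul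
    (hg.matrix_det.sqrt hpos.ne')

theorem _root_.ContDiffAt.dMatInner (ha : ContDiffAt ℝ N a x) (hu : ContDiffAt ℝ N u x)
    (hv : ContDiffAt ℝ N v x) (ha' : ContDiffAt ℝ N a' x) (hu' : ContDiffAt ℝ N u' x)
    (hv' : ContDiffAt ℝ N v' x) (hpos : 0 < ((a x)ᵀ * a x).det) :
    ContDiffAt ℝ N (fun y => dMatInner (a y) (u y) (v y) (a' y) (u' y) (v' y)) x := by
  have hg := ha.matrix_transpose.matrix_mul ha
  have hG := hg.matrix_inv hpos.ne'
  have key : ∀ {p q : F → Mat n m}, ContDiffAt ℝ N p x → ContDiffAt ℝ N q x →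
      ContDiffAt ℝ N (fun y => p y * ((a y)ᵀ * a y)⁻¹ * (q y)ᵀ) x :=
    fun hp hq => (hp.matrix_mul hG).matrix_mul hq.matrix_transpose
  simp only [dMatInner_eq]
  exact ((((key hu' hv).matrix_trace.sub (((key hu ha').matrix_mul (key ha hv)).add
    ((key hu ha).matrix_mul (key ha' hv))).matrix_trace).add (key hu hv').matrix_trace).add
    ((key hu hv).matrix_trace.mul (key ha' ha).matrix_trace)).mul (hg.matrix_det.sqrt hpos.ne')

end

variable {H : Type*} [TopologicalSpace H] {I : ModelWithCorners ℝ (Euc m) H}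
  {M : Type*} [TopologicalSpace M] [ChartedSpace H M] [IsManifold I ∞ M]
  {Z : Type*} [NormedAddCommGroup Z] [NormedSpace ℝ Z]

theorem continuousAt_matInner_div {A B C : Z → M → Mat n m} {z₀ : Z} {x₀ : M}
    (hA : SmoothFamilyAt I A z₀ x₀) (hB : SmoothFamilyAt I B z₀ x₀)
    (hC : SmoothFamilyAt I C z₀ x₀) (hpos : 0 < ((A z₀ x₀)ᵀ * A z₀ x₀).det)
    {r : OneForm I M n} (hr : 0 < ((mat I r x₀)ᵀ * mat I r x₀).det) :
    ContinuousAt (fun p : Z × M => matInner (A p.1 p.2) (B p.1 p.2) (C p.1 p.2) /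
      Real.sqrt ((mat I r p.2)ᵀ * mat I r p.2).det) (z₀, x₀) := by
  refine continuousAt_of_invariant hA hB hC hC (smoothFamilyAt_const r z₀ x₀)
    (fun q => matInner q.1 q.2.1 q.2.2.1 / Real.sqrt (q.2.2.2.2ᵀ * q.2.2.2.2).det) ?_ ?_
  · refine ContDiffAt.continuousAt (𝕜 := ℝ) (n := 0) ?_
    refine ContDiffAt.div (ContDiffAt.matInner (by fun_prop) (by fun_prop) (by fun_prop) hpos) ?_
      (Real.sqrt_pos.2 hr).ne'
    have h : ContDiffAt ℝ 0 (fun q : Mat n m × Mat n m × Mat n m × Mat n m × Mat n m =>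
      q.2.2.2.2) (A z₀ x₀, B z₀ x₀, C z₀ x₀, C z₀ x₀, mat I r x₀) := by fun_prop
    exact (h.matrix_transpose.matrix_mul h).matrix_det.sqrt hr.ne'
  · intro a b c d s E hE
    simp only
    rw [matInner_mul _ _ _ hE, gram_mul_det, Real.sqrt_mul (gram_det_nonneg s),
      Real.sqrt_sq_eq_abs, mul_div_mul_right _ _ (abs_ne_zero.2 hE)]

theorem continuousAt_dMatInner_div {A B C D : Z → M → Mat n m} {z₀ : Z} {x₀ : M}
    (hA : SmoothFamilyAt I A z₀ x₀) (hB : SmoothFamilyAt I B z₀ x₀)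
    (hC : SmoothFamilyAt I C z₀ x₀) (hD : SmoothFamilyAt I D z₀ x₀)
    (hpos : 0 < ((A z₀ x₀)ᵀ * A z₀ x₀).det)
    {r : OneForm I M n} (hr : 0 < ((mat I r x₀)ᵀ * mat I r x₀).det) :
    ContinuousAt (fun p : Z × M => dMatInner (A p.1 p.2) (B p.1 p.2) (B p.1 p.2) (C p.1 p.2)
      (D p.1 p.2) (D p.1 p.2) / Real.sqrt ((mat I r p.2)ᵀ * mat I r p.2).det) (z₀, x₀) := by
  refine continuousAt_of_invariant hA hB hC hD (smoothFamilyAt_const r z₀ x₀)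
    (fun q => dMatInner q.1 q.2.1 q.2.1 q.2.2.1 q.2.2.2.1 q.2.2.2.1 /
      Real.sqrt (q.2.2.2.2ᵀ * q.2.2.2.2).det) ?_ ?_
  · refine ContDiffAt.continuousAt (𝕜 := ℝ) (n := 0) ?_
    refine ContDiffAt.div (ContDiffAt.dMatInner (by fun_prop) (by fun_prop) (by fun_prop)
      (by fun_prop) (by fun_prop) (by fun_prop) hpos) ?_ (Real.sqrt_pos.2 hr).ne'
    have h : ContDiffAt ℝ 0 (fun q : Mat n m × Mat n m × Mat n m × Mat n m × Mat n m =>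
      q.2.2.2.2) (A z₀ x₀, B z₀ x₀, C z₀ x₀, D z₀ x₀, mat I r x₀) := by fun_prop
    exact (h.matrix_transpose.matrix_mul h).matrix_det.sqrt hr.ne'
  · intro a b c d s E hE
    simp only
    rw [dMatInner_mul _ _ _ _ _ _ hE, gram_mul_det, Real.sqrt_mul (gram_det_nonneg s),
      Real.sqrt_sq_eq_abs, mul_div_mul_right _ _ (abs_ne_zero.2 hE)]

end PointwiseContinuity

/-! ### The first variation of the energy -/

section FirstVariation

open Filter Topology
open scoped Matrix.Norms.Operator

variable {m n : ℕ} {H : Type*} [TopologicalSpace H] {I : ModelWithCorners ℝ (Euc m) H}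
  {M : Type*} [TopologicalSpace M] [ChartedSpace H M] [IsManifold I ∞ M]

/-- The matrix of the velocity of a curve of one-forms. -/
def velMat (c : ℝ → OneForm I M n) (t : ℝ) (x : M) : Mat n m :=
  deriv (fun s => mat I (c s) x) t

/-- The matrix of the second derivative of a curve of one-forms. -/
def accMat (c : ℝ → OneForm I M n) (t : ℝ) (x : M) : Mat n m :=
  deriv (fun s => velMat c s x) t

/-- The covariant acceleration of a curve of one-forms, as a matrix. -/
def geodDefect (c : ℝ → OneForm I M n) (t : ℝ) (x : M) : Mat n m :=
  accMat c t x - geodF (mat I (c t) x) (velMat c t x)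

theorem smoothFamilyAt_velMat {J : Set ℝ} (hJ : IsOpen J) {c : ℝ → OneForm I M n}
    (hc : SmoothCurveOn I J c) : ∀ t ∈ J, ∀ x, SmoothFamilyAt I (velMat c) t x := by
  exact smoothFamilyAt_fderiv hJ ((smoothCurveOn_iff hJ).1 hc) 1

theorem smoothFamilyAt_accMat {J : Set ℝ} (hJ : IsOpen J) {c : ℝ → OneForm I M n}
    (hc : SmoothCurveOn I J c) : ∀ t ∈ J, ∀ x, SmoothFamilyAt I (accMat c) t x := by
  exact smoothFamilyAt_fderiv hJ (smoothFamilyAt_velMat hJ hc) 1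

theorem smoothFamilyAt_geodDefect {J : Set ℝ} (hJ : IsOpen J) {c : ℝ → OneForm I M n}
    (hc : SmoothCurveOn I J c) (hfr : ∀ t ∈ J, c t ∈ fullRank I) :
    ∀ t ∈ J, ∀ x, SmoothFamilyAt I (geodDefect c) t x := by
  intro t ht x
  have h1 := (smoothCurveOn_iff hJ).1 hc t ht x
  have h2 := smoothFamilyAt_velMat hJ hc t ht x
  have h3 := smoothFamilyAt_accMat hJ hc t ht x
  have hpos := (mem_fullRank_iff _).1 (hfr t ht) x
  have h4 := h1.map₂ h2 (fun q => geodF q.2.1 q.2.2)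
    (ContDiffAt.comp (g := fun p : Mat n m × Mat n m => geodF p.1 p.2) (t, mat I (c t) x, velMat c t x)
      (contDiffAt_geodF _ hpos) contDiffAt_snd) fun z a u E hE => geodF_mul a u hE
  exact h3.map₂ h4 (fun q => q.2.1 - q.2.2) (by fun_prop) fun z a u E _ => (Matrix.sub_mul a u E).symm

theorem hasDerivAt_mat {J : Set ℝ} (hJ : IsOpen J) {c : ℝ → OneForm I M n}
    (hc : SmoothCurveOn I J c) {t : ℝ} (ht : t ∈ J) (x : M) :
    HasDerivAt (fun s => mat I (c s) x) (velMat c t x) t :=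
  (((smoothCurveOn_iff hJ).1 hc t ht x).contDiffAt.differentiableAt (by simp)).hasDerivAt

theorem hasDerivAt_velMat {J : Set ℝ} (hJ : IsOpen J) {c : ℝ → OneForm I M n}
    (hc : SmoothCurveOn I J c) {t : ℝ} (ht : t ∈ J) (x : M) :
    HasDerivAt (fun s => velMat c s x) (accMat c t x) t :=
  ((smoothFamilyAt_velMat hJ hc t ht x).contDiffAt.differentiableAt (by simp)).hasDerivAt

theorem toMat_symm_mat (α : OneForm I M n) (x : M) (v : Euc m) :
    (toMat n m).symm (mat I α x) v = (α x v : Euc n) := by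
  rw [mat, ContinuousLinearEquiv.symm_apply_apply]
  rfl

theorem hasDerivAt_apply_of_mat {c : ℝ → OneForm I M n} {t : ℝ} {x : M} {V : Mat n m}
    (h : HasDerivAt (fun s => mat I (c s) x) V t) (v : Euc m) :
    HasDerivAt (fun s => (c s x v : Euc n)) ((toMat n m).symm V v) t := by
  have h1 := ((toMat n m).symm.hasFDerivAt.comp_hasDerivAt t h).clm_apply (hasDerivAt_const t v)
  refine (h1.congr_of_eventuallyEq (Eventually.of_forall fun s => ?_)).congr_deriv (by simp; rfl)
  exact (toMat_symm_mat (c s) x v).symm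

theorem hasVelocityAt_iff {c : ℝ → OneForm I M n} {ζ : OneForm I M n} {t : ℝ} :
    HasVelocityAt I c ζ t ↔ ∀ x, HasDerivAt (fun s => mat I (c s) x) (mat I ζ x) t := by
  constructor
  · intro h x
    have h1 : HasDerivAt (fun s => (fun k j => (c s x (EuclideanSpace.single j 1 : Euc m) : Euc n) k
        : Fin n → Fin m → ℝ)) (fun k j => (ζ x (EuclideanSpace.single j 1 : Euc m) : Euc n) k) t :=
      hasDerivAt_pi.2 fun k => hasDerivAt_pi.2 fun j =>
        (EuclideanSpace.proj k : Euc n →L[ℝ] ℝ).hasFDerivAt.comp_hasDerivAt t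
          (h x (EuclideanSpace.single j 1 : Euc m))
    let L : (Fin n → Fin m → ℝ) →L[ℝ] Mat n m :=
      LinearMap.toContinuousLinearMap (Matrix.ofLinearEquiv ℝ).toLinearMap
    have h2 := L.hasFDerivAt.comp_hasDerivAt t h1
    have e1 : ∀ α : OneForm I M n, mat I α x =
        L (fun k j => (α x (EuclideanSpace.single j 1 : Euc m) : Euc n) k) := fun α => by
      ext k j
      rw [mat_apply]
      rfl
    simp only [e1]
    exact h2
  · intro h x v
    have h1 := hasDerivAt_apply_of_mat (h x) v
    exact h1.congr_deriv (toMat_symm_mat ζ x v)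

variable [T2Space M] [CompactSpace M] [MeasurableSpace M] [BorelSpace M]

theorem ebinMetric_velocity {r : OneForm I M n} (hr : r ∈ fullRank I) {c : ℝ → OneForm I M n}
    {t : ℝ} {V : M → Mat n m} (hV : ∀ x, HasDerivAt (fun s => mat I (c s) x) (V x) t)
    (hc : Continuous fun x => matInner (mat I (c t) x) (V x) (V x) /
      Real.sqrt ((mat I r x)ᵀ * mat I r x).det) :
    ebinMetric I (fun x v => c t x v) (velocity I c t) (velocity I c t) =
      ∫ x, matInner (mat I (c t) x) (V x) (V x) / Real.sqrt ((mat I r x)ᵀ * mat I r x).det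
        ∂volMeasure r := by
  have h1 : velocity I c t = fun x v => (toMat n m).symm (V x) v := by
    funext x v
    exact (hasDerivAt_apply_of_mat (hV x) v).deriv
  have h2 := ebinMetric_eq_integral hr (fun x => show Euc m →L[ℝ] Euc n from c t x)
    (fun x => (toMat n m).symm (V x)) (fun x => (toMat n m).symm (V x))
    (by simpa only [ContinuousLinearEquiv.apply_symm_apply] using! hc)
  simp only [ContinuousLinearEquiv.apply_symm_apply] at h2
  rw [h1]
  exact h2

/-- The first variation formula of the energy. -/
theorem hasDerivAt_energy {r : OneForm I M n} (hr : r ∈ fullRank I) {J : Set ℝ} (hJ : IsOpen J)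
    {a b : ℝ} (hab : a < b) (hJab : Icc a b ⊆ J) {ε : ℝ} (hε : 0 < ε)
    {Γ : ℝ → ℝ → OneForm I M n} (hΓ : SmoothFamilyOn I (Ioo (-ε) ε) J Γ)
    (hfr : ∀ s ∈ Ioo (-ε) ε, ∀ t ∈ J, Γ s t ∈ fullRank I)
    (hends : ∀ s ∈ Ioo (-ε) ε, Γ s a = Γ 0 a ∧ Γ s b = Γ 0 b) :
    HasDerivAt (fun s => energy I (Γ s) a b)
      (-2 * ∫ t in a..b, ∫ x, matInner (mat I (Γ 0 t) x) (geodDefect (Γ 0) t x)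
        (deriv (fun s => mat I (Γ s t) x) 0) / Real.sqrt ((mat I r x)ᵀ * mat I r x).det
        ∂volMeasure r) 0 := by
  have hr' := (mem_fullRank_iff r).1 hr
  set ρ : M → ℝ := fun x => Real.sqrt ((mat I r x)ᵀ * mat I r x).det with hρ
  set T : Set ℝ := Ioo (-ε) ε with hT
  have hTo : IsOpen T := isOpen_Ioo
  have h0T : (0 : ℝ) ∈ T := ⟨by linarith, hε⟩
  have hSo : IsOpen (T ×ˢ J) := hTo.prod hJ
  let G : ℝ × ℝ → M → Mat n m := fun z x => mat I (Γ z.1 z.2) x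
  let V : ℝ × ℝ → M → Mat n m := fun z x => fderiv ℝ (fun z' => G z' x) z (0, 1)
  let W : ℝ × ℝ → M → Mat n m := fun z x => fderiv ℝ (fun z' => G z' x) z (1, 0)
  let V₁ : ℝ × ℝ → M → Mat n m := fun z x => fderiv ℝ (fun z' => V z' x) z (1, 0)
  let V₂ : ℝ × ℝ → M → Mat n m := fun z x => fderiv ℝ (fun z' => V z' x) z (0, 1)
  have hG : ∀ z ∈ T ×ˢ J, ∀ x, SmoothFamilyAt I G z x := (smoothFamilyOn_iff hTo hJ).1 hΓ
  have hV : ∀ z ∈ T ×ˢ J, ∀ x, SmoothFamilyAt I V z x := smoothFamilyAt_fderiv hSo hG _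
  have hW : ∀ z ∈ T ×ˢ J, ∀ x, SmoothFamilyAt I W z x := smoothFamilyAt_fderiv hSo hG _
  have hV₁ : ∀ z ∈ T ×ˢ J, ∀ x, SmoothFamilyAt I V₁ z x := smoothFamilyAt_fderiv hSo hV _
  have hpos : ∀ z ∈ T ×ˢ J, ∀ x, 0 < ((G z x)ᵀ * G z x).det := fun z hz x =>
    (mem_fullRank_iff _).1 (hfr z.1 hz.1 z.2 hz.2) x
  have line₁ : ∀ {A : ℝ × ℝ → M → Mat n m} {z : ℝ × ℝ} {x : M}, SmoothFamilyAt I A z x →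
      HasDerivAt (fun s => A (s, z.2) x) (fderiv ℝ (fun z' => A z' x) z (1, 0)) z.1 := by
    intro A z x hA
    have h1 := (hA.contDiffAt.differentiableAt (by simp)).hasFDerivAt
    exact h1.comp_hasDerivAt z.1 (f := fun s => (s, z.2))
      ((hasDerivAt_id z.1).prodMk (hasDerivAt_const z.1 z.2))
  have line₂ : ∀ {A : ℝ × ℝ → M → Mat n m} {z : ℝ × ℝ} {x : M}, SmoothFamilyAt I A z x →
      HasDerivAt (fun t => A (z.1, t) x) (fderiv ℝ (fun z' => A z' x) z (0, 1)) z.2 := by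
    intro A z x hA
    have h1 := (hA.contDiffAt.differentiableAt (by simp)).hasFDerivAt
    exact h1.comp_hasDerivAt z.2 (f := fun t => (z.1, t))
      ((hasDerivAt_const z.2 z.1).prodMk (hasDerivAt_id z.2))
  -- Symmetry of second derivatives: the time derivative of the variation field is the variation of
  -- the velocity.
  have hsymm : ∀ z ∈ T ×ˢ J, ∀ x, fderiv ℝ (fun z' => W z' x) z (0, 1) = V₁ z x := by
    intro z hz x
    have hc : ContDiffAt ℝ ∞ (fun z => G z x) z := (hG z hz x).contDiffAt
    have hd : DifferentiableAt ℝ (fderiv ℝ fun z' => G z' x) z :=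
      (hc.fderiv_right (m := 1) (by norm_cast)).differentiableAt one_ne_zero
    have hs : IsSymmSndFDerivAt ℝ (fun z => G z x) z :=
      hc.isSymmSndFDerivAt (by simp; norm_cast)
    have e1 : ∀ e : ℝ × ℝ, HasFDerivAt (fun z' => fderiv ℝ (fun z' => G z' x) z' e)
        ((ContinuousLinearMap.apply ℝ (Mat n m) e) ∘L
          (fderiv ℝ (fderiv ℝ fun z' => G z' x) z)) z := fun e =>
      (ContinuousLinearMap.apply ℝ (Mat n m) e).hasFDerivAt.comp z hd.hasFDerivAt
    have e2 := (e1 (1, 0)).fderiv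
    have e3 := (e1 (0, 1)).fderiv
    simp only [V₁, W, V, e2, e3]
    exact hs.eq (0, 1) (1, 0)
  let Λ : ℝ × ℝ → M → ℝ := fun z x => matInner (G z x) (V z x) (V z x) / ρ x
  let Λ₁ : ℝ × ℝ → M → ℝ := fun z x =>
    dMatInner (G z x) (V z x) (V z x) (W z x) (V₁ z x) (V₁ z x) / ρ x
  have hΛ : ContinuousOn (Function.uncurry Λ) ((T ×ˢ J) ×ˢ univ) := by
    rintro ⟨z, x⟩ ⟨hz, -⟩
    exact (continuousAt_matInner_div (hG z hz x) (hV z hz x) (hV z hz x) (hpos z hz x)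
      (hr' x)).continuousWithinAt
  have hΛ₁ : ContinuousOn (Function.uncurry Λ₁) ((T ×ˢ J) ×ˢ univ) := by
    rintro ⟨z, x⟩ ⟨hz, -⟩
    exact (continuousAt_dMatInner_div (hG z hz x) (hV z hz x) (hW z hz x) (hV₁ z hz x) (hpos z hz x)
      (hr' x)).continuousWithinAt
  have hdΛ : ∀ z ∈ T ×ˢ J, ∀ x, HasDerivAt (fun s => Λ (s, z.2) x) (Λ₁ z x) z.1 := fun z hz x =>
    (hasDerivAt_matInner (line₁ (hG z hz x)) (line₁ (hV z hz x)) (line₁ (hV z hz x))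
      (hpos z hz x)).div_const _
  have hvel : ∀ z ∈ T ×ˢ J, ∀ x, HasDerivAt (fun t => mat I (Γ z.1 t) x) (V z x) z.2 :=
    fun z hz x => line₂ (hG z hz x)
  have hcurve : ∀ {g : ℝ × ℝ → M → ℝ}, ContinuousOn (Function.uncurry g) ((T ×ˢ J) ×ˢ univ) →
      ∀ z ∈ T ×ˢ J, Continuous (g z) := by
    intro g hg z hz
    rw [← continuousOn_univ]
    exact hg.comp (f := fun x => (z, x)) (by fun_prop) fun x _ => ⟨hz, mem_univ _⟩
  have henergy : ∀ s ∈ T, energy I (Γ s) a b =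
      ∫ t in a..b, ∫ x, Λ (s, t) x ∂volMeasure r := by
    intro s hs
    refine intervalIntegral.integral_congr fun t ht => ?_
    rw [uIcc_of_le hab.le] at ht
    have hz : (s, t) ∈ T ×ˢ J := ⟨hs, hJab ht⟩
    exact ebinMetric_velocity hr (hvel (s, t) hz) (hcurve hΛ (s, t) hz)
  have hJT : ∀ {s t : ℝ}, s ∈ T → t ∈ Icc a b → (s, t) ∈ T ×ˢ J := fun hs ht => ⟨hs, hJab ht⟩
  have main : HasDerivAt (fun s => ∫ t in a..b, ∫ x, Λ (s, t) x ∂volMeasure r)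
      (∫ t in a..b, ∫ x, Λ₁ (0, t) x ∂volMeasure r) 0 := by
    refine hasDerivAt_intervalIntegral hab.le hTo
      (f := fun s t => ∫ x, Λ (s, t) x ∂volMeasure r)
      (f' := fun s t => ∫ x, Λ₁ (s, t) x ∂volMeasure r)
      ((continuousOn_integral_of_compactSpace hΛ).mono (prod_mono Subset.rfl hJab))
      ((continuousOn_integral_of_compactSpace hΛ₁).mono (prod_mono Subset.rfl hJab)) ?_ h0T
    intro s hs t ht
    refine hasDerivAt_integral_of_compactSpace hTo (f := fun s x => Λ (s, t) x)
      (f' := fun s x => Λ₁ (s, t) x) ?_ ?_ (fun s hs x => hdΛ (s, t) (hJT hs ht) x) hs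
    · exact hΛ.comp (f := fun p : ℝ × M => ((p.1, t), p.2)) (by fun_prop)
        fun p hp => ⟨hJT hp.1 ht, mem_univ _⟩
    · exact hΛ₁.comp (f := fun p : ℝ × M => ((p.1, t), p.2)) (by fun_prop)
        fun p hp => ⟨hJT hp.1 ht, mem_univ _⟩
  have main2 : HasDerivAt (fun s => energy I (Γ s) a b)
      (∫ t in a..b, ∫ x, Λ₁ (0, t) x ∂volMeasure r) 0 :=
    main.congr_of_eventuallyEq (by
      filter_upwards [hTo.mem_nhds h0T] with s hs using henergy s hs)
  refine main2.congr_deriv ?_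
  -- integration by parts in time
  have hcs : SmoothCurveOn I J (Γ 0) := by
    rw [smoothCurveOn_iff hJ]
    intro t ht x
    exact (hG (0, t) ⟨h0T, ht⟩ x).comp_param (φ := fun t => ((0 : ℝ), t)) (by fun_prop)
  have hV0 : ∀ t ∈ J, ∀ x, V (0, t) x = velMat (Γ 0) t x := fun t ht x =>
    (hvel (0, t) ⟨h0T, ht⟩ x).deriv.symm
  have hWd : ∀ t ∈ J, ∀ x, W (0, t) x = deriv (fun s => mat I (Γ s t) x) 0 := fun t ht x =>
    (line₁ (hG (0, t) ⟨h0T, ht⟩ x)).deriv.symm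
  have hV2 : ∀ t ∈ J, ∀ x, V₂ (0, t) x = accMat (Γ 0) t x := by
    intro t ht x
    have h1 := line₂ (hV (0, t) ⟨h0T, ht⟩ x)
    have h2 := hasDerivAt_velMat hJ hcs ht x
    refine (h1.congr_of_eventuallyEq ?_).unique h2
    filter_upwards [hJ.mem_nhds ht] with τ hτ using (hV0 τ hτ x).symm
  have hD := smoothFamilyAt_geodDefect hJ hcs (hfr 0 h0T)
  have hG0 : ∀ t ∈ J, ∀ x, SmoothFamilyAt I (fun t x => G (0, t) x) t x := fun t ht x =>
    (hG (0, t) ⟨h0T, ht⟩ x).comp_param (φ := fun t => ((0 : ℝ), t)) (by fun_prop)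
  have hW0 : ∀ t ∈ J, ∀ x, SmoothFamilyAt I (fun t x => W (0, t) x) t x := fun t ht x =>
    (hW (0, t) ⟨h0T, ht⟩ x).comp_param (φ := fun t => ((0 : ℝ), t)) (by fun_prop)
  have hVV0 : ∀ t ∈ J, ∀ x, SmoothFamilyAt I (fun t x => V (0, t) x) t x := fun t ht x =>
    (hV (0, t) ⟨h0T, ht⟩ x).comp_param (φ := fun t => ((0 : ℝ), t)) (by fun_prop)
  -- `P` is the boundary term `2⟨c', w⟩`. Its time derivative is the varied Lagrangian `Λ₁` plus `2
  -- Q`, and `P` vanishes at both end points, where `w = 0`.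
  let P : ℝ → M → ℝ := fun t x => 2 * (matInner (G (0, t) x) (V (0, t) x) (W (0, t) x) / ρ x)
  let Q : ℝ → M → ℝ := fun t x =>
    matInner (G (0, t) x) (geodDefect (Γ 0) t x) (W (0, t) x) / ρ x
  have hP : ContinuousOn (Function.uncurry P) (J ×ˢ univ) := by
    rintro ⟨t, x⟩ ⟨ht, -⟩
    exact ((continuousAt_matInner_div (hG0 t ht x) (hVV0 t ht x) (hW0 t ht x)
      (hpos (0, t) ⟨h0T, ht⟩ x) (hr' x)).const_mul 2).continuousWithinAt
  have hQ : ContinuousOn (Function.uncurry Q) (J ×ˢ univ) := by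
    rintro ⟨t, x⟩ ⟨ht, -⟩
    exact (continuousAt_matInner_div (hG0 t ht x) (hD t ht x) (hW0 t ht x)
      (hpos (0, t) ⟨h0T, ht⟩ x) (hr' x)).continuousWithinAt
  have hΛ₁0 : ContinuousOn (Function.uncurry fun t x => Λ₁ (0, t) x) (J ×ˢ univ) :=
    hΛ₁.comp (f := fun p : ℝ × M => (((0 : ℝ), p.1), p.2)) (by fun_prop)
      fun p hp => ⟨⟨h0T, hp.1⟩, mem_univ _⟩
  have hP' : ContinuousOn (Function.uncurry fun t x => Λ₁ (0, t) x + 2 * Q t x) (J ×ˢ univ) :=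
    hΛ₁0.add (continuousOn_const.mul hQ)
  have hdP : ∀ t ∈ J, ∀ x, HasDerivAt (fun t => P t x) (Λ₁ (0, t) x + 2 * Q t x) t := by
    intro t ht x
    have hz : ((0 : ℝ), t) ∈ T ×ˢ J := ⟨h0T, ht⟩
    have h1 := ((hasDerivAt_matInner (line₂ (hG _ hz x)) (line₂ (hV _ hz x)) (line₂ (hW _ hz x))
      (hpos _ hz x)).div_const (ρ x)).const_mul 2
    refine h1.congr_deriv ?_
    have h2 := dMatInner_sub (G (0, t) x) (V (0, t) x) (W (0, t) x) (V₂ (0, t) x) (V₁ (0, t) x)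
    have h3 : geodDefect (Γ 0) t x = V₂ (0, t) x - geodF (G (0, t) x) (V (0, t) x) := by
      rw [geodDefect, hV2 t ht, hV0 t ht]
    simp only [Λ₁, Q, h3, hsymm _ hz x]
    simp only [V₂, V] at h2 ⊢
    rw [sub_eq_iff_eq_add] at h2
    rw [← mul_div_assoc, h2]
    ring
  have hdPi : ∀ t ∈ J, HasDerivAt (fun t => ∫ x, P t x ∂volMeasure r)
      (∫ x, (Λ₁ (0, t) x + 2 * Q t x) ∂volMeasure r) t := fun t ht =>
    hasDerivAt_integral_of_compactSpace hJ hP hP' hdP ht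
  have hW_end : ∀ t ∈ J, (∀ s ∈ T, Γ s t = Γ 0 t) → ∀ x, W (0, t) x = 0 := by
    intro t ht hst x
    rw [hWd t ht x]
    have : (fun s => mat I (Γ s t) x) =ᶠ[𝓝 0] fun _ => mat I (Γ 0 t) x := by
      filter_upwards [hTo.mem_nhds h0T] with s hs
      rw [hst s hs]
    exact this.deriv_eq.trans (deriv_const _ _)
  have hP_end : ∀ t ∈ J, (∀ s ∈ T, Γ s t = Γ 0 t) → ∫ x, P t x ∂volMeasure r = 0 := by
    intro t ht hst
    have : ∀ x, P t x = 0 := fun x => by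
      simp [P, hW_end t ht hst x, matInner]
    simp [this]
  have haJ : a ∈ J := hJab ⟨le_rfl, hab.le⟩
  have hbJ : b ∈ J := hJab ⟨hab.le, le_rfl⟩
  have hint1 : IntervalIntegrable (fun t => ∫ x, Λ₁ (0, t) x ∂volMeasure r) volume a b := by
    refine ContinuousOn.intervalIntegrable ?_
    rw [uIcc_of_le hab.le]
    exact (continuousOn_integral_of_compactSpace hΛ₁0).mono hJab
  have hint2 : IntervalIntegrable (fun t => ∫ x, Q t x ∂volMeasure r) volume a b := by
    refine ContinuousOn.intervalIntegrable ?_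
    rw [uIcc_of_le hab.le]
    exact (continuousOn_integral_of_compactSpace hQ).mono hJab
  have hsec : ∀ {g : ℝ → M → ℝ}, ContinuousOn (Function.uncurry g) (J ×ˢ univ) →
      ∀ t ∈ J, Integrable (g t) (volMeasure r) := by
    intro g hg t ht
    have : Continuous (g t) := by
      rw [← continuousOn_univ]
      exact hg.comp (f := fun x => (t, x)) (by fun_prop) fun x _ => ⟨ht, mem_univ _⟩
    exact this.integrable_of_hasCompactSupport (HasCompactSupport.of_compactSpace _)
  have hsplit : ∀ t ∈ J, ∫ x, (Λ₁ (0, t) x + 2 * Q t x) ∂volMeasure r =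
      ∫ x, Λ₁ (0, t) x ∂volMeasure r + 2 * ∫ x, Q t x ∂volMeasure r := by
    intro t ht
    rw [integral_add (hsec hΛ₁0 t ht) ((hsec hQ t ht).const_mul 2), integral_const_mul]
  have hFTC := intervalIntegral.integral_eq_sub_of_hasDerivAt (a := a) (b := b)
    (f := fun t => ∫ x, P t x ∂volMeasure r)
    (f' := fun t => ∫ x, Λ₁ (0, t) x ∂volMeasure r + 2 * ∫ x, Q t x ∂volMeasure r)
    (fun t ht => by
      rw [uIcc_of_le hab.le] at ht
      rw [← hsplit t (hJab ht)]
      exact hdPi t (hJab ht)) (hint1.add (hint2.const_mul 2))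
  rw [intervalIntegral.integral_add hint1 (hint2.const_mul 2),
    intervalIntegral.integral_const_mul, hP_end a haJ (fun s hs => (hends s hs).1),
    hP_end b hbJ (fun s hs => (hends s hs).2)] at hFTC
  have hQeq : ∫ t in a..b, ∫ x, Q t x ∂volMeasure r = ∫ t in a..b, ∫ x,
      matInner (mat I (Γ 0 t) x) (geodDefect (Γ 0) t x)
        (deriv (fun s => mat I (Γ s t) x) 0) / ρ x ∂volMeasure r := by
    refine intervalIntegral.integral_congr fun t ht => ?_
    rw [uIcc_of_le hab.le] at ht
    simp only [Q, G, hWd t (hJab ht)]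
  rw [← hQeq]
  linarith

end FirstVariation

/-! ### Geodesics and the geodesic equation -/

section GeodesicEquation

open Filter Topology
open scoped Matrix.Norms.Operator

variable {m n : ℕ} {H : Type*} [TopologicalSpace H] {I : ModelWithCorners ℝ (Euc m) H}
  {M : Type*} [TopologicalSpace M] [ChartedSpace H M] [IsManifold I ∞ M]

theorem mat_add_smul (α β : OneForm I M n) (s : ℝ) (x : M) :
    mat I (α + s • β) x = mat I α x + s • mat I β x := by
  have h1 : mat I (α + s • β) x = toMat n m ((show Euc m →L[ℝ] Euc n from α x) +
    s • (show Euc m →L[ℝ] Euc n from β x)) := rfl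
  rw [h1, map_add, map_smul]
  rfl

theorem matInner_smul_right (a u v : Mat n m) (s : ℝ) :
    matInner a u (s • v) = s * matInner a u v := by
  simp only [matInner, Matrix.transpose_smul, Matrix.mul_smul, Matrix.trace_smul, smul_eq_mul]
  ring

theorem velMat_congr {J : Set ℝ} (hJ : IsOpen J) {c c' : ℝ → OneForm I M n}
    (h : ∀ t ∈ J, c t = c' t) {t : ℝ} (ht : t ∈ J) (x : M) : velMat c t x = velMat c' t x := by
  have : (fun s => mat I (c s) x) =ᶠ[𝓝 t] fun s => mat I (c' s) x := by
    filter_upwards [hJ.mem_nhds ht] with s hs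
    rw [h s hs]
  exact this.deriv_eq

theorem geodDefect_congr {J : Set ℝ} (hJ : IsOpen J) {c c' : ℝ → OneForm I M n}
    (h : ∀ t ∈ J, c t = c' t) {t : ℝ} (ht : t ∈ J) (x : M) :
    geodDefect c t x = geodDefect c' t x := by
  have : (fun s => velMat c s x) =ᶠ[𝓝 t] fun s => velMat c' s x := by
    filter_upwards [hJ.mem_nhds ht] with s hs
    exact velMat_congr hJ h hs x
  have h2 : accMat c t x = accMat c' t x := this.deriv_eq
  rw [geodDefect, geodDefect, h2, velMat_congr hJ h ht x, h t ht]

/-- Geodesics of the same initial data agree on each common interval. -/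
theorem eq_of_geodDefect_eq_zero {J : Set ℝ} (hJ : IsOpen J) (hJc : J.OrdConnected)
    {c c' : ℝ → OneForm I M n} (hc : SmoothCurveOn I J c) (hc' : SmoothCurveOn I J c')
    (hfr : ∀ t ∈ J, c t ∈ fullRank I)
    (hd : ∀ t ∈ J, ∀ x, geodDefect c t x = 0) (hd' : ∀ t ∈ J, ∀ x, geodDefect c' t x = 0)
    {t₀ : ℝ} (ht₀ : t₀ ∈ J) (h0 : c t₀ = c' t₀) (hv0 : ∀ x, velMat c t₀ x = velMat c' t₀ x) :
    ∀ t ∈ J, c t = c' t := by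
  intro t ht
  refine mat_injective fun x => ?_
  let v : Mat n m × Mat n m → Mat n m × Mat n m := fun p => (p.2, geodF p.1 p.2)
  have hy : ∀ {c : ℝ → OneForm I M n}, SmoothCurveOn I J c →
      (∀ t ∈ J, ∀ x, geodDefect c t x = 0) → ∀ t ∈ J,
      HasDerivAt (fun t => (mat I (c t) x, velMat c t x)) (v (mat I (c t) x, velMat c t x)) t := by
    intro c hc hd t ht
    have h1 := hasDerivAt_velMat hJ hc ht x
    rw [sub_eq_zero.1 (hd t ht x)] at h1
    exact (hasDerivAt_mat hJ hc ht x).prodMk h1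
  set y : ℝ → Mat n m × Mat n m := fun t => (mat I (c t) x, velMat c t x) with hydef
  set y' : ℝ → Mat n m × Mat n m := fun t => (mat I (c' t) x, velMat c' t x) with hydef'
  have hyd := hy hc hd
  have hyd' := hy hc' hd'
  -- At full rank the vector field of the first-order system is smooth, hence locally Lipschitz,
  -- which gives local uniqueness.
  have hloc : ∀ t ∈ J, y t = y' t → y =ᶠ[𝓝 t] y' := by
    intro t ht heq
    have hp : 0 < ((y t).1ᵀ * (y t).1).det := (mem_fullRank_iff _).1 (hfr t ht) x
    have hv : ContDiffAt ℝ 1 v (y t) := contDiffAt_snd.prodMk (contDiffAt_geodF _ hp)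
    obtain ⟨K, s, hs, hK⟩ := hv.exists_lipschitzOnWith
    refine ODE_solution_unique_of_eventually (v := fun _ => v) (s := fun _ => s)
      (Eventually.of_forall fun _ => hK) ?_ ?_ heq
    · filter_upwards [hJ.mem_nhds ht, (hyd t ht).continuousAt.eventually hs] with τ h1 h2
      exact ⟨hyd τ h1, h2⟩
    · rw [heq] at hs
      filter_upwards [hJ.mem_nhds ht, (hyd' t ht).continuousAt.eventually hs] with τ h1 h2
      exact ⟨hyd' τ h1, h2⟩
  -- The set of times where the germs agree is open, and by continuity and `hloc` relatively closed
  -- in the connected set `J`.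
  have hsub : J ⊆ {t | y =ᶠ[𝓝 t] y'} := by
    refine hJc.isPreconnected.subset_of_closure_inter_subset isOpen_setOfPred_eventually_nhds
      ⟨t₀, ht₀, hloc t₀ ht₀ ?_⟩ ?_
    · simp only [hydef, hydef', h0, hv0 x]
    · rintro τ ⟨hτ, hτJ⟩
      refine hloc τ hτJ ?_
      have hcl : τ ∈ closure {t | y t = y' t} := closure_mono (fun s hs => hs.self_of_nhds) hτ
      obtain ⟨F, hF1, hF2⟩ := mem_closure_iff_ultrafilter.1 hcl
      have e1 := ((hyd τ hτJ).continuousAt.tendsto.mono_left hF2)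
      have e2 := ((hyd' τ hτJ).continuousAt.tendsto.mono_left hF2)
      exact tendsto_nhds_unique e1 (e2.congr' (by filter_upwards [hF1] with s hs using hs.symm))
  exact congrArg Prod.fst (hsub ht).self_of_nhds

variable [T2Space M] [CompactSpace M]

/-- The first variation formula has the covariant acceleration as a factor of its integrand. -/
theorem isGeodesicIn_of_geodDefect_eq_zero {J : Set ℝ} (hJ : IsOpen J) (hJc : J.OrdConnected)
    {c : ℝ → OneForm I M n} (hc : SmoothCurveOn I J c) (hfr : ∀ t ∈ J, c t ∈ fullRank I)
    (hd : ∀ t ∈ J, ∀ x, geodDefect c t x = 0) : IsGeodesicIn I (fullRank I) J c where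
  isOpen := hJ
  ordConnected := hJc
  smooth := hc
  mem := hfr
  critical := by
    intro a b hab hJab ε hε Γ hΓ hmem h0 hends
    borelize M
    have haJ : a ∈ J := hJab ⟨le_rfl, hab.le⟩
    have hbJ : b ∈ J := hJab ⟨hab.le, le_rfl⟩
    have h := hasDerivAt_energy (hfr a haJ) hJ hab hJab hε hΓ hmem
      (fun s hs => by rw [h0 a haJ, h0 b hbJ]; exact hends s hs)
    refine h.congr_deriv ?_
    rw [mul_eq_zero]
    right
    rw [intervalIntegral.integral_of_le hab.le]
    refine setIntegral_eq_zero_of_forall_eq_zero fun t ht => ?_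
    have htJ : t ∈ J := hJab (Ioc_subset_Icc_self ht)
    simp only [geodDefect_congr hJ h0 htJ, hd t htJ]
    simp [matInner]

/-- If a geodesic of `N` can be varied within `N` in the direction of its covariant acceleration,
then its covariant acceleration vanishes. -/
theorem geodDefect_eq_zero_of_isGeodesicIn {N : Set (OneForm I M n)} (hN : N ⊆ fullRank I)
    {J : Set ℝ} {c : ℝ → OneForm I M n} (hc : IsGeodesicIn I N J c)
    (hvar : ∀ (χ : ℝ → ℝ) (θ : ℝ → OneForm I M n), ContDiff ℝ ∞ χ → HasCompactSupport χ →
      tsupport χ ⊆ J → (∀ t ∈ J, ∀ x, mat I (θ t) x = geodDefect c t x) →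
      SmoothFamilyOn I univ J (fun s t => c t + (s * χ t) • θ t) →
      ∃ ε > 0, ∀ s ∈ Ioo (-ε) ε, ∀ t ∈ J, c t + (s * χ t) • θ t ∈ N) :
    ∀ t ∈ J, ∀ x, geodDefect c t x = 0 := by
  intro t₀ ht₀
  have hJ := hc.isOpen
  have hfr : ∀ t ∈ J, c t ∈ fullRank I := fun t ht => hN (hc.mem t ht)
  obtain ⟨δ, hδ, hδJ⟩ := Metric.isOpen_iff.1 hJ t₀ ht₀
  let χ : ContDiffBump t₀ := ⟨δ / 4, δ / 3, by linarith, by linarith⟩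
  have hD := smoothFamilyAt_geodDefect hJ hc.smooth hfr
  have hex : ∀ t, ∃ θ : OneForm I M n, t ∈ J → ∀ x, mat I θ x = geodDefect c t x := by
    intro t
    by_cases ht : t ∈ J
    · obtain ⟨θ, hθ⟩ := exists_mat_eq (hD t ht)
      exact ⟨θ, fun _ => hθ⟩
    · exact ⟨0, fun h => absurd h ht⟩
  choose θ hθ using hex
  have hχJ : tsupport χ ⊆ J := by
    rw [χ.tsupport_eq]
    exact (Metric.closedBall_subset_ball (by change δ / 3 < δ; linarith)).trans hδJ
  set Γ : ℝ → ℝ → OneForm I M n := fun s t => c t + (s * χ t) • θ t with hΓdef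
  have hΓmat : ∀ s, ∀ t ∈ J, ∀ x,
      mat I (Γ s t) x = mat I (c t) x + (s * χ t) • geodDefect c t x := by
    intro s t ht x
    rw [hΓdef, mat_add_smul, hθ t ht]
  have hχs : ContDiff ℝ ∞ χ := χ.contDiff
  have hΓs : SmoothFamilyOn I univ J Γ := by
    rw [smoothFamilyOn_iff isOpen_univ hJ]
    rintro z ⟨-, ht⟩ x
    have h1' := (smoothCurveOn_iff hJ).1 hc.smooth z.2 ht x
    have h1 := h1'.comp_param (φ := fun z : ℝ × ℝ => z.2) (z := z) (by fun_prop)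
    have h2 := (hD z.2 ht x).comp_param (φ := fun z : ℝ × ℝ => z.2) (z := z) (by fun_prop)
    have h3 := h1.map₂ h2 (fun q => q.2.1 + (q.1.1 * χ q.1.2) • q.2.2)
      (ContDiff.contDiffAt (by
        have h4 : ContDiff ℝ ∞ fun q : (ℝ × ℝ) × Mat n m × Mat n m => χ q.1.2 :=
          hχs.comp (by fun_prop)
        fun_prop))
      (fun z a u E _ => by simp [Matrix.add_mul])
    refine ContMDiffAt.congr_of_eventuallyEq h3 ?_
    have : ∀ᶠ p : (ℝ × ℝ) × M in 𝓝 (z, x), p.1.2 ∈ J := by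
      have hc : ContinuousAt (fun p : (ℝ × ℝ) × M => p.1.2) (z, x) := by fun_prop
      exact hc.eventually (hJ.mem_nhds ht)
    filter_upwards [this] with p hp
    simp only [hΓmat p.1.1 p.1.2 hp]
  obtain ⟨ε, hε, hεN⟩ := hvar χ θ hχs χ.hasCompactSupport hχJ (fun t ht => hθ t ht) hΓs
  have hΓε : SmoothFamilyOn I (Ioo (-ε) ε) J Γ :=
    ContMDiffOn.mono hΓs (prod_mono (prod_mono (subset_univ _) Subset.rfl) Subset.rfl)
  -- The bump function vanishes from distance `δ / 3` on, so `χ` is zero at distance `δ / 2` and the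
  -- variation fixes the end points, while `[a, b]` stays inside the ball of radius `δ` in `J`.
  set a := t₀ - δ / 2 with ha
  set b := t₀ + δ / 2 with hb
  have hab : a < b := by linarith
  have hJab : Icc a b ⊆ J := by
    intro t ht
    refine hδJ ?_
    rw [Metric.mem_ball, Real.dist_eq, abs_lt]
    constructor <;> linarith [ht.1, ht.2]
  have hχ0 : ∀ t, δ / 3 ≤ dist t t₀ → χ t = 0 := fun t ht => χ.zero_of_le_dist ht
  have hχa : χ a = 0 := hχ0 a (by rw [Real.dist_eq, ha, abs_of_nonpos] <;> linarith)
  have hχb : χ b = 0 := hχ0 b (by rw [Real.dist_eq, hb, abs_of_nonneg] <;> linarith)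
  have hΓ0 : Γ 0 = c := by
    funext t
    refine mat_injective fun x => ?_
    simp only [hΓdef, mat_add_smul, zero_mul, zero_smul, add_zero]
  have hΓa : ∀ s, Γ s a = c a := fun s => mat_injective fun x => by
    simp only [hΓdef, mat_add_smul, hχa, mul_zero, zero_smul, add_zero]
  have hΓb : ∀ s, Γ s b = c b := fun s => mat_injective fun x => by
    simp only [hΓdef, mat_add_smul, hχb, mul_zero, zero_smul, add_zero]
  have hcrit := hc.critical a b hab hJab ε hε Γ hΓε hεN (fun t _ => by rw [hΓ0])
    (fun s _ => ⟨hΓa s, hΓb s⟩)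
  borelize M
  set r := c t₀ with hr
  have hr' := (mem_fullRank_iff r).1 (hfr t₀ ht₀)
  have hFV := hasDerivAt_energy (r := r) (hfr t₀ ht₀) hJ hab hJab hε hΓε
    (fun s hs t ht => hN (hεN s hs t ht)) (fun s _ => by rw [hΓ0, hΓa, hΓb]; exact ⟨rfl, rfl⟩)
  have h0 := hFV.unique hcrit
  set ρ : M → ℝ := fun x => Real.sqrt ((mat I r x)ᵀ * mat I r x).det with hρ
  set q : ℝ → M → ℝ := fun t x =>
    matInner (mat I (c t) x) (geodDefect c t x) (geodDefect c t x) / ρ x with hq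
  have hqc : ContinuousOn (Function.uncurry q) (J ×ˢ univ) := by
    rintro ⟨t, x⟩ ⟨ht, -⟩
    exact (continuousAt_matInner_div ((smoothCurveOn_iff hJ).1 hc.smooth t ht x) (hD t ht x)
      (hD t ht x) ((mem_fullRank_iff _).1 (hfr t ht) x) (hr' x)).continuousWithinAt
  have hqnn : ∀ t ∈ J, ∀ x, 0 ≤ q t x := fun t ht x =>
    div_nonneg (matInner_self_nonneg _ _ ((mem_fullRank_iff _).1 (hfr t ht) x)) (Real.sqrt_nonneg _)
  have hqi : ContinuousOn (fun t => ∫ x, q t x ∂volMeasure r) J :=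
    continuousOn_integral_of_compactSpace hqc
  -- The variation field is `χ` times the covariant acceleration, so the vanishing first variation
  -- is an integral of `χ q` with `q ≥ 0`. Positivity of the inner integral at `t₀`, where `χ = 1`,
  -- would make it positive.
  have h1 : ∫ t in a..b, χ t * ∫ x, q t x ∂volMeasure r = 0 := by
    have h2 := (mul_eq_zero.1 h0).resolve_left (by norm_num)
    rw [← h2]
    refine intervalIntegral.integral_congr fun t ht => ?_
    rw [uIcc_of_le hab.le] at ht
    have htJ := hJab ht
    have hW : ∀ x, deriv (fun s => mat I (Γ s t) x) 0 = χ t • geodDefect c t x := by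
      intro x
      have e1 : HasDerivAt (fun s : ℝ => mat I (c t) x + (s * χ t) • geodDefect c t x)
          ((1 * χ t) • geodDefect c t x) 0 :=
        (((hasDerivAt_id (0 : ℝ)).mul_const (χ t)).smul_const _).const_add _
      rw [one_mul] at e1
      refine (e1.congr_of_eventuallyEq (Eventually.of_forall fun s => ?_)).deriv
      exact hΓmat s t htJ x
    simp only [hΓ0, hW, matInner_smul_right, ← integral_const_mul, hq]
    refine integral_congr_ae (Eventually.of_forall fun x => ?_)
    simp only
    ring
  have h2 : ∫ x, q t₀ x ∂volMeasure r = 0 := by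
    by_contra hne
    have hpos : 0 < ∫ x, q t₀ x ∂volMeasure r :=
      lt_of_le_of_ne (integral_nonneg (hqnn t₀ ht₀)) (Ne.symm hne)
    have h3 : 0 < ∫ t in a..b, χ t * ∫ x, q t x ∂volMeasure r := by
      refine intervalIntegral.integral_pos hab ?_ ?_ ⟨t₀, ⟨by linarith, by linarith⟩, ?_⟩
      · exact χ.continuous.continuousOn.mul (hqi.mono hJab)
      · intro t ht
        exact mul_nonneg χ.nonneg (integral_nonneg (hqnn t (hJab (Ioc_subset_Icc_self ht))))
      · rw [χ.one_of_mem_closedBall (Metric.mem_closedBall_self (by change 0 ≤ δ / 4; linarith)),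
          one_mul]
        exact hpos
    exact h3.ne' h1
  intro x
  have hcont : Continuous (q t₀) := by
    rw [← continuousOn_univ]
    exact hqc.comp (f := fun x => (t₀, x)) (by fun_prop) fun x _ => ⟨ht₀, mem_univ _⟩
  have hopen := isOpenPosMeasure_volMeasure (hfr t₀ ht₀)
  have hq0 : q t₀ x = 0 := by
    by_contra hne
    exact (hcont.integral_pos_of_hasCompactSupport_nonneg_nonzero
      (HasCompactSupport.of_compactSpace _) (hqnn t₀ ht₀) hne).ne' h2
  exact eq_zero_of_matInner_self _ _ (hr' x)
    ((div_eq_zero_iff.1 hq0).resolve_right (Real.sqrt_pos.2 (hr' x)).ne')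

end GeodesicEquation

/-! ### The time change of the explicit geodesics -/

section TimeChange

open Filter Topology

/-- The integrals `∫₀¹ σ²ᵏ / (1 + z σ²)ᵏ⁺¹ dσ`; for `k = 0` this is `arctan √z / √z`. -/
def arctanIntegral (k : ℕ) (z : ℝ) : ℝ :=
  ∫ σ in (0 : ℝ)..1, σ ^ (2 * k) / (1 + z * σ ^ 2) ^ (k + 1)

theorem one_add_mul_sq_pos {z σ : ℝ} (hz : -1 < z) (hσ : σ ∈ Icc (0 : ℝ) 1) :
    0 < 1 + z * σ ^ 2 := by
  have h1 : σ ^ 2 ≤ 1 := pow_le_one₀ hσ.1 hσ.2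
  rcases (sq_nonneg σ).eq_or_lt with h | h
  · rw [← h]
    norm_num
  · nlinarith [mul_pos (by linarith : 0 < 1 + z) h]

theorem hasDerivAt_arctanIntegral (k : ℕ) {z : ℝ} (hz : -1 < z) :
    HasDerivAt (arctanIntegral k) (-(k + 1) * arctanIntegral (k + 1) z) z := by
  have hpos : ∀ p ∈ Ioi (-1 : ℝ) ×ˢ Icc (0 : ℝ) 1, 1 + p.1 * p.2 ^ 2 ≠ 0 := fun p hp =>
    (one_add_mul_sq_pos hp.1 hp.2).ne'
  have h := hasDerivAt_intervalIntegral (a := 0) (b := 1) zero_le_one isOpen_Ioi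
    (f := fun z σ => σ ^ (2 * k) / (1 + z * σ ^ 2) ^ (k + 1))
    (f' := fun z σ => -(k + 1) * (σ ^ (2 * (k + 1)) / (1 + z * σ ^ 2) ^ (k + 1 + 1)))
    (by
      refine ContinuousOn.div (by fun_prop) (by fun_prop) fun p hp => pow_ne_zero _ (hpos p hp))
    (by
      refine ContinuousOn.mul (by fun_prop) ?_
      refine ContinuousOn.div (by fun_prop) (by fun_prop) fun p hp => pow_ne_zero _ (hpos p hp))
    (fun z hz σ hσ => by
      have hne : 1 + z * σ ^ 2 ≠ 0 := hpos (z, σ) ⟨hz, hσ⟩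
      have h1 : HasDerivAt (fun z => 1 + z * σ ^ 2) (σ ^ 2) z := by
        simpa using ((hasDerivAt_id z).mul_const (σ ^ 2)).const_add 1
      have h2 := (hasDerivAt_const z (σ ^ (2 * k))).div (h1.pow (k + 1)) (pow_ne_zero _ hne)
      refine h2.congr_deriv ?_
      simp only [Pi.pow_apply, Nat.add_sub_cancel]
      field_simp
      push_cast
      ring) (mem_Ioi.2 hz)
  rwa [intervalIntegral.integral_const_mul] at h

/-- The derivative of the `k`-th integral is a multiple of the `(k + 1)`-st, so the induction on the
order has to run over all `k` at once. The integral form makes `arctan √z / √z` smooth through `z =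
0`, the value taken at time zero. -/
theorem contDiffOn_arctanIntegral (N : ℕ) : ∀ k, ContDiffOn ℝ N (arctanIntegral k) (Ioi (-1)) := by
  induction N with
  | zero =>
    intro k
    exact contDiffOn_zero.2 fun z hz =>
      (hasDerivAt_arctanIntegral k hz).continuousAt.continuousWithinAt
  | succ N ih =>
    intro k
    rw [Nat.cast_add, Nat.cast_one, contDiffOn_succ_iff_deriv_of_isOpen isOpen_Ioi]
    refine ⟨fun z hz => (hasDerivAt_arctanIntegral k hz).differentiableAt.differentiableWithinAt,
      by simp, ?_⟩
    refine (contDiffOn_const.mul (ih (k + 1))).congr (f := fun z =>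
      (-((k : ℝ) + 1)) * arctanIntegral (k + 1) z) fun z hz => ?_
    exact (hasDerivAt_arctanIntegral k hz).deriv

theorem contDiffAt_arctanIntegral (k : ℕ) {z : ℝ} (hz : -1 < z) :
    ContDiffAt ℝ ∞ (arctanIntegral k) z :=
  contDiffAt_infty.2 fun N => (contDiffOn_arctanIntegral N k).contDiffAt (Ioi_mem_nhds hz)

/-- The integrand of the left side is the `σ`-derivative of `σ / (1 + z σ²)`. Because the derivative
of `arctanIntegral 0` is `-arctanIntegral 1`, this is a differential equation for `arctanIntegral
0`, used to differentiate `timeChange`. -/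
theorem arctanIntegral_ode {z : ℝ} (hz : -1 < z) :
    arctanIntegral 0 z - 2 * z * arctanIntegral 1 z = 1 / (1 + z) := by
  have hne : ∀ σ ∈ Icc (0 : ℝ) 1, 1 + z * σ ^ 2 ≠ 0 := fun σ hσ =>
    (one_add_mul_sq_pos hz hσ).ne'
  have hint : ∀ k : ℕ, IntervalIntegrable
      (fun σ : ℝ => σ ^ (2 * k) / (1 + z * σ ^ 2) ^ (k + 1)) volume 0 1 := fun k => by
    refine ContinuousOn.intervalIntegrable ?_
    rw [uIcc_of_le zero_le_one]
    exact ContinuousOn.div (by fun_prop) (by fun_prop) fun σ hσ => pow_ne_zero _ (hne σ hσ)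
  have h := intervalIntegral.integral_eq_sub_of_hasDerivAt (a := 0) (b := 1)
    (f := fun σ => σ / (1 + z * σ ^ 2))
    (f' := fun σ => σ ^ (2 * 0) / (1 + z * σ ^ 2) ^ (0 + 1) -
      2 * z * (σ ^ (2 * 1) / (1 + z * σ ^ 2) ^ (1 + 1)))
    (fun σ hσ => by
      rw [uIcc_of_le zero_le_one] at hσ
      have h1 : HasDerivAt (fun σ => 1 + z * σ ^ 2) (z * (2 * σ)) σ := by
        simpa using (((hasDerivAt_id σ).pow 2).const_mul z).const_add 1
      refine ((hasDerivAt_id σ).div h1 (hne σ hσ)).congr_deriv ?_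
      have := hne σ hσ
      simp only [id]
      field_simp
      ring) ((hint 0).sub ((hint 1).const_mul (2 * z)))
  rw [intervalIntegral.integral_sub (hint 0) ((hint 1).const_mul (2 * z)),
    intervalIntegral.integral_const_mul] at h
  simp only [arctanIntegral]
  rw [h]
  simp

/-- The domain of the time change `timeChange`. -/
def timeDomain : Set (ℝ × ℝ × ℝ) :=
  {p | 0 < 1 + p.2.1 * p.1 / 2 ∧
    -1 < (p.2.2 - p.2.1 ^ 2 / 4) * (p.1 / (1 + p.2.1 * p.1 / 2)) ^ 2}

/-- The volume factor `1 + τ t + κ t²` of the geodesics. -/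
def volFactor (p : ℝ × ℝ × ℝ) : ℝ := 1 + p.2.1 * p.1 + p.2.2 * p.1 ^ 2

/-- The time change `∫₀ᵗ dσ / (1 + τ σ + κ σ²)`. -/
def timeChange (p : ℝ × ℝ × ℝ) : ℝ :=
  p.1 / (1 + p.2.1 * p.1 / 2) *
    arctanIntegral 0 ((p.2.2 - p.2.1 ^ 2 / 4) * (p.1 / (1 + p.2.1 * p.1 / 2)) ^ 2)

/-- Completing the square: `1 + τ t + κ t² = (1 + τ t / 2)² + (κ - τ² / 4) t²`. The substitution `t
/ (1 + τ t / 2)` then reduces the time change to an arctangent. -/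
theorem volFactor_eq {p : ℝ × ℝ × ℝ} (hp : p ∈ timeDomain) :
    volFactor p = (1 + p.2.1 * p.1 / 2) ^ 2 *
      (1 + (p.2.2 - p.2.1 ^ 2 / 4) * (p.1 / (1 + p.2.1 * p.1 / 2)) ^ 2) := by
  have h := hp.1.ne'
  rw [volFactor]
  generalize hw : 1 + p.2.1 * p.1 / 2 = w at h
  have : p.2.1 * p.1 = 2 * (w - 1) := by rw [← hw]; ring
  field_simp
  linear_combination (p.2.1 * p.1 + 2 * w + 2) * this

theorem volFactor_pos {p : ℝ × ℝ × ℝ} (hp : p ∈ timeDomain) : 0 < volFactor p := by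
  rw [volFactor_eq hp]
  exact mul_pos (pow_pos hp.1 2) (by linarith [hp.2])

theorem contDiffAt_timeChange {p : ℝ × ℝ × ℝ} (hp : p ∈ timeDomain) :
    ContDiffAt ℝ ∞ timeChange p := by
  have h1 : ContDiffAt ℝ ∞ (fun p : ℝ × ℝ × ℝ => p.1 / (1 + p.2.1 * p.1 / 2)) p :=
    ContDiffAt.div (by fun_prop) (by fun_prop) hp.1.ne'
  have h2 : ContDiffAt ℝ ∞ (fun p : ℝ × ℝ × ℝ =>
      (p.2.2 - p.2.1 ^ 2 / 4) * (p.1 / (1 + p.2.1 * p.1 / 2)) ^ 2) p :=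
    ContDiffAt.mul (by fun_prop) (h1.pow 2)
  exact h1.mul (ContDiffAt.comp p (contDiffAt_arctanIntegral 0 hp.2) h2)

theorem zero_mem_timeDomain (q : ℝ × ℝ) : ((0 : ℝ), q) ∈ timeDomain := by
  simp [timeDomain]

theorem timeChange_zero (q : ℝ × ℝ) : timeChange (0, q) = 0 := by
  simp [timeChange]

theorem isOpen_timeDomain : IsOpen timeDomain := by
  rw [isOpen_iff_mem_nhds]
  intro p hp
  have c1 : ContinuousAt (fun p : ℝ × ℝ × ℝ => 1 + p.2.1 * p.1 / 2) p := by fun_prop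
  have c2 : ContinuousAt (fun p : ℝ × ℝ × ℝ =>
      (p.2.2 - p.2.1 ^ 2 / 4) * (p.1 / (1 + p.2.1 * p.1 / 2)) ^ 2) p :=
    ContinuousAt.mul (by fun_prop) ((ContinuousAt.div (by fun_prop) c1 hp.1.ne').pow 2)
  exact (c1.eventually (Ioi_mem_nhds hp.1)).and (c2.eventually (Ioi_mem_nhds hp.2))

theorem hasDerivAt_timeChange {t τ κ : ℝ} (hp : (t, τ, κ) ∈ timeDomain) :
    HasDerivAt (fun t => timeChange (t, τ, κ)) (volFactor (t, τ, κ))⁻¹ t := by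
  have hw := hp.1.ne'
  have hf := volFactor_eq hp
  have hfp := (volFactor_pos hp).ne'
  simp only at hw hf
  set w := 1 + τ * t / 2 with hwdef
  have h0 : HasDerivAt (fun t => 1 + τ * t / 2) (τ / 2) t := by
    simpa using (((hasDerivAt_id t).const_mul τ).div_const 2).const_add 1
  have h1 : HasDerivAt (fun t => t / (1 + τ * t / 2)) (1 / w ^ 2) t := by
    refine ((hasDerivAt_id t).div h0 hw).congr_deriv ?_
    simp only [id, ← hwdef]
    congr 1
    rw [hwdef]
    ring
  have h2 : HasDerivAt (fun t => (κ - τ ^ 2 / 4) * (t / (1 + τ * t / 2)) ^ 2)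
      ((κ - τ ^ 2 / 4) * (2 * (t / w) * (1 / w ^ 2))) t :=
    ((h1.pow 2).const_mul _).congr_deriv (by simp [← hwdef])
  have h3 := h1.mul ((hasDerivAt_arctanIntegral 0 hp.2).comp t h2)
  refine h3.congr_deriv ?_
  have h4 := arctanIntegral_ode hp.2
  have h5 : 1 + (κ - τ ^ 2 / 4) * (t / w) ^ 2 ≠ 0 := by
    intro h
    rw [h, mul_zero] at hf
    exact hfp hf
  simp only [Function.comp, ← hwdef] at h4 ⊢
  rw [hf, mul_inv]
  generalize arctanIntegral 0 ((κ - τ ^ 2 / 4) * (t / w) ^ 2) = A at h4 ⊢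
  generalize arctanIntegral 1 ((κ - τ ^ 2 / 4) * (t / w) ^ 2) = B at h4 ⊢
  simp only [Nat.cast_zero, zero_add]
  rw [← one_div (1 + _), ← h4]
  field_simp
  ring

end TimeChange

/-! ### Explicit solutions of the geodesic equation -/

section ExplicitGeodesics

open Filter Topology
open scoped Matrix.Norms.Operator

variable {m n : ℕ}

/-- The endomorphism `u (aᵀa)⁻¹ aᵀ` of `ℝⁿ`. It takes `a` to `u` and vanishes on the orthogonal
complement of the range of `a`; in particular `toEnd a a` is the orthogonal projection to that
range. -/
def toEnd (a u : Mat n m) : Mat n n := u * (aᵀ * a)⁻¹ * aᵀ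

theorem toEnd_mul (a u : Mat n m) {E : Mat m m} (hE : E.det ≠ 0) :
    toEnd (a * E) (u * E) = toEnd a u := mul_gram_inv_mul a u a hE

theorem toEnd_self_transpose (a : Mat n m) : (toEnd a a)ᵀ = toEnd a a := by
  rw [toEnd, Matrix.transpose_mul, Matrix.transpose_mul, gram_isSymm, Matrix.transpose_transpose,
    Matrix.mul_assoc]

theorem toEnd_mul_self {a : Mat n m} (ha : 0 < (aᵀ * a).det) (u : Mat n m) :
    toEnd a u * a = u := by
  rw [toEnd, Matrix.mul_assoc, Matrix.mul_assoc, Matrix.nonsing_inv_mul _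
    (isUnit_iff_ne_zero.2 ha.ne'), Matrix.mul_one]

theorem toEnd_mul_toEnd (a u v : Mat n m) :
    toEnd a u * toEnd a v = toEnd a (toEnd a u * v) := by
  simp only [toEnd, Matrix.mul_assoc]

theorem trace_toEnd_self {a : Mat n m} (ha : 0 < (aᵀ * a).det) : (toEnd a a).trace = m := by
  rw [toEnd, Matrix.mul_assoc, Matrix.trace_mul_comm, Matrix.mul_assoc, Matrix.nonsing_inv_mul _
    (isUnit_iff_ne_zero.2 ha.ne'), Matrix.trace_one, Fintype.card_fin]

theorem contDiffAt_toEnd {N : WithTop ℕ∞} {F : Type*} [NormedAddCommGroup F] [NormedSpace ℝ F]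
    {a u : F → Mat n m} {z : F} (ha : ContDiffAt ℝ N a z) (hu : ContDiffAt ℝ N u z)
    (hp : 0 < ((a z)ᵀ * a z).det) : ContDiffAt ℝ N (fun z => toEnd (a z) (u z)) z :=
  (hu.matrix_mul ((ha.matrix_transpose.matrix_mul ha).matrix_inv hp.ne')).matrix_mul
    ha.matrix_transpose

/-- An invertible matrix that preserves the range of `a` changes `a` by a change of basis. -/
theorem exists_mul_eq_mul {a : Mat n m} (ha : 0 < (aᵀ * a).det) {B B' : Mat n n} (hB : B * B' = 1)
    (hc : B * toEnd a a = toEnd a a * B) : ∃ E : Mat m m, E.det ≠ 0 ∧ B * a = a * E := by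
  have h1 : (aᵀ * a)⁻¹ * (aᵀ * a) = 1 := Matrix.nonsing_inv_mul _ (isUnit_iff_ne_zero.2 ha.ne')
  have h2 := toEnd_mul_self ha a
  refine ⟨(aᵀ * a)⁻¹ * aᵀ * B * a, ?_, ?_⟩
  · have h3 : ((aᵀ * a)⁻¹ * aᵀ * B * a) * ((aᵀ * a)⁻¹ * aᵀ * B' * a) = 1 := by
      calc _ = (aᵀ * a)⁻¹ * aᵀ * (B * toEnd a a) * B' * a := by
            simp only [toEnd, Matrix.mul_assoc]
        _ = ((aᵀ * a)⁻¹ * (aᵀ * a)) * (aᵀ * a)⁻¹ * aᵀ * (B * B') * a := by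
            rw [hc]
            simp only [toEnd, Matrix.mul_assoc]
        _ = 1 := by
            rw [h1, hB, Matrix.one_mul, Matrix.mul_one, Matrix.mul_assoc, h1]
    intro h0
    have := congrArg Matrix.det h3
    rw [Matrix.det_mul, h0, zero_mul, Matrix.det_one] at this
    exact zero_ne_one this
  · calc B * a = B * toEnd a a * a := by rw [Matrix.mul_assoc, h2]
      _ = _ := by
        rw [hc]
        simp only [toEnd, Matrix.mul_assoc]

/-- Velocities are written as `X a` with an endomorphism `X` of `ℝⁿ`, so that the position enters
the right-hand side only through the projection to its range, which is constant along the explicit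
geodesics. -/
theorem geodF_mul_left {a : Mat n m} (X : Mat n n) :
    geodF a (X * a) = (X * toEnd a a * Xᵀ + X * toEnd a a * X - (X * toEnd a a).trace • X
      - toEnd a a * Xᵀ * X + ((1 / 2 : ℝ) * (X * toEnd a a * Xᵀ).trace) • 1) * a := by
  simp only [geodF, toEnd, Matrix.transpose_mul, Matrix.add_mul, Matrix.sub_mul, Matrix.smul_mul,
    Matrix.one_mul, Matrix.mul_assoc]

/-- The geodesic equation for `X a`, where `X = p Π + q W` with the orthogonal projection `Π` to
the range of `a` and `W` a trace free endomorphism of that range. -/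
theorem geodF_eq {a : Mat n m} {P W : Mat n n} (hP : toEnd a a = P) (hPa : P * a = a)
    (hPt : Pᵀ = P) (hPP : P * P = P) (htr : P.trace = m) (hPW : P * W = W) (hWP : W * P = W)
    (hW : W.trace = 0) (p q : ℝ) :
    geodF a ((p • P + q • W) * a) = (p ^ 2 - p ^ 2 * m + (1 / 2) * (p ^ 2 * m +
      q ^ 2 * (W * Wᵀ).trace)) • a + (2 * p * q - p * m * q) • (W * a) +
      q ^ 2 • ((W * W + W * Wᵀ - Wᵀ * W) * a) := by
  have hPWt : P * Wᵀ = Wᵀ := by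
    have := congrArg Matrix.transpose hWP
    rwa [Matrix.transpose_mul, hPt] at this
  have hWtP : Wᵀ * P = Wᵀ := by
    have := congrArg Matrix.transpose hPW
    rwa [Matrix.transpose_mul, hPt] at this
  rw [geodF_mul_left, hP]
  simp only [Matrix.transpose_add, Matrix.transpose_smul, hPt, Matrix.add_mul, Matrix.mul_add,
    Matrix.sub_mul, Matrix.smul_mul, Matrix.mul_smul, hPP, hPW, hWP, hPWt, hWtP, hPa, smul_add,
    Matrix.trace_add, Matrix.trace_smul, hW, Matrix.trace_transpose, htr, smul_smul, Matrix.one_mul,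
    smul_eq_mul, Matrix.mul_assoc]
  module

/-- The parameters `(t, τ, κ)` of the time change. -/
def geodParam (t : ℝ) (a u : Mat n m) : ℝ × ℝ × ℝ :=
  (t, (toEnd a u).trace, m * (toEnd a u * (toEnd a u)ᵀ).trace / 4)

/-- The skew part of the initial velocity, as an endomorphism. -/
def geodSkew (a u : Mat n m) : Mat n n := toEnd a u - (toEnd a u)ᵀ

/-- The trace free part of the transposed initial velocity, as an endomorphism. -/
def geodTraceFree (a u : Mat n m) : Mat n n :=
  (toEnd a u)ᵀ - ((toEnd a u).trace / m) • toEnd a a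

/-- The geodesic with initial point `a` and initial velocity `u`, if the range of `u` is contained
in the range of `a`. -/
def geodSol (t : ℝ) (a u : Mat n m) : Mat n m :=
  volFactor (geodParam t a u) ^ (1 / (m : ℝ)) •
    (NormedSpace.exp (timeChange (geodParam t a u) • geodSkew a u) *
      NormedSpace.exp (timeChange (geodParam t a u) • geodTraceFree a u) * a)

theorem geodParam_mul (t : ℝ) (a u : Mat n m) {E : Mat m m} (hE : E.det ≠ 0) :
    geodParam t (a * E) (u * E) = geodParam t a u := by
  simp only [geodParam, toEnd_mul a u hE]

theorem geodSol_mul (t : ℝ) (a u : Mat n m) {E : Mat m m} (hE : E.det ≠ 0) :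
    geodSol t (a * E) (u * E) = geodSol t a u * E := by
  simp only [geodSol, geodParam_mul t a u hE, geodSkew, geodTraceFree, toEnd_mul a u hE,
    toEnd_mul a a hE, Matrix.smul_mul, Matrix.mul_assoc]

theorem geodSol_zero (a u : Mat n m) : geodSol 0 a u = a := by
  simp [geodSol, geodParam, timeChange_zero, volFactor]

theorem contDiffAt_exp_matrix (A : Mat n n) :
    ContDiffAt ℝ ∞ (NormedSpace.exp : Mat n n → Mat n n) A :=
  (NormedSpace.exp_analytic (𝕂 := ℝ) A).contDiffAt

theorem contDiffAt_geodParam {p : ℝ × Mat n m × Mat n m} (ha : 0 < (p.2.1ᵀ * p.2.1).det) :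
    ContDiffAt ℝ ∞ (fun p : ℝ × Mat n m × Mat n m => geodParam p.1 p.2.1 p.2.2) p := by
  have hX : ContDiffAt ℝ ∞ (fun p : ℝ × Mat n m × Mat n m => toEnd p.2.1 p.2.2) p :=
    contDiffAt_toEnd (by fun_prop) (by fun_prop) ha
  exact contDiffAt_fst.prodMk (hX.matrix_trace.prodMk
    ((contDiffAt_const.mul (hX.matrix_mul hX.matrix_transpose).matrix_trace).div_const 4))

theorem contDiffAt_geodSol {p : ℝ × Mat n m × Mat n m} (ha : 0 < (p.2.1ᵀ * p.2.1).det)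
    (hp : geodParam p.1 p.2.1 p.2.2 ∈ timeDomain) :
    ContDiffAt ℝ ∞ (fun p : ℝ × Mat n m × Mat n m => geodSol p.1 p.2.1 p.2.2) p := by
  have hX : ContDiffAt ℝ ∞ (fun p : ℝ × Mat n m × Mat n m => toEnd p.2.1 p.2.2) p :=
    contDiffAt_toEnd (by fun_prop) (by fun_prop) ha
  have hP : ContDiffAt ℝ ∞ (fun p : ℝ × Mat n m × Mat n m => toEnd p.2.1 p.2.1) p :=
    contDiffAt_toEnd (by fun_prop) (by fun_prop) ha
  have hq := contDiffAt_geodParam ha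
  have hs := ContDiffAt.comp p (contDiffAt_timeChange hp) hq
  have hv : ContDiffAt ℝ ∞ volFactor (geodParam p.1 p.2.1 p.2.2) := by
    unfold volFactor
    fun_prop
  have hf := (ContDiffAt.comp p hv hq).rpow_const_of_ne (p := 1 / (m : ℝ)) (volFactor_pos hp).ne'
  have h1 := ContDiffAt.comp p (contDiffAt_exp_matrix _) (hs.smul (hX.sub hX.matrix_transpose))
  have h2 := ContDiffAt.comp p (contDiffAt_exp_matrix _)
    (hs.smul (hX.matrix_transpose.sub ((hX.matrix_trace.div_const (m : ℝ)).smul hP)))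
  have ha' : ContDiffAt ℝ ∞ (fun p : ℝ × Mat n m × Mat n m => p.2.1) p := by fun_prop
  exact hf.smul ((h1.matrix_mul h2).matrix_mul ha')

theorem exp_smul_commute {A P : Mat n n} (h : A * P = P * A) (s : ℝ) :
    NormedSpace.exp (s • A) * P = P * NormedSpace.exp (s • A) := by
  have h1 : Commute P (s • A) := (Commute.smul_right h.symm s)
  exact h1.exp_right.eq.symm

theorem exp_mul_exp_neg (A : Mat n n) : NormedSpace.exp A * NormedSpace.exp (-A) = 1 := by
  rw [Matrix.exp_neg]
  exact Matrix.mul_nonsing_inv _ ((Matrix.isUnit_iff_isUnit_det _).1 (Matrix.isUnit_exp A))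

/-- The hypothesis `hu` says that the columns of `u` lie in the range of `a`. Hence `toEnd a u` and
its transpose both act within that range and are fixed by its projection on either side. -/
theorem toEnd_relations {a u : Mat n m} (ha : 0 < (aᵀ * a).det) (hu : toEnd a a * u = u) :
    toEnd a a * toEnd a a = toEnd a a ∧ toEnd a a * toEnd a u = toEnd a u ∧
    toEnd a u * toEnd a a = toEnd a u ∧ toEnd a a * (toEnd a u)ᵀ = (toEnd a u)ᵀ ∧
    (toEnd a u)ᵀ * toEnd a a = (toEnd a u)ᵀ := by
  have h1 : toEnd a a * toEnd a u = toEnd a u := by rw [toEnd_mul_toEnd, hu]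
  have h2 : toEnd a u * toEnd a a = toEnd a u := by rw [toEnd_mul_toEnd, toEnd_mul_self ha]
  refine ⟨by rw [toEnd_mul_toEnd, toEnd_mul_self ha], h1, h2, ?_, ?_⟩
  · have := congrArg Matrix.transpose h2
    rwa [Matrix.transpose_mul, toEnd_self_transpose] at this
  · have := congrArg Matrix.transpose h1
    rwa [Matrix.transpose_mul, toEnd_self_transpose] at this

/-- Both exponentials are invertible and commute with the projection to the range of `a`. Thus the
solution has full rank and its image plane does not move. -/
theorem exists_geodSol_eq_mul {a u : Mat n m} (ha : 0 < (aᵀ * a).det) (hu : toEnd a a * u = u)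
    {t : ℝ} (ht : geodParam t a u ∈ timeDomain) :
    ∃ E : Mat m m, E.det ≠ 0 ∧ geodSol t a u = a * E := by
  obtain ⟨h0, h1, h2, h3, h4⟩ := toEnd_relations ha hu
  set s := timeChange (geodParam t a u)
  set R := NormedSpace.exp (s • geodSkew a u) with hR
  set Q := NormedSpace.exp (s • geodTraceFree a u) with hQ
  set R' := NormedSpace.exp (-(s • geodSkew a u)) with hR'
  set Q' := NormedSpace.exp (-(s • geodTraceFree a u)) with hQ'
  have hRR : R * R' = 1 := exp_mul_exp_neg _
  have hQQ : Q * Q' = 1 := exp_mul_exp_neg _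
  have hRP : R * toEnd a a = toEnd a a * R := exp_smul_commute (by
    simp only [geodSkew, Matrix.sub_mul, Matrix.mul_sub, h1, h2, h3, h4]) s
  have hQP : Q * toEnd a a = toEnd a a * Q := exp_smul_commute (by
    simp only [geodTraceFree, Matrix.sub_mul, Matrix.mul_sub, Matrix.smul_mul, Matrix.mul_smul,
      h0, h3, h4]) s
  obtain ⟨E, hE, hEa⟩ := exists_mul_eq_mul (B := R * Q) (B' := Q' * R') ha
    (by rw [Matrix.mul_assoc, ← Matrix.mul_assoc Q, hQQ, Matrix.one_mul, hRR])
    (by rw [Matrix.mul_assoc, hQP, ← Matrix.mul_assoc, hRP, Matrix.mul_assoc])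
  have hf := volFactor_pos ht
  have hφ : volFactor (geodParam t a u) ^ (1 / (m : ℝ)) ≠ 0 := (Real.rpow_pos_of_pos hf _).ne'
  refine ⟨volFactor (geodParam t a u) ^ (1 / (m : ℝ)) • E, ?_, ?_⟩
  · rw [Matrix.det_smul]
    exact mul_ne_zero (pow_ne_zero _ hφ) hE
  · rw [geodSol, hEa, Matrix.mul_smul]

/-- `geodSol` solves the geodesic equation. -/
theorem exists_velocity_geodSol {a u : Mat n m} (ha : 0 < (aᵀ * a).det)
    (hu : toEnd a a * u = u) :
    ∃ V : ℝ → Mat n m, V 0 = u ∧ ∀ t, geodParam t a u ∈ timeDomain →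
      HasDerivAt (fun t => geodSol t a u) (V t) t ∧
      HasDerivAt V (geodF (geodSol t a u) (V t)) t := by
  -- For `m = 0` the exponent `1 / m` is meaningless, but all matrices involved are equal.
  rcases Nat.eq_zero_or_pos m with rfl | hm
  · have h0 : ∀ f : ℝ → Mat n 0, f = fun _ => 0 := fun f => funext fun _ => Subsingleton.elim _ _
    refine ⟨fun _ => u, rfl, fun t _ => ⟨?_, ?_⟩⟩
    · rw [h0 fun t => geodSol t a u, Subsingleton.elim u 0]
      exact hasDerivAt_const _ _
    · exact (hasDerivAt_const t u).congr_deriv (Subsingleton.elim _ _)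
  have hm' : (m : ℝ) ≠ 0 := Nat.cast_ne_zero.2 hm.ne'
  obtain ⟨h0, h1, h2, h3, h4⟩ := toEnd_relations ha hu
  have hPa := toEnd_mul_self ha a
  have hPt := toEnd_self_transpose a
  have htr := trace_toEnd_self ha
  have hXa := toEnd_mul_self ha u
  set X := toEnd a u with hX
  set P := toEnd a a with hP
  set τ := X.trace with hτ
  set δ := (X * Xᵀ).trace with hδ
  set κ := m * δ / 4 with hκ
  set f : ℝ → ℝ := fun t => volFactor (t, τ, κ) with hf
  set s : ℝ → ℝ := fun t => timeChange (t, τ, κ) with hs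
  set Ω := X - Xᵀ with hΩ
  set Y := Xᵀ - (τ / m) • P with hY
  set X₀ := X - (τ / m) • P with hX₀
  set R : ℝ → Mat n n := fun t => NormedSpace.exp (s t • Ω) with hR
  set Q : ℝ → Mat n n := fun t => NormedSpace.exp (s t • Y) with hQ
  set c : ℝ → Mat n m := fun t => f t ^ (1 / (m : ℝ)) • (R t * Q t * a) with hc
  have hcsol : ∀ t, geodSol t a u = c t := fun t => rfl
  -- The velocity will be `(p P + q W) c`: `p` is the logarithmic derivative of `f^(1/m)`, `q = 1 /
  -- f` is the derivative of the time change, and `W` is the trace-free part of the initial velocity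
  -- rotated by `R`.
  set W : ℝ → Mat n n := fun t => R t * X₀ * (R t)ᵀ with hW
  set p : ℝ → ℝ := fun t => (τ + 2 * κ * t) / (m * f t) with hp
  set q : ℝ → ℝ := fun t => (f t)⁻¹ with hq
  have hΩt : Ωᵀ = -Ω := by rw [hΩ, Matrix.transpose_sub, Matrix.transpose_transpose, neg_sub]
  have hRt : ∀ t, (R t)ᵀ = NormedSpace.exp (-(s t • Ω)) := fun t => by
    rw [hR, ← Matrix.exp_transpose, Matrix.transpose_smul, hΩt, smul_neg]
  have hRR : ∀ t, R t * (R t)ᵀ = 1 := fun t => by rw [hRt]; exact exp_mul_exp_neg _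
  have hRR' : ∀ t, (R t)ᵀ * R t = 1 := fun t => mul_eq_one_comm.1 (hRR t)
  have hRΩ : ∀ t, R t * Ω = Ω * R t := fun t => exp_smul_commute rfl (s t)
  have hRP : ∀ t, R t * P = P * R t := fun t => exp_smul_commute (by
    simp only [hΩ, Matrix.sub_mul, Matrix.mul_sub, h1, h2, h3, h4]) (s t)
  have hRtP : ∀ t, (R t)ᵀ * P = P * (R t)ᵀ := fun t => by
    have := congrArg Matrix.transpose (hRP t)
    rw [Matrix.transpose_mul, Matrix.transpose_mul, hPt] at this
    exact this.symm
  have hX₀P : X₀ * P = X₀ := by simp only [hX₀, Matrix.sub_mul, Matrix.smul_mul, h2, h0]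
  have hPX₀ : P * X₀ = X₀ := by simp only [hX₀, Matrix.mul_sub, Matrix.mul_smul, h1, h0]
  have hPW : ∀ t, P * W t = W t := fun t => by
    simp only [hW]
    rw [← Matrix.mul_assoc, ← Matrix.mul_assoc, ← hRP, Matrix.mul_assoc (R t), hPX₀]
  have hWP : ∀ t, W t * P = W t := fun t => by
    simp only [hW]
    rw [Matrix.mul_assoc, hRtP, ← Matrix.mul_assoc, Matrix.mul_assoc (R t), hX₀P]
  have hWtr : ∀ t, (W t).trace = 0 := fun t => by
    simp only [hW]
    rw [Matrix.mul_assoc, Matrix.trace_mul_comm, Matrix.mul_assoc, hRR', Matrix.mul_one, hX₀,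
      Matrix.trace_sub, Matrix.trace_smul, htr, ← hτ, smul_eq_mul]
    field_simp
    ring
  have hWt : ∀ t, (W t)ᵀ = R t * X₀ᵀ * (R t)ᵀ := fun t => by
    simp only [hW, Matrix.transpose_mul, Matrix.transpose_transpose, Matrix.mul_assoc]
  have hWW : ∀ t, (W t * (W t)ᵀ).trace = δ - τ ^ 2 / m := fun t => by
    have e1 : W t * (W t)ᵀ = R t * (X₀ * X₀ᵀ) * (R t)ᵀ := by
      rw [hWt]
      simp only [hW]
      calc _ = R t * X₀ * ((R t)ᵀ * R t) * X₀ᵀ * (R t)ᵀ := by simp only [Matrix.mul_assoc]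
        _ = _ := by rw [hRR', Matrix.mul_one]; simp only [Matrix.mul_assoc]
    have e2 : Xᵀ.trace = τ := Matrix.trace_transpose X
    rw [e1, Matrix.trace_mul_comm, ← Matrix.mul_assoc, hRR', Matrix.one_mul, hX₀]
    simp only [Matrix.transpose_sub, Matrix.transpose_smul, hPt, Matrix.sub_mul, Matrix.mul_sub,
      Matrix.smul_mul, Matrix.mul_smul, h2, h3, h0, Matrix.trace_sub, Matrix.trace_smul, e2, htr,
      ← hτ, ← hδ, smul_eq_mul]
    field_simp
    ring
  -- The rotation `R` is generated by `Ω` and commutes with it, so the skew part of `W` is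
  -- conserved.
  have hWΩ : ∀ t, W t - (W t)ᵀ = Ω := fun t => by
    rw [hWt]
    simp only [hW]
    rw [← Matrix.sub_mul, ← Matrix.mul_sub]
    have : X₀ - X₀ᵀ = Ω := by
      simp only [hX₀, hΩ, Matrix.transpose_sub, Matrix.transpose_smul, hPt]
      abel
    rw [this, hRΩ, Matrix.mul_assoc, hRR, Matrix.mul_one]
  -- This is why two exponentials appear: the derivative of `R Q` is `q (Ω + R Y Rᵀ) R Q`, and `Ω +
  -- Y = X₀`.
  have hWY : ∀ t, Ω + R t * Y * (R t)ᵀ = W t := fun t => by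
    have e1 : Ω = R t * Ω * (R t)ᵀ := by rw [hRΩ, Matrix.mul_assoc, hRR, Matrix.mul_one]
    have e2 : Ω + Y = X₀ := by simp only [hΩ, hY, hX₀]; abel
    calc Ω + R t * Y * (R t)ᵀ = R t * Ω * (R t)ᵀ + R t * Y * (R t)ᵀ := by rw [← e1]
      _ = _ := by rw [← Matrix.add_mul, ← Matrix.mul_add, e2]
  have hd : ∀ t, geodParam t a u ∈ timeDomain → 0 < f t ∧
      HasDerivAt R (q t • (Ω * R t)) t ∧ HasDerivAt Q (q t • (Y * Q t)) t ∧
      HasDerivAt f (τ + 2 * κ * t) t := by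
    intro t ht
    have hs' : HasDerivAt s (q t) t := hasDerivAt_timeChange ht
    refine ⟨volFactor_pos ht, ?_, ?_, ?_⟩
    · exact (hasDerivAt_exp_smul_const' Ω (s t)).scomp t hs'
    · exact (hasDerivAt_exp_smul_const' Y (s t)).scomp t hs'
    · exact ((((hasDerivAt_id t).const_mul τ).const_add 1).add
        (((hasDerivAt_id t).pow 2).const_mul κ)).congr_deriv (by simp; ring)
  have hPc : ∀ t, P * c t = c t := by
    intro t
    have hQP : Q t * P = P * Q t := exp_smul_commute (by
      simp only [hY, Matrix.sub_mul, Matrix.mul_sub, Matrix.smul_mul, Matrix.mul_smul,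
        h0, h3, h4]) (s t)
    simp only [hc, Matrix.mul_smul]
    rw [← Matrix.mul_assoc, ← Matrix.mul_assoc, ← hRP, Matrix.mul_assoc (R t), ← hQP]
    simp only [Matrix.mul_assoc, hPa]
  have hcd : ∀ t, geodParam t a u ∈ timeDomain →
      HasDerivAt c ((p t • P + q t • W t : Mat n n) * c t) t := by
    intro t ht
    obtain ⟨hft, hRd, hQd, hfd⟩ := hd t ht
    have e1 := hfd.rpow_const (p := 1 / (m : ℝ)) (Or.inl hft.ne')
    have e3 : f t ^ (1 / (m : ℝ) - 1) = f t ^ (1 / (m : ℝ)) / f t := Real.rpow_sub_one hft.ne' _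
    have e4 : Ω * R t * Q t + R t * Y * Q t = W t * R t * Q t := by
      rw [← hWY t, Matrix.add_mul, Matrix.add_mul, Matrix.mul_assoc (R t * Y), hRR',
        Matrix.mul_one]
    have e5 : (p t • P + q t • W t : Mat n n) * c t = p t • c t + q t • (W t * c t) := by
      rw [Matrix.add_mul, Matrix.smul_mul, Matrix.smul_mul, hPc]
    have e2 : HasDerivAt (fun t => R t * Q t * a) (q t • (W t * R t * Q t * a)) t := by
      refine ((hRd.matrix_mul hQd).matrix_mul (hasDerivAt_const t a)).congr_deriv ?_
      rw [← e4]
      simp only [Matrix.mul_zero, add_zero, Matrix.smul_mul, Matrix.mul_smul, Matrix.add_mul,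
        smul_add, Matrix.mul_assoc]
    refine (e1.smul e2).congr_deriv ?_
    rw [e5, e3]
    simp only [hc, Matrix.mul_smul, smul_smul, ← Matrix.mul_assoc]
    rw [add_comm]
    congr 1
    · congr 1
      simp only [hp]
      field_simp
    · rw [mul_comm]
  -- `W' = q (Ω W - W Ω)`, and substituting `Ω = W - Wᵀ` yields the commutator that the geodesic
  -- equation asks for.
  have hWd : ∀ t, geodParam t a u ∈ timeDomain →
      HasDerivAt W (q t • (W t * (W t)ᵀ - (W t)ᵀ * W t)) t := by
    intro t ht
    obtain ⟨hft, hRd, hQd, hfd⟩ := hd t ht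
    have e1 := (hRd.matrix_mul (hasDerivAt_const t X₀)).matrix_mul hRd.matrix_transpose
    refine e1.congr_deriv ?_
    have e2 : W t * (W t)ᵀ - (W t)ᵀ * W t = Ω * W t - W t * Ω := by
      rw [← hWΩ t, Matrix.sub_mul, Matrix.mul_sub]
      abel
    rw [e2]
    simp only [hW, Matrix.transpose_smul, Matrix.transpose_mul, hΩt, Matrix.mul_zero, add_zero,
      Matrix.smul_mul, Matrix.mul_smul, Matrix.mul_neg, Matrix.mul_assoc, smul_sub, smul_neg]
    abel
  have hW0 : W 0 = X₀ := by
    simp [hW, hR, hs, timeChange_zero]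
  refine ⟨fun t => (p t • P + q t • W t : Mat n n) * c t, ?_, fun t ht => ⟨hcd t ht, ?_⟩⟩
  · have hf0 : f 0 = 1 := by simp [hf, volFactor]
    have hc0 : c 0 = a := by rw [← hcsol, geodSol_zero]
    simp only [hp, hq, hf0, hW0, hc0, mul_zero, add_zero, mul_one, inv_one, one_smul, hX₀,
      add_sub_cancel]
    exact hXa
  · obtain ⟨hft, hRd, hQd, hfd⟩ := hd t ht
    obtain ⟨E, hE, hEa⟩ := exists_geodSol_eq_mul ha hu ht
    rw [hcsol] at hEa
    have hPt' : toEnd (c t) (c t) = P := by rw [hEa, toEnd_mul _ _ hE]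
    rw [hcsol, geodF_eq hPt' (hPc t) hPt h0 htr (hPW t) (hWP t) (hWtr t), hWW t]
    have hfd2 : HasDerivAt (fun t => τ + 2 * κ * t) (2 * κ) t := by
      simpa using ((hasDerivAt_id t).const_mul (2 * κ)).const_add τ
    have hpd := hfd2.div (hfd.const_mul (m : ℝ)) (mul_ne_zero hm' hft.ne')
    have hqd := hfd.inv hft.ne'
    have hXd : HasDerivAt (fun t => (p t • P + q t • W t : Mat n n))
        (((2 * κ * (m * f t) - (τ + 2 * κ * t) * (m * (τ + 2 * κ * t))) / (m * f t) ^ 2) • P +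
          (q t • q t • (W t * (W t)ᵀ - (W t)ᵀ * W t) + (-(τ + 2 * κ * t) / f t ^ 2) • W t)) t :=
      (hpd.smul_const P).add (hqd.smul (hWd t ht))
    refine (hXd.matrix_mul (hcd t ht)).congr_deriv ?_
    have hfe : f t = 1 + τ * t + κ * t ^ 2 := rfl
    have hδκ : δ = 4 * κ / m := by rw [hκ]; field_simp
    have hPWc : P * (W t * c t) = W t * c t := by rw [← Matrix.mul_assoc, hPW]
    simp only [Matrix.add_mul, Matrix.smul_mul, Matrix.mul_smul, Matrix.mul_add, Matrix.sub_mul,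
      smul_add, smul_smul, hPc, hPWc, Matrix.mul_assoc, smul_sub]
    have hfne := hft.ne'
    generalize W t * (W t * c t) = v₁
    generalize W t * ((W t)ᵀ * c t) = v₂
    generalize (W t)ᵀ * (W t * c t) = v₃
    generalize W t * c t = v₄
    generalize c t = v₅
    -- The coefficient of `c` is the equation `4 κ f = f'² + m δ - τ²`, which for `f = 1 + τ t + κ
    -- t²` holds exactly when `κ = m δ / 4`. The coefficient of `W c` is `q' = -m p q`, true for `q
    -- = 1 / f`.
    match_scalars
    · simp only [hp, hq, mul_one, hδκ]
      field_simp
      rw [hfe]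
      ring
    all_goals
      simp only [hp, hq]
      field_simp
    ring

end ExplicitGeodesics

/-! ### A criterion for totally geodesic sets -/

section TotallyGeodesic

open Filter Topology
open scoped Matrix.Norms.Operator

variable {m n : ℕ} {H : Type*} [TopologicalSpace H] {I : ModelWithCorners ℝ (Euc m) H}
  {M : Type*} [TopologicalSpace M] [ChartedSpace H M] [IsManifold I ∞ M]

theorem SmoothFamilyAt.congr_of_forall {Z : Type*} [NormedAddCommGroup Z] [NormedSpace ℝ Z]
    {A B : Z → M → Mat n m} {S : Set Z} (hS : IsOpen S) {z : Z} (hz : z ∈ S) {x : M}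
    (hA : SmoothFamilyAt I A z x) (h : ∀ z ∈ S, ∀ x, B z x = A z x) : SmoothFamilyAt I B z x := by
  refine ContMDiffAt.congr_of_eventuallyEq hA ?_
  have h5 : ∀ᶠ p : Z × M in 𝓝 (z, x), p.1 ∈ S := continuousAt_fst.eventually (hS.mem_nhds hz)
  filter_upwards [h5] with p hp
  simp only [h p.1 hp p.2]

/-- The preimages of `U` under smooth families of one-forms are open. -/
def SmoothlyOpen (U : Set (OneForm I M n)) : Prop :=
  ∀ {Z : Type} [NormedAddCommGroup Z] [NormedSpace ℝ Z] {S : Set Z} {Γ : Z → OneForm I M n},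
    IsOpen S → (∀ z ∈ S, ∀ x, SmoothFamilyAt I (fun z x => mat I (Γ z) x) z x) →
    IsOpen {z | z ∈ S ∧ Γ z ∈ U}

theorem smoothlyOpen_fullRank [CompactSpace M] :
    SmoothlyOpen (I := I) (fullRank I : Set (OneForm I M n)) := by
  intro Z _ _ S Γ hS hΓ
  simp only [mem_fullRank_iff]
  exact isOpen_setOf_fullRank hS hΓ

theorem SmoothlyOpen.isOpenSet {U : Set (OneForm I M n)} (hU : SmoothlyOpen U) :
    IsOpenSet I U := by
  intro c hc
  have h := hU (Γ := c) isOpen_univ ((smoothCurveOn_iff isOpen_univ).1 hc)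
  simpa using! h

theorem velMat_eq_of_hasVelocityAt {c : ℝ → OneForm I M n} {ζ : OneForm I M n} {t : ℝ}
    (h : HasVelocityAt I c ζ t) (x : M) : velMat c t x = mat I ζ x :=
  (hasVelocityAt_iff.1 h x).deriv

/-- The velocities of a smooth curve form a smooth curve. -/
theorem exists_velocity_curve {J : Set ℝ} (hJ : IsOpen J) {c : ℝ → OneForm I M n}
    (hc : SmoothCurveOn I J c) : ∃ ζ : ℝ → OneForm I M n, SmoothCurveOn I J ζ ∧
      ∀ t ∈ J, HasVelocityAt I c (ζ t) t := by
  have hV := smoothFamilyAt_velMat hJ hc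
  have hex : ∀ t, ∃ ζ : OneForm I M n, t ∈ J → ∀ x, mat I ζ x = velMat c t x := by
    intro t
    by_cases ht : t ∈ J
    · obtain ⟨ζ, hζ⟩ := exists_mat_eq (hV t ht)
      exact ⟨ζ, fun _ => hζ⟩
    · exact ⟨0, fun h => absurd h ht⟩
  choose ζ hζ using hex
  refine ⟨ζ, (smoothCurveOn_iff hJ).2 fun t ht x => (hV t ht x).congr_of_forall hJ ht hζ,
    fun t ht => hasVelocityAt_iff.2 fun x => ?_⟩
  rw [hζ t ht]
  exact hasDerivAt_mat hJ hc ht x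

/-- The explicit geodesics, for tangent vectors `ζ` at `α` with values in the image planes
of `α`. -/
theorem exists_explicit_geodesic [CompactSpace M] {α ζ : OneForm I M n} (hα : α ∈ fullRank I)
    (hζ : ∀ x, toEnd (mat I α x) (mat I α x) * mat I ζ x = mat I ζ x) :
    ∃ ε > 0, ∃ c : ℝ → OneForm I M n, SmoothCurveOn I (Ioo (-ε) ε) c ∧
      (∀ t ∈ Ioo (-ε) ε, c t ∈ fullRank I) ∧
      (∀ t ∈ Ioo (-ε) ε, ∀ x, geodParam t (mat I α x) (mat I ζ x) ∈ timeDomain ∧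
        mat I (c t) x = geodSol t (mat I α x) (mat I ζ x)) ∧
      c 0 = α ∧ HasVelocityAt I c ζ 0 ∧ ∀ t ∈ Ioo (-ε) ε, ∀ x, geodDefect c t x = 0 := by
  have hα' := (mem_fullRank_iff α).1 hα
  have hsα : ∀ (t : ℝ) (x : M), SmoothFamilyAt I (fun (_ : ℝ) x => mat I α x) t x :=
    smoothFamilyAt_const α
  have hsζ : ∀ (t : ℝ) (x : M), SmoothFamilyAt I (fun (_ : ℝ) x => mat I ζ x) t x :=
    smoothFamilyAt_const ζ
  -- The domain of the time change is open and contains time zero for all initial data; the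
  -- parameters depend continuously on `x`, so compactness of `M` gives one time interval for all
  -- points.
  have hev : ∀ᶠ t in 𝓝 (0 : ℝ), ∀ x ∈ (univ : Set M),
      geodParam t (mat I α x) (mat I ζ x) ∈ timeDomain := by
    refine isCompact_univ.eventually_forall_of_forall_eventually (P := fun t x =>
      geodParam t (mat I α x) (mat I ζ x) ∈ timeDomain) fun x _ => ?_
    have h1 := continuousAt_of_invariant (hsα 0 x) (hsζ 0 x) (hsα 0 x) (hsα 0 x) (hsα 0 x)
      (fun q => (geodParam 0 q.1 q.2.1).2)
      (by
        have h2 := contDiffAt_geodParam (p := ((0 : ℝ), mat I α x, mat I ζ x)) (hα' x)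
        have h3 : ContinuousAt (fun q : Mat n m × Mat n m × Mat n m × Mat n m × Mat n m =>
            ((0 : ℝ), q.1, q.2.1))
            (mat I α x, mat I ζ x, mat I α x, mat I α x, mat I α x) := by fun_prop
        exact (ContinuousAt.comp (x := (mat I α x, mat I ζ x, mat I α x, mat I α x, mat I α x))
          h2.continuousAt h3).snd)
      (fun a b c d r E hE => by rw [geodParam_mul _ _ _ hE])
    have h2 : ContinuousAt (fun p : ℝ × M => geodParam p.1 (mat I α p.2) (mat I ζ p.2)) (0, x) :=
      continuousAt_fst.prodMk h1
    exact h2.eventually (isOpen_timeDomain.mem_nhds (zero_mem_timeDomain _))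
  obtain ⟨ε, hε, hεb⟩ := Metric.eventually_nhds_iff.1 hev
  have hdom : ∀ t ∈ Ioo (-ε) ε, ∀ x, geodParam t (mat I α x) (mat I ζ x) ∈ timeDomain :=
    fun t ht x => hεb (by rw [Real.dist_eq, sub_zero, abs_lt]; exact ht) x (mem_univ x)
  have hS : ∀ t ∈ Ioo (-ε) ε, ∀ x,
      SmoothFamilyAt I (fun t x => geodSol t (mat I α x) (mat I ζ x)) t x := fun t ht x =>
    (hsα t x).map₂ (hsζ t x) (fun p => geodSol p.1 p.2.1 p.2.2)
      (contDiffAt_geodSol (p := (t, mat I α x, mat I ζ x)) (hα' x) (hdom t ht x))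
      fun t a u E hE => geodSol_mul t a u hE
  have hex : ∀ t, ∃ β : OneForm I M n, t ∈ Ioo (-ε) ε →
      ∀ x, mat I β x = geodSol t (mat I α x) (mat I ζ x) := by
    intro t
    by_cases ht : t ∈ Ioo (-ε) ε
    · obtain ⟨β, hβ⟩ := exists_mat_eq (hS t ht)
      exact ⟨β, fun _ => hβ⟩
    · exact ⟨0, fun h => absurd h ht⟩
  choose c hc using hex
  have h0 : (0 : ℝ) ∈ Ioo (-ε) ε := ⟨by linarith, hε⟩
  have hsol : ∀ x, ∃ V : ℝ → Mat n m, V 0 = mat I ζ x ∧ ∀ t ∈ Ioo (-ε) ε,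
      HasDerivAt (fun t => mat I (c t) x) (V t) t ∧
      HasDerivAt V (geodF (mat I (c t) x) (V t)) t := by
    intro x
    obtain ⟨V, hV0, hV⟩ := exists_velocity_geodSol (hα' x) (hζ x)
    refine ⟨V, hV0, fun t ht => ⟨?_, ?_⟩⟩
    · refine (hV t (hdom t ht x)).1.congr_of_eventuallyEq ?_
      filter_upwards [isOpen_Ioo.mem_nhds ht] with s hs using hc s hs x
    · rw [hc t ht x]
      exact (hV t (hdom t ht x)).2
  refine ⟨ε, hε, c, ?_, ?_, fun t ht x => ⟨hdom t ht x, hc t ht x⟩, ?_, ?_, ?_⟩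
  · exact (smoothCurveOn_iff isOpen_Ioo).2 fun t ht x =>
      (hS t ht x).congr_of_forall isOpen_Ioo ht hc
  · intro t ht
    rw [mem_fullRank_iff]
    intro x
    obtain ⟨E, hE, hEa⟩ := exists_geodSol_eq_mul (hα' x) (hζ x) (hdom t ht x)
    rw [hc t ht x, hEa, gram_mul_det]
    exact mul_pos (hα' x) (by positivity)
  · exact mat_injective fun x => by rw [hc 0 h0 x, geodSol_zero]
  · rw [hasVelocityAt_iff]
    intro x
    obtain ⟨V, hV0, hV⟩ := hsol x
    rw [← hV0]
    exact (hV 0 h0).1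
  · intro t ht x
    obtain ⟨V, hV0, hV⟩ := hsol x
    have e1 : ∀ s ∈ Ioo (-ε) ε, velMat c s x = V s := fun s hs => (hV s hs).1.deriv
    have e2 : accMat c t x = geodF (mat I (c t) x) (V t) := by
      refine ((hV t ht).2.congr_of_eventuallyEq ?_).deriv
      filter_upwards [isOpen_Ioo.mem_nhds ht] with s hs using e1 s hs
    rw [geodDefect, e2, e1 t ht, sub_self]

variable [T2Space M] [CompactSpace M]

/-- The geodesic equation for the geodesics of an open subset of a linear space of one-forms that
contains their covariant accelerations. -/
theorem geodDefect_eq_zero_of_isGeodesicIn_inter {E : Submodule ℝ (OneForm I M n)}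
    {U N : Set (OneForm I M n)} (hN : N = (E : Set (OneForm I M n)) ∩ U) (hUf : U ⊆ fullRank I)
    (hU : SmoothlyOpen U) {J : Set ℝ} {c : ℝ → OneForm I M n} (hc : IsGeodesicIn I N J c)
    (hE : ∀ t ∈ J, ∀ θ : OneForm I M n, (∀ x, mat I θ x = geodDefect c t x) → θ ∈ E) :
    ∀ t ∈ J, ∀ x, geodDefect c t x = 0 := by
  have hcN : ∀ t ∈ J, c t ∈ E ∧ c t ∈ U := fun t ht => by
    have := hc.mem t ht
    rwa [hN] at this
  refine geodDefect_eq_zero_of_isGeodesicIn (by rw [hN]; exact inter_subset_right.trans hUf) hc ?_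
  intro χ θ hχ hχc hχJ hθ hΓ
  obtain ⟨Γ, hΓdef⟩ : ∃ Γ : ℝ → ℝ → OneForm I M n, Γ = fun s t => c t + (s * χ t) • θ t := ⟨_, rfl⟩
  have hΓE : ∀ s, ∀ t ∈ J, Γ s t ∈ E := fun s t ht => by
    rw [hΓdef]
    exact E.add_mem (hcN t ht).1 (E.smul_mem _ (hE t ht (θ t) (hθ t ht)))
  have hzero : ∀ s t : ℝ, s * χ t = 0 → Γ s t = c t := fun s t hr => mat_injective fun x => by
    rw [hΓdef]
    simp only
    rw [mat_add_smul, hr, zero_smul, add_zero]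
  suffices h : ∃ ε > 0, ∀ s ∈ Ioo (-ε) ε, ∀ t ∈ J, Γ s t ∈ N by
    rw [hΓdef] at h
    exact h
  rw [← hΓdef] at hΓ
  have hopen := hU (Γ := fun z : ℝ × ℝ => Γ z.1 z.2)
    (isOpen_univ.prod hc.isOpen) ((smoothFamilyOn_iff isOpen_univ hc.isOpen).1 hΓ)
  -- Membership in `E` is automatic by linearity. Membership in `U` is needed only on the compact
  -- support of `χ`, since elsewhere the variation equals `c`.
  have hev : ∀ᶠ s in 𝓝 (0 : ℝ), ∀ t ∈ tsupport χ, Γ s t ∈ U := by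
    refine IsCompact.eventually_forall_of_forall_eventually (P := fun s t => Γ s t ∈ U) hχc
      fun t ht => ?_
    have hmem : ((0 : ℝ), t) ∈ {z : ℝ × ℝ | z ∈ univ ×ˢ J ∧ Γ z.1 z.2 ∈ U} :=
      ⟨⟨mem_univ _, hχJ ht⟩, by
        rw [hzero 0 t (zero_mul _)]
        exact (hcN t (hχJ ht)).2⟩
    filter_upwards [hopen.mem_nhds hmem] with z hz using hz.2
  obtain ⟨ε, hε, hεb⟩ := Metric.eventually_nhds_iff.1 hev
  refine ⟨ε, hε, fun s hs t ht => ?_⟩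
  rw [hN]
  refine ⟨hΓE s t ht, ?_⟩
  by_cases hts : t ∈ tsupport χ
  · exact hεb (by rw [Real.dist_eq, sub_zero, abs_lt]; exact hs) t hts
  · rw [hzero s t (by rw [image_eq_zero_of_notMem_tsupport hts, mul_zero])]
    exact (hcN t ht).2

theorem geodDefect_eq_zero_of_isGeodesicIn_fullRank {J : Set ℝ} {c : ℝ → OneForm I M n}
    (hc : IsGeodesicIn I (fullRank I) J c) : ∀ t ∈ J, ∀ x, geodDefect c t x = 0 :=
  geodDefect_eq_zero_of_isGeodesicIn_inter (E := ⊤) (U := fullRank I) (by simp) Subset.rfl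
    smoothlyOpen_fullRank hc fun _ _ _ _ => Submodule.mem_top

/-- An open subset of a split linear space `E` of one-forms is totally geodesic if the geodesic
equation preserves `E`. -/
theorem isTotallyGeodesic_of_inter {E : Submodule ℝ (OneForm I M n)}
    {U N : Set (OneForm I M n)} (hN : N = (E : Set (OneForm I M n)) ∩ U) (hUf : U ⊆ fullRank I)
    (hU : SmoothlyOpen U) (P : OneForm I M n →ₗ[ℝ] OneForm I M n) (hP : SmoothMapOn I univ P)
    (hPP : P ∘ₗ P = P) (hPE : LinearMap.range P = E)
    (hT : ∀ J : Set ℝ, IsOpen J → ∀ c : ℝ → OneForm I M n, SmoothCurveOn I J c →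
      (∀ t ∈ J, c t ∈ E) → ∀ t ∈ J, ∀ ζ, HasVelocityAt I c ζ t → ζ ∈ E)
    (hR : ∀ α ∈ E, α ∈ U → ∀ ζ ∈ E, ∀ x,
      toEnd (mat I α x) (mat I α x) * mat I ζ x = mat I ζ x)
    (hF : ∀ α ∈ E, α ∈ U → ∀ ζ ∈ E, ∀ ξ ∈ E, ∀ θ : OneForm I M n,
      (∀ x, mat I θ x = mat I ξ x - geodF (mat I α x) (mat I ζ x)) → θ ∈ E)
    (hX : ∀ α ∈ E, α ∈ U → ∀ ζ ∈ E, ∀ (t : ℝ) (β : OneForm I M n),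
      (∀ x, geodParam t (mat I α x) (mat I ζ x) ∈ timeDomain ∧
        mat I β x = geodSol t (mat I α x) (mat I ζ x)) → β ∈ E) :
    IsTotallyGeodesic I N := by
  have hNE : ∀ α ∈ N, α ∈ E ∧ α ∈ U := fun α hα => by rwa [hN] at hα
  have hNf : N ⊆ fullRank I := fun α hα => hUf (hNE α hα).2
  have htan : ∀ α, ∀ ζ ∈ tangentVectors I N α, ζ ∈ E := by
    rintro α ζ ⟨ε, hε, c, hc, hcN, -, hv⟩
    exact hT _ isOpen_Ioo c hc (fun t ht => (hNE _ (hcN t ht)).1) 0 ⟨by linarith, hε⟩ ζ hv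
  -- The explicit geodesic stays in `E` by `hX`, and in `U` for a possibly shorter time by openness.
  have hex : ∀ α ∈ N, ∀ ζ ∈ E, ∃ ε > 0, ∃ c : ℝ → OneForm I M n,
      SmoothCurveOn I (Ioo (-ε) ε) c ∧ (∀ t ∈ Ioo (-ε) ε, c t ∈ N) ∧ c 0 = α ∧
      HasVelocityAt I c ζ 0 ∧ ∀ t ∈ Ioo (-ε) ε, ∀ x, geodDefect c t x = 0 := by
    intro α hα ζ hζ
    obtain ⟨hαE, hαU⟩ := hNE α hα
    obtain ⟨ε, hε, c, hc, -, hsol, hc0, hv, hd⟩ :=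
      exists_explicit_geodesic (hNf hα) (hR α hαE hαU ζ hζ)
    have h0 : (0 : ℝ) ∈ Ioo (-ε) ε := ⟨by linarith, hε⟩
    have hopen := hU (Γ := c) isOpen_Ioo ((smoothCurveOn_iff isOpen_Ioo).1 hc)
    obtain ⟨δ, hδ, hδb⟩ := Metric.isOpen_iff.1 hopen 0 ⟨h0, by rw [hc0]; exact hαU⟩
    have hδ' : ∀ t ∈ Ioo (-δ) δ, t ∈ Ioo (-ε) ε ∧ c t ∈ U := fun t ht =>
      hδb (by rw [Metric.mem_ball, Real.dist_eq, sub_zero, abs_lt]; exact ht)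
    refine ⟨δ, hδ, c, ContMDiffOn.mono hc
      (prod_mono (fun t ht => (hδ' t ht).1) Subset.rfl), ?_, hc0, hv,
      fun t ht => hd t (hδ' t ht).1⟩
    intro t ht
    rw [hN]
    exact ⟨hX α hαE hαU ζ hζ t (c t) (hsol t (hδ' t ht).1), (hδ' t ht).2⟩
  refine ⟨⟨hNf, fun α hα => ?_⟩, ?_, ?_, ?_⟩
  · refine ⟨U, U, id, id, P, (hNE α hα).2, hUf, hU.isOpenSet, hU.isOpenSet,
      fun c hc _ => hc, fun c hc _ => hc, mapsTo_id _, mapsTo_id _,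
      ⟨fun _ _ => rfl, fun _ _ => rfl⟩, hP, hPP, ?_⟩
    rw [image_id, hPE, hN, inter_assoc, inter_self]
  · intro J c hc
    have hcN := hc.mem
    refine isGeodesicIn_of_geodDefect_eq_zero hc.isOpen hc.ordConnected hc.smooth
      (fun t ht => hNf (hcN t ht)) ?_
    refine geodDefect_eq_zero_of_isGeodesicIn_inter hN hUf hU hc fun t ht θ hθ => ?_
    -- First and second derivatives of a curve in `E` are in `E` by two applications of `hT`; then
    -- `hF` puts the covariant acceleration in `E`.
    obtain ⟨ζ, hζs, hζ⟩ := exists_velocity_curve hc.isOpen hc.smooth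
    obtain ⟨ξ, -, hξ⟩ := exists_velocity_curve hc.isOpen hζs
    have hζE : ∀ t ∈ J, ζ t ∈ E := fun t ht =>
      hT J hc.isOpen c hc.smooth (fun t ht => (hNE _ (hcN t ht)).1) t ht _ (hζ t ht)
    have hξE : ξ t ∈ E := hT J hc.isOpen ζ hζs hζE t ht _ (hξ t ht)
    obtain ⟨hcE, hcU⟩ := hNE _ (hcN t ht)
    refine hF (c t) hcE hcU (ζ t) (hζE t ht) (ξ t) hξE θ fun x => ?_
    rw [hθ x, geodDefect, velMat_eq_of_hasVelocityAt (hζ t ht)]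
    congr 1
    rw [← velMat_eq_of_hasVelocityAt (hξ t ht)]
    refine Filter.EventuallyEq.deriv_eq ?_
    filter_upwards [hc.isOpen.mem_nhds ht] with s hs
    exact velMat_eq_of_hasVelocityAt (hζ s hs) x
  · intro α hα ζ hζ
    obtain ⟨ε, hε, c, hc, hcN, hc0, hv, hd⟩ := hex α hα ζ (htan α ζ hζ)
    exact ⟨ε, hε, c, isGeodesicIn_of_geodDefect_eq_zero isOpen_Ioo ordConnected_Ioo hc
      (fun t ht => hNf (hcN t ht)) hd, hc0, hv, hcN⟩
  · rintro J c hc h0 hcN ⟨ζ, hζ, hv⟩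
    obtain ⟨ε, hε, c', hc', hcN', hc0', hv', hd'⟩ := hex (c 0) hcN ζ (htan _ ζ hζ)
    refine ⟨ε, hε, fun t ht => ?_⟩
    have heq := eq_of_geodDefect_eq_zero (hc.isOpen.inter isOpen_Ioo)
      (hc.ordConnected.inter ordConnected_Ioo)
      (ContMDiffOn.mono hc.smooth (prod_mono (inter_subset_left (t := Ioo (-ε) ε)) Subset.rfl))
      (ContMDiffOn.mono hc' (prod_mono (inter_subset_right (s := J)) Subset.rfl))
      (fun t ht => hc.mem t ht.1)
      (fun t ht => geodDefect_eq_zero_of_isGeodesicIn_fullRank hc t ht.1)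
      (fun t ht => hd' t ht.2) (t₀ := 0) ⟨h0, by linarith, hε⟩ hc0'.symm
      (fun x => by rw [velMat_eq_of_hasVelocityAt hv, velMat_eq_of_hasVelocityAt hv'])
    rw [heq t ht]
    exact hcN' t ht.2

end TotallyGeodesic

/-! ### The rays of scalings -/

section Scalings

open Filter Topology
open scoped Matrix.Norms.Operator

variable {m n : ℕ}

theorem toEnd_smul_right (a u : Mat n m) (r : ℝ) : toEnd a (r • u) = r • toEnd a u := by
  simp only [toEnd, Matrix.smul_mul]

theorem geodF_smul_self {a : Mat n m} (ha : 0 < (aᵀ * a).det) (r : ℝ) :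
    geodF a (r • a) = (r ^ 2 * (1 - m / 2)) • a := by
  have hPa := toEnd_mul_self ha a
  have h1 : r • a = (r • (1 : Mat n n)) * a := by rw [Matrix.smul_mul, Matrix.one_mul]
  rw [h1, geodF_mul_left]
  simp only [Matrix.transpose_smul, Matrix.transpose_one, Matrix.smul_mul, Matrix.mul_smul,
    Matrix.one_mul, Matrix.mul_one, Matrix.add_mul, Matrix.sub_mul, Matrix.trace_smul,
    trace_toEnd_self ha, hPa, smul_eq_mul, smul_smul]
  module

/-- Here the endomorphism is `r P`, symmetric and without trace-free part, so both exponents vanish.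
The remaining factor does not involve `a`, so it is the same at every point of `M`. -/
theorem geodSol_smul_self {a : Mat n m} (ha : 0 < (aᵀ * a).det) (t r : ℝ) :
    geodSol t a (r • a) = volFactor (t, r * m, m * (r ^ 2 * m) / 4) ^ (1 / (m : ℝ)) • a := by
  rcases Nat.eq_zero_or_pos m with rfl | hm
  · exact Subsingleton.elim _ _
  have hm' : (m : ℝ) ≠ 0 := Nat.cast_ne_zero.2 hm.ne'
  have hX := toEnd_smul_right a a r
  have hPt := toEnd_self_transpose a
  have hPP : toEnd a a * toEnd a a = toEnd a a := by rw [toEnd_mul_toEnd, toEnd_mul_self ha]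
  have htr := trace_toEnd_self ha
  have h1 : geodSkew a (r • a) = 0 := by
    rw [geodSkew, hX, Matrix.transpose_smul, hPt, sub_self]
  have h2 : geodTraceFree a (r • a) = 0 := by
    rw [geodTraceFree, hX, Matrix.transpose_smul, hPt, Matrix.trace_smul, htr, smul_eq_mul,
      mul_div_assoc, div_self hm', mul_one, sub_self]
  have h3 : geodParam t a (r • a) = (t, r * m, m * (r ^ 2 * m) / 4) := by
    rw [geodParam, hX, Matrix.transpose_smul, hPt, Matrix.smul_mul, Matrix.mul_smul, hPP,
      smul_smul, Matrix.trace_smul, Matrix.trace_smul, htr, smul_eq_mul, smul_eq_mul, sq]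
  rw [geodSol, h1, h2, h3, smul_zero, NormedSpace.exp_zero, Matrix.one_mul, Matrix.one_mul]

variable {H : Type*} [TopologicalSpace H] {I : ModelWithCorners ℝ (Euc m) H}
  {M : Type*} [TopologicalSpace M] [ChartedSpace H M] [IsManifold I ∞ M]

/-- The linear map that takes a one-form to its matrix at a point. -/
def matLin (x : M) : OneForm I M n →ₗ[ℝ] Mat n m where
  toFun α := mat I α x
  map_add' α β := by
    have h1 : mat I (α + β) x = toMat n m ((show Euc m →L[ℝ] Euc n from α x) +
      (show Euc m →L[ℝ] Euc n from β x)) := rfl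
    rw [h1, map_add]
    rfl
  map_smul' r α := by
    have h1 : mat I (r • α) x = toMat n m (r • (show Euc m →L[ℝ] Euc n from α x)) := rfl
    rw [h1, map_smul]
    rfl

theorem mat_smul (r : ℝ) (α : OneForm I M n) (x : M) : mat I (r • α) x = r • mat I α x :=
  (matLin x).map_smul r α

variable [T2Space M] [CompactSpace M]

theorem isTotallyGeodesic_of_subsingleton (hsub : ∀ _ : M, Subsingleton (Mat n m))
    (N : Set (OneForm I M n)) (hN : N = fullRank I) : IsTotallyGeodesic I N :=
  isTotallyGeodesic_of_inter (E := ⊤) (U := fullRank I) (by simp [hN]) Subset.rfl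
    smoothlyOpen_fullRank LinearMap.id (fun _ hc _ => hc) rfl LinearMap.range_id
    (fun _ _ _ _ _ _ _ _ _ => Submodule.mem_top)
    (fun _ _ _ _ _ x => (hsub x).elim _ _)
    (fun _ _ _ _ _ _ _ _ _ => Submodule.mem_top)
    (fun _ _ _ _ _ _ _ _ => Submodule.mem_top)

theorem isTotallyGeodesic_scalings (α₀ : OneForm I M n) (hα₀ : α₀ ∈ fullRank I) :
    IsTotallyGeodesic I (scalings I α₀) := by
  have hα₀' := (mem_fullRank_iff α₀).1 hα₀
  -- A full-ranked form vanishes identically only if `m = 0` or `M` is empty. Then there is a single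
  -- one-form and no functional with value `1` on `α₀`, so this case is separate.
  by_cases hne : ∃ x₀, mat I α₀ x₀ ≠ 0
  swap
  · push Not at hne
    have hsub : ∀ _ : M, Subsingleton (Mat n m) := by
      intro x
      have h := hα₀' x
      rw [hne x] at h
      rcases Nat.eq_zero_or_pos m with rfl | hm
      · infer_instance
      · have : Nonempty (Fin m) := ⟨⟨0, hm⟩⟩
        rw [Matrix.mul_zero, Matrix.det_zero] at h
        exact absurd h (lt_irrefl 0)
    have hall : ∀ α β : OneForm I M n, α = β := fun α β =>
      mat_injective fun x => (hsub x).elim _ _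
    refine isTotallyGeodesic_of_subsingleton hsub _ (Set.ext fun α => ?_)
    rw [hall α α₀]
    exact ⟨fun _ => hα₀, fun _ => ⟨1, one_pos, hall _ _⟩⟩
  obtain ⟨x₀, hx₀⟩ := hne
  obtain ⟨k, j, hkj⟩ : ∃ k j, mat I α₀ x₀ k j ≠ 0 := by
    by_contra! h
    exact hx₀ (Matrix.ext h)
  -- A nonzero entry of `α₀` at `x₀`, normalised so that `ℓ α₀ = 1`. The functional gives the
  -- projection `α ↦ ℓ α • α₀` to the line, and the condition `0 < ℓ` cuts out the positive ray.
  let L : Mat n m →L[ℝ] ℝ := (mat I α₀ x₀ k j)⁻¹ • entryL n m k j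
  let ℓ : OneForm I M n →ₗ[ℝ] ℝ := L.toLinearMap ∘ₗ matLin x₀
  have hℓ : ∀ α, ℓ α = L (mat I α x₀) := fun _ => rfl
  have hℓ₀ : ℓ α₀ = 1 := inv_mul_cancel₀ hkj
  have hℓr : ∀ r : ℝ, ℓ (r • α₀) = r := fun r => by rw [map_smul, hℓ₀, smul_eq_mul, mul_one]
  have hℓc : ∀ {Z : Type} [NormedAddCommGroup Z] [NormedSpace ℝ Z] {Γ : Z → OneForm I M n} {z : Z},
      SmoothFamilyAt I (fun z x => mat I (Γ z) x) z x₀ → ContDiffAt ℝ ∞ (fun z => ℓ (Γ z)) z :=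
    fun h => L.contDiff.contDiffAt.comp _ h.contDiffAt
  have hE : ∀ {α : OneForm I M n}, α ∈ Submodule.span ℝ {α₀} → ∃ r : ℝ, r • α₀ = α :=
    fun h => Submodule.mem_span_singleton.1 h
  have hpos : ∀ r : ℝ, 0 < ℓ (r • α₀) → 0 < r := fun r h => by rwa [hℓr] at h
  have hdet : ∀ r : ℝ, 0 < r → ∀ x, 0 < ((r • mat I α₀ x)ᵀ * (r • mat I α₀ x)).det := by
    intro r hr x
    rw [Matrix.transpose_smul, Matrix.smul_mul, Matrix.mul_smul, smul_smul, Matrix.det_smul]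
    exact mul_pos (pow_pos (mul_pos hr hr) _) (hα₀' x)
  have hmul : ∀ r q : ℝ, 0 < r → ∀ x, q • mat I α₀ x = (q / r) • (r • mat I α₀ x) :=
    fun r q hr x => by rw [smul_smul, div_mul_cancel₀ _ hr.ne']
  refine isTotallyGeodesic_of_inter (E := Submodule.span ℝ {α₀})
    (U := {α | α ∈ fullRank I ∧ 0 < ℓ α}) ?_ (fun α h => h.1) ?_
    (LinearMap.toSpanSingleton ℝ (OneForm I M n) α₀ ∘ₗ ℓ) ?_ ?_ ?_
    ?_ ?_ ?_ ?_
  · ext α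
    constructor
    · rintro ⟨t, ht, rfl⟩
      refine ⟨Submodule.smul_mem _ _ (Submodule.mem_span_singleton_self α₀), ?_, by
        rw [hℓr]; exact ht⟩
      rw [mem_fullRank_iff]
      intro x
      rw [mat_smul]
      exact hdet t ht x
    · rintro ⟨h1, -, h2⟩
      obtain ⟨r, rfl⟩ := hE h1
      exact ⟨r, hpos r h2, rfl⟩
  · intro Z _ _ S Γ hS hΓ
    have h1 : ContinuousOn (fun z => ℓ (Γ z)) S := fun z hz =>
      (hℓc (hΓ z hz x₀)).continuousAt.continuousWithinAt
    have h2 := (h1.isOpen_inter_preimage hS isOpen_Ioi (t := Ioi (0 : ℝ))).inter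
      (smoothlyOpen_fullRank hS hΓ)
    convert h2 using 1
    ext z
    constructor
    · rintro ⟨h3, h4, h5⟩
      exact ⟨⟨h3, h5⟩, h3, h4⟩
    · rintro ⟨⟨h3, h5⟩, -, h4⟩
      exact ⟨h3, h4, h5⟩
  · intro c hc _
    rw [smoothCurveOn_iff isOpen_univ] at hc ⊢
    intro t ht x
    have h1 := (smoothFamilyAt_const α₀ t x).map₂ (smoothFamilyAt_const α₀ t x)
      (fun q => ℓ (c q.1) • q.2.1)
      (ContDiffAt.smul (ContDiffAt.comp (t, mat I α₀ x, mat I α₀ x) (hℓc (hc t ht x₀))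
        contDiffAt_fst) (by fun_prop))
      (fun z a u E _ => (Matrix.smul_mul _ _ _).symm)
    exact h1.congr_of_forall isOpen_univ (mem_univ t) fun t _ x => mat_smul _ _ _
  · ext1 α
    simp only [LinearMap.comp_apply, LinearMap.toSpanSingleton_apply, hℓr]
  · ext α
    rw [Submodule.mem_span_singleton]
    constructor
    · rintro ⟨β, rfl⟩
      exact ⟨ℓ β, rfl⟩
    · rintro ⟨r, rfl⟩
      exact ⟨r • α₀, by rw [LinearMap.comp_apply, LinearMap.toSpanSingleton_apply, hℓr]⟩
  · intro J hJ c hc hcE t ht ζ hζ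
    rw [Submodule.mem_span_singleton]
    refine ⟨ℓ ζ, mat_injective fun x => ?_⟩
    rw [hasVelocityAt_iff] at hζ
    have h1 : HasDerivAt (fun t => ℓ (c t)) (ℓ ζ) t := L.hasFDerivAt.comp_hasDerivAt t (hζ x₀)
    have h2 : HasDerivAt (fun t => mat I (c t) x) (ℓ ζ • mat I α₀ x) t := by
      refine (h1.smul_const (mat I α₀ x)).congr_of_eventuallyEq ?_
      filter_upwards [hJ.mem_nhds ht] with s hs
      obtain ⟨r, hr⟩ := hE (hcE s hs)
      rw [← hr, hℓr, mat_smul]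
    rw [mat_smul]
    exact h2.unique (hζ x)
  · rintro α hα ⟨-, hU⟩ ζ hζ x
    obtain ⟨r, rfl⟩ := hE hα
    obtain ⟨q, rfl⟩ := hE hζ
    have hr := hpos r hU
    rw [mat_smul, mat_smul, hmul r q hr, Matrix.mul_smul, toEnd_mul_self (hdet r hr x)]
  · rintro α hα ⟨-, hU⟩ ζ hζ ξ hξ θ hθ
    obtain ⟨r, rfl⟩ := hE hα
    obtain ⟨q, rfl⟩ := hE hζ
    obtain ⟨p, rfl⟩ := hE hξ
    have hr := hpos r hU
    rw [Submodule.mem_span_singleton]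
    refine ⟨p - (q / r) ^ 2 * (1 - m / 2) * r, mat_injective fun x => ?_⟩
    rw [hθ x, mat_smul, mat_smul, mat_smul, mat_smul, hmul r q hr,
      geodF_smul_self (hdet r hr x), smul_smul, sub_smul]
  · rintro α hα ⟨-, hU⟩ ζ hζ t β hβ
    obtain ⟨r, rfl⟩ := hE hα
    obtain ⟨q, rfl⟩ := hE hζ
    have hr := hpos r hU
    rw [Submodule.mem_span_singleton]
    refine ⟨volFactor (t, q / r * m, m * ((q / r) ^ 2 * m) / 4) ^ (1 / (m : ℝ)) * r,
      mat_injective fun x => ?_⟩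
    rw [(hβ x).2, mat_smul, mat_smul, mat_smul, hmul r q hr, geodSol_smul_self (hdet r hr x),
      smul_smul]

end Scalings

/-! ### Forms with prescribed image planes -/

section FixedPlanes

open Filter Topology
open scoped Matrix.Norms.Operator

variable {m n : ℕ} {H : Type*} [TopologicalSpace H] {I : ModelWithCorners ℝ (Euc m) H}
  {M : Type*} [TopologicalSpace M] [ChartedSpace H M] [IsManifold I ∞ M]

/-- The matrix of the orthogonal projection to the plane `f x`. -/
def planeProj (f : M → Gr m n) (x : M) : Mat n n :=
  toMat n n ((f x).1.starProjection : Euc n →L[ℝ] Euc n)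

omit [TopologicalSpace M] in
theorem planeProj_mul_self (f : M → Gr m n) (x : M) :
    planeProj f x * planeProj f x = planeProj f x := by
  rw [planeProj, ← toMat_comp]
  congr 1
  ext1 v
  exact Submodule.starProjection_eq_self_iff.2 (Submodule.starProjection_apply_mem _ v)

theorem planeProj_mul_mat_iff (f : M → Gr m n) (α : OneForm I M n) (x : M) :
    planeProj f x * mat I α x = mat I α x ↔ ∀ v : TangentSpace I x, (α x v : Euc n) ∈ (f x).1 := by
  rw [planeProj, mat, ← toMat_comp, (toMat n m).injective.eq_iff, ContinuousLinearMap.ext_iff]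
  exact forall_congr' fun v => Submodule.starProjection_eq_self_iff

theorem smoothFamilyAt_planeProj_mul {f : M → Gr m n} (hf : SmoothGr I f) {Z : Type*}
    [NormedAddCommGroup Z] [NormedSpace ℝ Z] {A : Z → M → Mat n m} {z : Z} {x : M}
    (hA : SmoothFamilyAt I A z x) : SmoothFamilyAt I (fun z x => planeProj f x * A z x) z x := by
  have h1 : ContMDiffAt (𝓘(ℝ, Z).prod I) 𝓘(ℝ, Euc n →L[ℝ] Euc n) ∞
      (fun p : Z × M => ((f p.2).1.starProjection : Euc n →L[ℝ] Euc n)) (z, x) :=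
    (hf x).comp (z, x) contMDiffAt_snd
  have h2 : ContMDiffAt (𝓘(ℝ, Z).prod I) 𝓘(ℝ, Euc m →L[ℝ] Euc n) ∞
    (fun p : Z × M => (toMat n m).symm (A p.1 p.2 * frame I x p.2)) (z, x) := hA
  refine (h1.clm_comp h2).congr_of_eventuallyEq (Eventually.of_forall fun p => ?_)
  simp only
  rw [ContinuousLinearEquiv.symm_apply_eq, toMat_comp, ContinuousLinearEquiv.apply_symm_apply,
    planeProj, Matrix.mul_assoc]

/-- The one-forms with values in the planes `f x`. -/
def planeForms (I : ModelWithCorners ℝ (Euc m) H) [IsManifold I ∞ M] (f : M → Gr m n) :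
    Submodule ℝ (OneForm I M n) where
  carrier := {α | ∀ x, planeProj f x * mat I α x = mat I α x}
  zero_mem' x := by
    have h : mat I (0 : OneForm I M n) x = 0 := (matLin x).map_zero
    rw [h, Matrix.mul_zero]
  add_mem' {α β} hα hβ x := by
    have h : mat I (α + β) x = mat I α x + mat I β x := (matLin x).map_add α β
    rw [h, Matrix.mul_add, hα x, hβ x]
  smul_mem' r α hα x := by
    rw [mat_smul, Matrix.mul_smul, hα x]

theorem exists_planeProjection {f : M → Gr m n} (hf : SmoothGr I f) :
    ∃ P : OneForm I M n →ₗ[ℝ] OneForm I M n, ∀ α x, mat I (P α) x = planeProj f x * mat I α x := by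
  have hex : ∀ α : OneForm I M n, ∃ β : OneForm I M n, ∀ x,
      mat I β x = planeProj f x * mat I α x := fun α =>
    exists_mat_eq (A := fun (_ : ℝ) x => planeProj f x * mat I α x) (z := 0) fun x =>
      smoothFamilyAt_planeProj_mul hf (smoothFamilyAt_const α 0 x)
  choose P hP using hex
  refine ⟨⟨⟨P, fun α β => mat_injective fun x => ?_⟩, fun r α => mat_injective fun x => ?_⟩, hP⟩
  · have h : ∀ α β : OneForm I M n, mat I (α + β) x = mat I α x + mat I β x := (matLin x).map_add
    rw [hP, h, h, Matrix.mul_add, hP, hP]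
  · change mat I (P (r • α)) x = mat I (r • P α) x
    rw [hP, mat_smul, mat_smul, Matrix.mul_smul, hP]

/-- Inclusion suffices because both spaces have dimension `m`. Thus the nonlinear condition on the
image plane becomes a linear one on full-ranked forms. -/
theorem range_eq_of_mem_planeForms {f : M → Gr m n} {α : OneForm I M n} (hα : α ∈ fullRank I)
    (hf : α ∈ planeForms I f) (x : M) :
    LinearMap.range ((α x : TangentSpace I x →L[ℝ] Euc n) : TangentSpace I x →ₗ[ℝ] Euc n) =
      (f x).1 := by
  refine Submodule.eq_of_le_of_finrank_eq ?_ ?_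
  · rintro _ ⟨v, rfl⟩
    exact (planeProj_mul_mat_iff f α x).1 (hf x) v
  · rw [(f x).2]
    exact (imagePlane I α hα x).2

theorem fixedPlanes_eq (f : M → Gr m n) :
    fixedPlanes I f = (planeForms I f : Set (OneForm I M n)) ∩ fullRank I := by
  ext α
  constructor
  · rintro ⟨hα, rfl⟩
    exact ⟨fun x => (planeProj_mul_mat_iff _ α x).2 fun v => ⟨v, rfl⟩, hα⟩
  · rintro ⟨h1, hα⟩
    exact ⟨hα, funext fun x => Subtype.ext (range_eq_of_mem_planeForms hα h1 x)⟩

/-- The columns of `ζ` at `x` lie in `f x`, which is the range of `α x`, so `ζ = α B` at `x` for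
some matrix `B`, and the projection fixes `α`. -/
theorem toEnd_mul_of_mem_planeForms {f : M → Gr m n} {α ζ : OneForm I M n} (hα : α ∈ fullRank I)
    (hαf : α ∈ planeForms I f) (hζf : ζ ∈ planeForms I f) (x : M) :
    toEnd (mat I α x) (mat I α x) * mat I ζ x = mat I ζ x := by
  have hex : ∀ j : Fin m, ∃ w : Euc m, (α x w : Euc n) =
      (ζ x (EuclideanSpace.single j 1 : Euc m) : Euc n) := by
    intro j
    have h := (planeProj_mul_mat_iff f ζ x).1 (hζf x) (EuclideanSpace.single j 1 : Euc m)
    rw [← range_eq_of_mem_planeForms hα hαf x] at h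
    exact h
  choose w hw using hex
  have h1 : mat I ζ x = mat I α x * Matrix.of fun k j => w j k := by
    ext k j
    rw [mat_apply, ← hw j]
    exact (congrFun (mat_mulVec α x (w j)) k).symm
  rw [h1, ← Matrix.mul_assoc, toEnd_mul_self ((mem_fullRank_iff α).1 hα x)]

/-- Every term of `geodF` has `a` or `u` as its leftmost matrix. -/
theorem mul_geodF_of_mul {P : Mat n n} {a u : Mat n m} (ha : P * a = a) (hu : P * u = u) :
    P * geodF a u = geodF a u := by
  simp only [geodF, Matrix.mul_add, Matrix.mul_sub, Matrix.mul_smul, ← Matrix.mul_assoc, ha, hu]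

theorem isTotallyGeodesic_fixedPlanes [T2Space M] [CompactSpace M] {f : M → Gr m n}
    (hf : SmoothGr I f) : IsTotallyGeodesic I (fixedPlanes I f) := by
  obtain ⟨P, hP⟩ := exists_planeProjection hf
  refine isTotallyGeodesic_of_inter (fixedPlanes_eq f) Subset.rfl smoothlyOpen_fullRank P ?_ ?_ ?_
    ?_ ?_ ?_ ?_
  · intro c hc _
    rw [smoothCurveOn_iff isOpen_univ] at hc ⊢
    intro t ht x
    simp only [hP]
    exact smoothFamilyAt_planeProj_mul hf (hc t ht x)
  · refine LinearMap.ext fun α => mat_injective fun x => ?_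
    rw [LinearMap.comp_apply, hP, hP, ← Matrix.mul_assoc, planeProj_mul_self]
  · ext α
    constructor
    · rintro ⟨β, rfl⟩ x
      rw [hP, ← Matrix.mul_assoc, planeProj_mul_self]
    · intro hα
      exact ⟨α, mat_injective fun x => by rw [hP, hα x]⟩
  · intro J hJ c hc hcE t ht ζ hζ x
    rw [hasVelocityAt_iff] at hζ
    have h1 : HasDerivAt (fun t => mat I (c t) x) (planeProj f x * mat I ζ x) t := by
      refine (((hasDerivAt_const t (planeProj f x)).matrix_mul (hζ x)).congr_deriv
        (by rw [Matrix.zero_mul]; exact zero_add _)).congr_of_eventuallyEq ?_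
      filter_upwards [hJ.mem_nhds ht] with s hs using (hcE s hs x).symm
    exact h1.unique (hζ x)
  · exact fun α hα hU ζ hζ x => toEnd_mul_of_mem_planeForms hU hα hζ x
  · intro α hα _ ζ hζ ξ hξ θ hθ x
    rw [hθ x, Matrix.mul_sub, hξ x, mul_geodF_of_mul (hα x) (hζ x)]
  · intro α hα hU ζ hζ t β hβ x
    obtain ⟨E, -, hE⟩ := exists_geodSol_eq_mul ((mem_fullRank_iff α).1 hU x)
      (toEnd_mul_of_mem_planeForms hU hα hζ x) (hβ x).1
    rw [(hβ x).2, hE, ← Matrix.mul_assoc, hα x]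

/-- A full-ranked form with image planes `f x` is the same thing as a smooth family of isomorphisms
from `T_xM` onto `f x`, seen inside `ℝⁿ`. -/
theorem fixedPlanes_nonempty_iff (f : M → Gr m n) :
    (fixedPlanes I f).Nonempty ↔ TangentIsoPullback I f := by
  constructor
  · rintro ⟨α, hα, rfl⟩
    have hfd : ∀ x : M, FiniteDimensional ℝ (TangentSpace I x) := fun x =>
      inferInstanceAs (FiniteDimensional ℝ (Euc m))
    have hT2 : ∀ x : M, T2Space (TangentSpace I x) := fun x => inferInstanceAs (T2Space (Euc m))
    refine ⟨fun x => (LinearEquiv.ofInjective ((α x : TangentSpace I x →L[ℝ] Euc n) :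
      TangentSpace I x →ₗ[ℝ] Euc n) (hα x)).toContinuousLinearEquiv, ?_⟩
    exact α.contMDiff_toFun
  · rintro ⟨e, he⟩
    refine ⟨⟨_, he⟩, fun x v w h => (e x).injective (Subtype.ext h), ?_⟩
    funext x
    refine Subtype.ext (Submodule.ext fun y => ⟨?_, fun hy => ?_⟩)
    · rintro ⟨v, rfl⟩
      exact (e x v).2
    · exact ⟨(e x).symm ⟨y, hy⟩, congrArg Subtype.val ((e x).apply_symm_apply ⟨y, hy⟩)⟩

end FixedPlanes

end EbinOneForms

end

theorem mainTheorem9 {m n : ℕ} (hmn : m ≤ n) {H : Type*} [TopologicalSpace H]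
    (I : ModelWithCorners ℝ (EuclideanSpace ℝ (Fin m)) H)
    (M : Type*) [TopologicalSpace M] [ChartedSpace H M] [IsManifold I ∞ M]
    [T2Space M] [CompactSpace M] :
    (∀ α₀ ∈ EbinOneForms.fullRank (M := M) (n := n) I,
      EbinOneForms.IsTotallyGeodesic I (EbinOneForms.scalings I α₀)) ∧
    (∀ f₀ : M → EbinOneForms.Gr m n, EbinOneForms.SmoothGr I f₀ →
      EbinOneForms.IsTotallyGeodesic I (EbinOneForms.fixedPlanes I f₀) ∧
      ((EbinOneForms.fixedPlanes I f₀).Nonempty ↔ EbinOneForms.TangentIsoPullback I f₀)) := by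
  exact ⟨fun α₀ hα₀ => EbinOneForms.isTotallyGeodesic_scalings α₀ hα₀, fun f₀ hf₀ =>
    ⟨EbinOneForms.isTotallyGeodesic_fixedPlanes hf₀, EbinOneForms.fixedPlanes_nonempty_iff f₀⟩⟩
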